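/- Let $\ell\ge 1$ and let $x(1),\dots,x(\ell)$ be the first-order Gauss–Markov source $$x(k+1)=a_k\,x(k)+\xi(k),\qquad k=1,\dots,\ell-1,$$ where $a_1,\dots,a_{\ell-1}\in\mathbb R$ and $x(1),\xi(1),\dots,\xi(\ell-1)$ are independent zero-mean Gaussian random variables with variances $\sigma^2_{x(1)}>0$ and $\sigma^2_{\xi(k)}>0$. Let $D_1,\dots,D_\ell>0$ be a distortion schedule. Call a random vector $y=(y(1),\dots,y(\ell))$, jointly distributed with $x=(x(1),\dots,x(\ell))$ (only the joint law of $(x,y)$ matters), admissible for $(D_k)$ if it is causally related to $x$, i.e. for every $k$ the vectors $(y(1),\dots,y(k))$ and $(x(k+1),\dots,x(\ell))$ are conditionally independent given $(x(1),\dots,x(k))$, and if $\mathbb E[(y(k)-x(k))^2]\le D_k$ for $k=1,\dots,\ell$. The sequential rate-distortion function is $$R^{it}_{SRD}(D_1,\dots,D_\ell)=\inf \tfrac1\ell I(x;y)\quad\text{(in nats per sample)},$$ the infimum being over all admissible $y$. A realization is an admissible $y$ that attains this infimum. Define the effective distortions by $$d_1=\min\{\sigma^2_{x(1)},D_1\},\qquad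 d_k=\min\{a_{k-1}^2d_{k-1}+\sigma^2_{\xi(k-1)},\,D_k\},\quad k=2,\dots,\ell .$$ Procedure 1 computes real numbers $E[y_iy_j]$ and $E[y_ix_j]$, $1\le i,j\le\ell$, from the second moments $E[x_ix_j]$ of the source and from $(d_k)$, as follows. Write $x^{k}=(x_1,\dots,x_k)^T$, $y^{k}=(y_1,\dots,y_k)^T$, $K_{x^k}=E[x^k(x^k)^T]$, $K_{y^k}=E[y^k(y^k)^T]$, $K_{y^kx^k}=E[y^k(x^k)^T]$. Start with $E[y_1^2]=E[y_1x_1]=E[x_1^2]-d_1$. For $k=2,\dots,\ell$ set $$E[y^{k-1}x_k]=K_{y^{k-1}x^{k-1}}K_{x^{k-1}}^{-1}E[x^{k-1}x_k],\qquad E[y^{k-1}y_k]=E[y^{k-1}x_k],$$ $$E[y_k^2]=E[y_kx_k]=E[x_k^2]-d_k,$$ $$E[y_k(x^{k-1})^T]=E[y^kx_k]^T\begin{pmatrix}K_{y^{k-1}}&E[y^{k-1}x_k]\\E[y^{k-1}x_k]^T&E[x_k^2]\end{pmatrix}^{\dagger}\begin{bmatrix}K_{y^{k-1}x^{k-1}}\\E[x^{k-1}x_k]^T\end{bmatrix},$$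 where $\dagger$ is the Moore–Penrose pseudo-inverse (the inverse, when the matrix is nonsingular). Then: (i) $$R^{it}_{SRD}(D_1,\dots,D_\ell)=\frac1{2\ell}\ln\frac{\sigma^2_{x(1)}}{d_1}+\frac1{2\ell}\sum_{k=2}^{\ell}\ln\frac{a_{k-1}^2d_{k-1}+\sigma^2_{\xi(k-1)}}{d_k}.$$ (ii) There is a realization $y$, zero-mean and jointly Gaussian with $x$, with $\mathbb E[(y(k)-x(k))^2]=d_k$ for every $k$, whose second-order statistics $\mathbb E[yy^T]$, $\mathbb E[yx^T]$ are those computed by Procedure 1. (iii) These second-order statistics are unique: for every realization $y$ (Gaussian or not) the following are equivalent: (a) $\mathbb E[(y(k)-x(k))^2]\le d_k$ for every $k$; (b) $\mathbb E[(y(k)-x(k))\,y(j)]=0$ for all $j\le k$; (c) $\mathbb E[yy^T]$ and $\mathbb E[yx^T]$ are those computed by Procedure 1. -/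

import Mathlib

open MeasureTheory ProbabilityTheory
open scoped ENNReal NNReal Matrix

noncomputable section

/-! Moore–Penrose pseudo-inverse of a real square matrix. -/

/-- `B` is the Moore–Penrose pseudo-inverse of `A` (the four Penrose equations). -/
structure IsMoorePenrose {m : ℕ} (A B : Matrix (Fin m) (Fin m) ℝ) : Prop where
  mul_mul_self : A * B * A = A
  self_mul_mul : B * A * B = B
  symm_left : (A * B)ᵀ = A * B
  symm_right : (B * A)ᵀ = B * A

theorem IsMoorePenrose.unique {m : ℕ} {A B C : Matrix (Fin m) (Fin m) ℝ}
    (hB : IsMoorePenrose A B) (hC : IsMoorePenrose A C) : B = C := by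
  have h1 : A * B = A * C := by
    calc A * B = (A * B)ᵀ := hB.symm_left.symm
      _ = ((A * C) * (A * B))ᵀ := by
          rw [← Matrix.mul_assoc, hC.mul_mul_self]
      _ = (A * B)ᵀ * (A * C)ᵀ := Matrix.transpose_mul _ _
      _ = (A * B) * (A * C) := by rw [hB.symm_left, hC.symm_left]
      _ = A * C := by rw [← Matrix.mul_assoc, hB.mul_mul_self]
  have h2 : B * A = C * A := by
    calc B * A = (B * A)ᵀ := hB.symm_right.symm
      _ = ((B * A) * (C * A))ᵀ := by
          rw [Matrix.mul_assoc, ← Matrix.mul_assoc A, hC.mul_mul_self]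
      _ = (C * A)ᵀ * (B * A)ᵀ := Matrix.transpose_mul _ _
      _ = (C * A) * (B * A) := by rw [hB.symm_right, hC.symm_right]
      _ = C * A := by rw [Matrix.mul_assoc, ← Matrix.mul_assoc A, hB.mul_mul_self]
  calc B = B * A * B := hB.self_mul_mul.symm
    _ = C * A * C := by rw [h2, Matrix.mul_assoc, h1, Matrix.mul_assoc]
    _ = C := hC.self_mul_mul

theorem IsMoorePenrose.transpose {m : ℕ} {A B : Matrix (Fin m) (Fin m) ℝ}
    (h : IsMoorePenrose A B) : IsMoorePenrose Aᵀ Bᵀ where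
  mul_mul_self := by
    rw [← Matrix.transpose_mul, ← Matrix.transpose_mul, ← Matrix.mul_assoc, h.mul_mul_self]
  self_mul_mul := by
    rw [← Matrix.transpose_mul, ← Matrix.transpose_mul, ← Matrix.mul_assoc, h.self_mul_mul]
  symm_left := by rw [← Matrix.transpose_mul, h.symm_right, h.symm_right]
  symm_right := by rw [← Matrix.transpose_mul, h.symm_left, h.symm_left]

theorem exists_isMoorePenrose_of_isHermitian {m : ℕ} {S : Matrix (Fin m) (Fin m) ℝ}
    (hS : S.IsHermitian) : ∃ B, IsMoorePenrose S B := by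
  let U : Matrix (Fin m) (Fin m) ℝ := hS.eigenvectorUnitary
  let e : Fin m → ℝ := hS.eigenvalues
  have hU : star U * U = 1 := Unitary.coe_star_mul_self hS.eigenvectorUnitary
  have hSd : S = U * Matrix.diagonal e * star U := by
    have := hS.spectral_theorem
    rw [Unitary.conjStarAlgAut_apply] at this
    exact this
  have key : ∀ f g : Fin m → ℝ, (U * Matrix.diagonal f * star U) * (U * Matrix.diagonal g * star U)
      = U * Matrix.diagonal (fun i => f i * g i) * star U := by
    intro f g
    calc _ = U * Matrix.diagonal f * (star U * U) * Matrix.diagonal g * star U := by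
          simp only [Matrix.mul_assoc]
      _ = _ := by
          rw [hU, Matrix.mul_one, Matrix.mul_assoc U, Matrix.diagonal_mul_diagonal]
  have ht : ∀ f : Fin m → ℝ, (U * Matrix.diagonal f * star U)ᵀ
      = U * Matrix.diagonal f * star U := by
    intro f
    have hs : star U = Uᵀ := by
      rw [Matrix.star_eq_conjTranspose, Matrix.conjTranspose_eq_transpose_of_trivial]
    rw [hs, Matrix.transpose_mul, Matrix.transpose_mul, Matrix.transpose_transpose,
      Matrix.diagonal_transpose, Matrix.mul_assoc]
  refine ⟨U * Matrix.diagonal (fun i => (e i)⁻¹) * star U, ?_, ?_, ?_, ?_⟩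
  · rw [hSd, key, key]
    congr 3
    funext i
    exact mul_inv_mul_cancel (e i)
  · rw [hSd, key, key]
    congr 3
    funext i
    by_cases h : e i = 0
    · simp [h]
    · field_simp
  · rw [hSd, key, ht]
  · rw [hSd, key, ht]

theorem exists_isMoorePenrose {m : ℕ} (A : Matrix (Fin m) (Fin m) ℝ) :
    ∃ B, IsMoorePenrose A B := by
  have hS : (Aᵀ * A)ᵀ = Aᵀ * A := by rw [Matrix.transpose_mul, Matrix.transpose_transpose]
  obtain ⟨P, hP⟩ := exists_isMoorePenrose_of_isHermitian (S := Aᵀ * A)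
    (by rw [Matrix.IsHermitian, Matrix.conjTranspose_eq_transpose_of_trivial, hS])
  have hPt : Pᵀ = P := by
    have := hP.transpose
    rw [hS] at this
    exact this.unique hP
  have hz : A * (P * (Aᵀ * A) - 1) = 0 := by
    rw [← Matrix.conjTranspose_mul_self_eq_zero, Matrix.conjTranspose_eq_transpose_of_trivial,
      Matrix.transpose_mul]
    have : (Aᵀ * A) * (P * (Aᵀ * A) - 1) = 0 := by
      rw [Matrix.mul_sub, ← Matrix.mul_assoc, hP.mul_mul_self, Matrix.mul_one, sub_self]
    calc _ = (P * (Aᵀ * A) - 1)ᵀ * ((Aᵀ * A) * (P * (Aᵀ * A) - 1)) := by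
          simp only [Matrix.mul_assoc]
      _ = 0 := by rw [this, Matrix.mul_zero]
  refine ⟨P * Aᵀ, ?_, ?_, ?_, ?_⟩
  · rw [Matrix.mul_sub, Matrix.mul_one, sub_eq_zero] at hz
    calc A * (P * Aᵀ) * A = A * (P * (Aᵀ * A)) := by simp only [Matrix.mul_assoc]
      _ = A := hz
  · calc P * Aᵀ * A * (P * Aᵀ) = (P * (Aᵀ * A) * P) * Aᵀ := by simp only [Matrix.mul_assoc]
      _ = P * Aᵀ := by rw [hP.self_mul_mul]
  · rw [Matrix.transpose_mul, Matrix.transpose_mul, Matrix.transpose_transpose, hPt,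
      Matrix.mul_assoc]
  · rw [Matrix.mul_assoc, hP.symm_right]

/-- The Moore–Penrose pseudo-inverse of a real square matrix. -/
def pinv {m : ℕ} (A : Matrix (Fin m) (Fin m) ℝ) : Matrix (Fin m) (Fin m) ℝ :=
  (exists_isMoorePenrose A).choose

theorem pinv_spec {m : ℕ} (A : Matrix (Fin m) (Fin m) ℝ) : IsMoorePenrose A (pinv A) :=
  (exists_isMoorePenrose A).choose_spec

theorem pinv_eq_inv {m : ℕ} (A : Matrix (Fin m) (Fin m) ℝ) (hA : IsUnit A.det) :
    pinv A = A⁻¹ := by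
  refine (pinv_spec A).unique ⟨?_, ?_, ?_, ?_⟩
  · rw [Matrix.mul_nonsing_inv A hA, Matrix.one_mul]
  · rw [Matrix.nonsing_inv_mul A hA, Matrix.one_mul]
  · rw [Matrix.mul_nonsing_inv A hA, Matrix.transpose_one]
  · rw [Matrix.nonsing_inv_mul A hA, Matrix.transpose_one]

/-! The sequential rate-distortion function.

A source/output pair `(x, y)` of random vectors of length `ℓ` is described by its joint law, a
probability measure on `(Fin ℓ → ℝ) × (Fin ℓ → ℝ)`; the two coordinates are `x` and `y`. -/

/-- Mutual information `I(x; y)` in nats of a pair with joint law `ν`: the Kullback–Leibler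
divergence of `ν` from the product of its marginals. -/
def mutualInformation {ℓ : ℕ} (ν : ProbabilityMeasure ((Fin ℓ → ℝ) × (Fin ℓ → ℝ))) : ℝ≥0∞ :=
  InformationTheory.klDiv (ν : Measure ((Fin ℓ → ℝ) × (Fin ℓ → ℝ)))
    ((ν : Measure ((Fin ℓ → ℝ) × (Fin ℓ → ℝ))).fst.prod
      (ν : Measure ((Fin ℓ → ℝ) × (Fin ℓ → ℝ))).snd)

/-- The `σ`-algebra generated by the source samples up to and including index `k`. -/
abbrev sourcePast {ℓ : ℕ} (k : Fin ℓ) : MeasurableSpace ((Fin ℓ → ℝ) × (Fin ℓ → ℝ)) :=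
  MeasurableSpace.comap (fun p (i : Set.Iic k) => p.1 i) inferInstance

theorem sourcePast_le {ℓ : ℕ} (k : Fin ℓ) :
    sourcePast k ≤ (inferInstance : MeasurableSpace ((Fin ℓ → ℝ) × (Fin ℓ → ℝ))) :=
  Measurable.comap_le (by fun_prop)

/-- Causality: for every `k` the outputs up to time `k` and the source samples after time `k`
are conditionally independent given the source samples up to time `k`. -/
def IsCausal {ℓ : ℕ} (ν : ProbabilityMeasure ((Fin ℓ → ℝ) × (Fin ℓ → ℝ))) : Prop :=
  ∀ k : Fin ℓ, CondIndepFun (sourcePast k) (sourcePast_le k)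
    (fun p (i : Set.Iic k) => p.2 i) (fun p (i : Set.Ioi k) => p.1 i)
    (ν : Measure ((Fin ℓ → ℝ) × (Fin ℓ → ℝ)))

/-- The outputs admitted for a source with law `P` under the distortion schedule `D`: causally
related to the source, with `E (y k - x k) ^ 2 ≤ D k` for every `k`. -/
structure IsAdmissible {ℓ : ℕ} (P : Measure (Fin ℓ → ℝ)) (D : Fin ℓ → ℝ)
    (ν : ProbabilityMeasure ((Fin ℓ → ℝ) × (Fin ℓ → ℝ))) : Prop where
  source_law : (ν : Measure ((Fin ℓ → ℝ) × (Fin ℓ → ℝ))).fst = P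
  causal : IsCausal ν
  memLp : ∀ k, MemLp (fun p : (Fin ℓ → ℝ) × (Fin ℓ → ℝ) => p.2 k - p.1 k) 2
    (ν : Measure ((Fin ℓ → ℝ) × (Fin ℓ → ℝ)))
  distortion : ∀ k, ∫ p, (p.2 k - p.1 k) ^ 2 ∂(ν : Measure ((Fin ℓ → ℝ) × (Fin ℓ → ℝ))) ≤ D k

/-- The sequential rate-distortion function (in nats per sample) under the schedule `D`. -/
def SRDF {ℓ : ℕ} (P : Measure (Fin ℓ → ℝ)) (D : Fin ℓ → ℝ) : ℝ≥0∞ :=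
  ⨅ (ν : ProbabilityMeasure ((Fin ℓ → ℝ) × (Fin ℓ → ℝ))) (_ : IsAdmissible P D ν),
    (ℓ : ℝ≥0∞)⁻¹ * mutualInformation ν

/-- A realization of the sequential rate-distortion function: an admissible output that attains
the infimum. -/
structure IsRealization {ℓ : ℕ} (P : Measure (Fin ℓ → ℝ)) (D : Fin ℓ → ℝ)
    (ν : ProbabilityMeasure ((Fin ℓ → ℝ) × (Fin ℓ → ℝ))) : Prop extends IsAdmissible P D ν where
  rate_eq : (ℓ : ℝ≥0∞)⁻¹ * mutualInformation ν = SRDF P D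

/-- The matrix `E [y yᵀ]` of a pair with joint law `ν`. -/
def outputMoments {ℓ : ℕ} (ν : ProbabilityMeasure ((Fin ℓ → ℝ) × (Fin ℓ → ℝ))) :
    Matrix (Fin ℓ) (Fin ℓ) ℝ :=
  Matrix.of fun i j => ∫ p, p.2 i * p.2 j ∂(ν : Measure ((Fin ℓ → ℝ) × (Fin ℓ → ℝ)))

/-- The matrix `E [y xᵀ]` of a pair with joint law `ν` (rows `y`, columns `x`). -/
def crossMoments {ℓ : ℕ} (ν : ProbabilityMeasure ((Fin ℓ → ℝ) × (Fin ℓ → ℝ))) :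
    Matrix (Fin ℓ) (Fin ℓ) ℝ :=
  Matrix.of fun i j => ∫ p, p.2 i * p.1 j ∂(ν : Measure ((Fin ℓ → ℝ) × (Fin ℓ → ℝ)))

/-- The matrix `E [x xᵀ]` of a source with law `P`. -/
def sourceMoments {ℓ : ℕ} (P : Measure (Fin ℓ → ℝ)) : Matrix (Fin ℓ) (Fin ℓ) ℝ :=
  Matrix.of fun i j => ∫ x, x i * x j ∂P

/-! Effective distortions and the recursive procedure. -/

/-- Effective distortions: `d 0 = min v₀ (D 0)` and
`d (k + 1) = min (a k ^ 2 * d k + v k) (D (k + 1))`. -/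
def effectiveDistortion {n : ℕ} (a : Fin n → ℝ) (v₀ : ℝ) (v : Fin n → ℝ) (D : Fin (n + 1) → ℝ) :
    Fin (n + 1) → ℝ :=
  Fin.induction (motive := fun _ => ℝ) (min v₀ (D 0))
    (fun k dk => min (a k ^ 2 * dk + v k) (D k.succ))

/-- The square matrix `[[A, c], [r, e]]` with last column `(c, e)` and last row `(r, e)`. -/
def bordered {m : ℕ} (A : Matrix (Fin m) (Fin m) ℝ) (c r : Fin m → ℝ) (e : ℝ) :
    Matrix (Fin (m + 1)) (Fin (m + 1)) ℝ :=
  Matrix.of (Fin.snoc (α := fun _ => Fin (m + 1) → ℝ)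
    (fun i => Fin.snoc (α := fun _ => ℝ) (A i) (c i)) (Fin.snoc (α := fun _ => ℝ) r e))

/-- One pass through the procedure. From the source moments `Kx = E [x xᵀ]` of length `m + 1`, the
effective distortion `dk` of the last sample, and the moments `Ky = E [y yᵀ]`, `Kyx = E [y xᵀ]` of
the first `m` samples, the moments of all `m + 1` samples are computed.

* `u` is `E [x_past x_last]`;
* `yx` is `E [y_past x_last] = Kyx (E [x_past x_pastᵀ])⁻¹ u`, which also serves as
  `E [y_past y_last]`;
* `e` is `E [y_last ^ 2] = E [y_last x_last] = E [x_last ^ 2] - dk`;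
* `w` is the row `E [y_last x_pastᵀ] =
  [yxᵀ, e] * [[Ky, yx], [yxᵀ, E [x_last ^ 2]]]† * [Kyx; uᵀ]`. -/
def procedureStep {m : ℕ} (Kx : Matrix (Fin (m + 1)) (Fin (m + 1)) ℝ) (dk : ℝ)
    (K : Matrix (Fin m) (Fin m) ℝ × Matrix (Fin m) (Fin m) ℝ) :
    Matrix (Fin (m + 1)) (Fin (m + 1)) ℝ × Matrix (Fin (m + 1)) (Fin (m + 1)) ℝ :=
  let Ky := K.1
  let Kyx := K.2
  let s := Kx (Fin.last m) (Fin.last m)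
  let u : Fin m → ℝ := fun i => Kx i.castSucc (Fin.last m)
  let yx : Fin m → ℝ := (Kyx * (Kx.submatrix Fin.castSucc Fin.castSucc)⁻¹) *ᵥ u
  let e := s - dk
  let w : Fin m → ℝ := Fin.snoc (α := fun _ => ℝ) yx e ᵥ*
    (pinv (bordered Ky yx yx s) * Matrix.of (Fin.snoc (α := fun _ => Fin m → ℝ) Kyx u))
  (bordered Ky yx yx e, bordered Kyx yx w e)

/-- The recursive procedure: from the source moments `Kx` and the effective distortions `d` it
computes the pair `(E [y yᵀ], E [y xᵀ])`. -/
def procedureOne : (n : ℕ) → Matrix (Fin (n + 1)) (Fin (n + 1)) ℝ → (Fin (n + 1) → ℝ) →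
    Matrix (Fin (n + 1)) (Fin (n + 1)) ℝ × Matrix (Fin (n + 1)) (Fin (n + 1)) ℝ
  | 0, Kx, d => (Matrix.of fun _ _ => Kx 0 0 - d 0, Matrix.of fun _ _ => Kx 0 0 - d 0)
  | n + 1, Kx, d => procedureStep Kx (d (Fin.last (n + 1)))
      (procedureOne n (Kx.submatrix Fin.castSucc Fin.castSucc) (fun i => d i.castSucc))

end

/-!
The theorem follows from a variational formula for the rate together with Hilbert space geometry.

**Converse.** Let `(x, y)` be admissible with joint law `ν`, let `d` be the effective distortions
and let `m k` be any linear estimates of the source from the outputs. The Gibbs inequality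
`klDiv ν (P ⊗ κ) ≥ ∫ f dν`, valid whenever `exp f` has integral one under `P ⊗ κ`
(`ofReal_integral_le_klDiv`), is applied to the log-likelihood ratio `f` of the Gaussian *backward*
channel (`channelLogRatio`): run in reversed time, `x k - c k • x (k + 1)` is estimated by
`w k • m k`, and the residuals are independent with variances `τ k`. Here `c k = smoothingGain`,
`w k = filterWeight` and `τ k = backwardVariance` are the Rauch–Tung–Striebel smoothing
coefficients that belong to `d`. Both linear changes of variables (to the innovations of the source
and to the backward residuals) are unit triangular, so no Jacobians appear, and the integral depends
on second moments only: with `T` the claimed total rate and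
`S = ∑ k, E (residual k) ^ 2 / τ k` (`backwardCost`),

  `I(x; y) ≥ T + (n + 1) / 2 - S / 2`   (`ofReal_le_mutualInformation`).

Causality enters through second moments as well: the innovation at time `k + 1` is orthogonal to
the outputs up to time `k` (`IsAdmissible.isCausalPair`). Hence, when `m k` lies in the span of
`y 0, …, y k`, each term of `S` equals `1 + w k * (E (x k - m k) ^ 2 / d k - 1)`
(`IsCausalPair.norm_backwardResidual`). Taking for `m k` the output `y k` if `d k = D k`, and the
one-step prediction otherwise, makes every filtering error at most `d k`
(`IsCausalPair.exists_estimate`), so `S ≤ n + 1` and `I(x; y) ≥ T`.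

**Achievability.** The recursive channel `y (k + 1) = (1 - g) a y k + g x (k + 1) + e (k + 1)`, with
independent Gaussian noise `e` of suitable variance, is causal since its noise is independent of
the source (`IsFilterLaw.isCausal`). Its backward residuals are orthogonal to each other and to all
outputs, with variances `τ k`; being jointly Gaussian they are independent, so that the law is
exactly the one with log-likelihood ratio `f`, and the rate is `T`
(`IsFilterLaw.mutualInformation_eq`).

**Uniqueness.** For a realization `I(x; y) = T`, so the lower bound forces `S ≥ n + 1` for *all*
linear estimates from the outputs. Causal estimates with errors at most `d k` thus minimize `S`;
the first-order conditions (`IsCausalPair.optimality`) say that the errors equal `d k` and that the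
backward residuals are orthogonal to all outputs. Under (a) this applies to `m = y`; under (b) the
estimates provided by `IsCausalPair.exists_estimate` must coincide with `y`
(`eq_of_filter_orthogonal`). The resulting orthogonality relations are the normal equations solved
by the recursive procedure, where the pseudo-inverse appears because the outputs may be linearly
dependent (`IsCausalPair.gram_eq_procedureOne`, `vecMul_pinv_gram`). Conversely the diagonal of the
procedure's output determines the distortions (`procedureOne_diag`).
-/

noncomputable section

/-! ### Filtering and smoothing coefficients -/

section Coefficients

variable {n : ℕ}

/-- The variance `a k ^ 2 * d k + v k` of the one-step prediction error at time `k + 1` when the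
filtering error at time `k` has variance `d k`. -/
def predictedVariance (a v : Fin n → ℝ) (d : Fin (n + 1) → ℝ) (k : Fin n) : ℝ :=
  a k ^ 2 * d k.castSucc + v k

/-- The gain of `x (k + 1)` in the backward (smoothing) estimate of `x k` from `x (k + 1)` and the
filtering estimate of `x k`. -/
def smoothingGain (a v : Fin n → ℝ) (d : Fin (n + 1) → ℝ) (k : Fin n) : ℝ :=
  a k * d k.castSucc / predictedVariance a v d k

/-- The weight of the filtering estimate of `x k` in the backward estimate of `x k`; at the last
time there is no `x (k + 1)` and the weight is `1`. -/
def filterWeight (a v : Fin n → ℝ) (d : Fin (n + 1) → ℝ) : Fin (n + 1) → ℝ :=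
  Fin.snoc (α := fun _ => ℝ) (fun k => v k / predictedVariance a v d k) 1

/-- The error variance of the backward estimate of `x k`. -/
def backwardVariance (a v : Fin n → ℝ) (d : Fin (n + 1) → ℝ) : Fin (n + 1) → ℝ :=
  Fin.snoc (α := fun _ => ℝ) (fun k => d k.castSucc * v k / predictedVariance a v d k)
    (d (Fin.last n))

/-- The innovations `x 0, x 1 - a 0 x 0, …` of a first-order recursion. -/
def innovation {E : Type*} [AddCommGroup E] [Module ℝ E] (a : Fin n → ℝ) (X : Fin (n + 1) → E) :
    Fin (n + 1) → E :=
  Fin.cons (α := fun _ => E) (X 0) (fun k => X k.succ - a k • X k.castSucc)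

/-- The sequence `x k - smoothingGain k • x (k + 1)`, ending with the last sample itself. -/
def backwardDifference {E : Type*} [AddCommGroup E] [Module ℝ E] (a v : Fin n → ℝ)
    (d : Fin (n + 1) → ℝ) (X : Fin (n + 1) → E) : Fin (n + 1) → E :=
  Fin.snoc (α := fun _ => E)
    (fun k => X k.castSucc - smoothingGain a v d k • X k.succ) (X (Fin.last n))

/-- The errors of the backward estimates built from the filtering estimates `M`. -/
def backwardResidual {E : Type*} [AddCommGroup E] [Module ℝ E] (a v : Fin n → ℝ)
    (d : Fin (n + 1) → ℝ) (X M : Fin (n + 1) → E) (k : Fin (n + 1)) : E :=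
  backwardDifference a v d X k - filterWeight a v d k • M k

/-- The properties of the effective distortions that the second-order theory uses: they are
positive and never exceed the variance predicted from the previous one. -/
structure IsFeasible (a : Fin n → ℝ) (v₀ : ℝ) (v : Fin n → ℝ) (d : Fin (n + 1) → ℝ) : Prop where
  var_pos : ∀ k, 0 < v k
  pos : ∀ k, 0 < d k
  le_zero : d 0 ≤ v₀
  le_succ : ∀ k, d (Fin.succ k) ≤ predictedVariance a v d k

variable {a v : Fin n → ℝ} {v₀ : ℝ} {d : Fin (n + 1) → ℝ}

theorem IsFeasible.predictedVariance_pos (h : IsFeasible a v₀ v d) (k : Fin n) :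
    0 < predictedVariance a v d k :=
  add_pos_of_nonneg_of_pos (mul_nonneg (sq_nonneg _) (h.pos _).le) (h.var_pos k)

theorem IsFeasible.filterWeight_pos (h : IsFeasible a v₀ v d) (k : Fin (n + 1)) :
    0 < filterWeight a v d k := by
  induction k using Fin.lastCases with
  | last => simp [filterWeight]
  | cast k => simpa [filterWeight] using div_pos (h.var_pos k) (h.predictedVariance_pos k)

theorem IsFeasible.backwardVariance_pos (h : IsFeasible a v₀ v d) (k : Fin (n + 1)) :
    0 < backwardVariance a v d k := by
  induction k using Fin.lastCases with
  | last => simpa [backwardVariance] using h.pos _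
  | cast k =>
    simpa [backwardVariance] using
      div_pos (mul_pos (h.pos _) (h.var_pos k)) (h.predictedVariance_pos k)

theorem effectiveDistortion_zero (D : Fin (n + 1) → ℝ) :
    effectiveDistortion a v₀ v D 0 = min v₀ (D 0) := rfl

theorem effectiveDistortion_succ (D : Fin (n + 1) → ℝ) (k : Fin n) :
    effectiveDistortion a v₀ v D k.succ =
      min (predictedVariance a v (effectiveDistortion a v₀ v D) k) (D k.succ) := rfl

theorem isFeasible_effectiveDistortion (hv₀ : 0 < v₀) (hv : ∀ k, 0 < v k) {D : Fin (n + 1) → ℝ}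
    (hD : ∀ k, 0 < D k) : IsFeasible a v₀ v (effectiveDistortion a v₀ v D) where
  var_pos := hv
  pos k := by
    induction k using Fin.induction with
    | zero => exact lt_min hv₀ (hD 0)
    | succ k ih =>
      rw [effectiveDistortion_succ]
      exact lt_min (add_pos_of_nonneg_of_pos (mul_nonneg (sq_nonneg _) ih.le) (hv k)) (hD _)
  le_zero := min_le_left _ _
  le_succ _ := by
    rw [effectiveDistortion_succ]
    exact min_le_left _ _

theorem effectiveDistortion_le (D : Fin (n + 1) → ℝ) (k : Fin (n + 1)) :
    effectiveDistortion a v₀ v D k ≤ D k := by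
  induction k using Fin.cases with
  | zero => exact min_le_right _ _
  | succ k =>
    rw [effectiveDistortion_succ]
    exact min_le_right _ _

end Coefficients

/-! ### Second-order theory of causal estimates -/

section SecondOrder

variable {n : ℕ} {H : Type*} [NormedAddCommGroup H] [InnerProductSpace ℝ H]
  {a v : Fin n → ℝ} {v₀ : ℝ} {d : Fin (n + 1) → ℝ} {X Y M : Fin (n + 1) → H}

/-- Second-order properties of a Gauss–Markov source `X` and a causally related output `Y`, seen
as vectors of a Hilbert space of square-integrable random variables: each innovation has the
prescribed variance and is orthogonal to the past of the source and of the output. -/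
structure IsCausalPair (a : Fin n → ℝ) (v₀ : ℝ) (v : Fin n → ℝ) (X Y : Fin (n + 1) → H) :
    Prop where
  norm_zero : ‖X 0‖ ^ 2 = v₀
  norm_innovation : ∀ k, ‖X (Fin.succ k) - a k • X k.castSucc‖ ^ 2 = v k
  source_orthogonal : ∀ k j, j ≤ Fin.castSucc k →
    inner ℝ (X j) (X k.succ - a k • X k.castSucc) = 0
  output_orthogonal : ∀ k j, j ≤ Fin.castSucc k →
    inner ℝ (Y j) (X k.succ - a k • X k.castSucc) = 0

theorem inner_eq_zero_of_mem_span {s : Set H} {x y : H} (hx : x ∈ Submodule.span ℝ s)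
    (h : ∀ z ∈ s, inner ℝ z y = 0) : inner ℝ x y = 0 := by
  induction hx using Submodule.span_induction with
  | mem z hz => exact h z hz
  | zero => simp
  | add _ _ _ _ h₁ h₂ => rw [inner_add_left, h₁, h₂, add_zero]
  | smul c _ _ h₁ => rw [inner_smul_left, h₁, mul_zero]

theorem IsCausalPair.span_orthogonal (h : IsCausalPair a v₀ v X Y) (k : Fin n) {y : H}
    (hy : y ∈ Submodule.span ℝ (Y '' Set.Iic k.castSucc)) :
    inner ℝ y (X k.succ - a k • X k.castSucc) = 0 :=
  inner_eq_zero_of_mem_span hy (by rintro _ ⟨j, hj, rfl⟩; exact h.output_orthogonal k j hj)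

theorem backwardResidual_castSucc (hd : IsFeasible a v₀ v d) (k : Fin n) :
    backwardResidual a v d X M k.castSucc =
      (v k / predictedVariance a v d k) • (X k.castSucc - M k.castSucc)
        - smoothingGain a v d k • (X k.succ - a k • X k.castSucc) := by
  have hl := (hd.predictedVariance_pos k).ne'
  have h1 : v k / predictedVariance a v d k = 1 - smoothingGain a v d k * a k := by
    rw [smoothingGain]
    field_simp
    rw [predictedVariance]
    ring
  simp only [backwardResidual, backwardDifference, filterWeight, Fin.snoc_castSucc]
  rw [h1]
  module

theorem backwardResidual_last :
    backwardResidual a v d X M (Fin.last n) = X (Fin.last n) - M (Fin.last n) := by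
  simp [backwardResidual, backwardDifference, filterWeight]

/-- For causal estimates the normalized backward error exceeds `1` by a positive multiple of the
amount by which the normalized filtering error does. -/
theorem IsCausalPair.norm_backwardResidual (h : IsCausalPair a v₀ v X Y)
    (hd : IsFeasible a v₀ v d) (hM : ∀ k, M k ∈ Submodule.span ℝ (Y '' Set.Iic k))
    (k : Fin (n + 1)) :
    ‖backwardResidual a v d X M k‖ ^ 2 / backwardVariance a v d k =
      1 + filterWeight a v d k * (‖X k - M k‖ ^ 2 / d k - 1) := by
  induction k using Fin.lastCases with
  | last => rw [backwardResidual_last]; simp [backwardVariance, filterWeight]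
  | cast k =>
    have h0 : inner ℝ (X k.castSucc - M k.castSucc) (X k.succ - a k • X k.castSucc) = 0 := by
      rw [inner_sub_left, h.source_orthogonal k _ le_rfl, h.span_orthogonal k (hM _), sub_zero]
    rw [backwardResidual_castSucc hd, norm_sub_sq_real, inner_smul_left, inner_smul_right, h0,
      norm_smul, norm_smul, mul_pow, mul_pow, h.norm_innovation, Real.norm_eq_abs,
      Real.norm_eq_abs, sq_abs, sq_abs]
    have hl := (hd.predictedVariance_pos k).ne'
    have hd' := (hd.pos k.castSucc).ne'
    have hv' := (hd.var_pos k).ne'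
    simp only [backwardVariance, filterWeight, Fin.snoc_castSucc, smoothingGain]
    field_simp
    rw [predictedVariance]
    ring

/-- The sum of the normalized backward errors. -/
def backwardCost (a v : Fin n → ℝ) (d : Fin (n + 1) → ℝ) (X M : Fin (n + 1) → H) : ℝ :=
  ∑ k, ‖backwardResidual a v d X M k‖ ^ 2 / backwardVariance a v d k

theorem backwardCost_update (k : Fin (n + 1)) (y : H) (hd : IsFeasible a v₀ v d) :
    backwardCost a v d X (Function.update M k (M k + y)) - backwardCost a v d X M =
      (filterWeight a v d k ^ 2 * ‖y‖ ^ 2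
        - 2 * (filterWeight a v d k * inner ℝ (backwardResidual a v d X M k) y))
        / backwardVariance a v d k := by
  have hne : ∀ j, j ≠ k → backwardResidual a v d X (Function.update M k (M k + y)) j
      = backwardResidual a v d X M j := fun j hj => by simp [backwardResidual, hj]
  have hk : backwardResidual a v d X (Function.update M k (M k + y)) k
      = backwardResidual a v d X M k - filterWeight a v d k • y := by
    simp [backwardResidual, smul_add, sub_sub]
  have hτ := (hd.backwardVariance_pos k).ne'
  rw [backwardCost, backwardCost, ← Finset.sum_sub_distrib,
    Finset.sum_eq_single k (fun j _ hj => by rw [hne j hj, sub_self]) (by simp), hk,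
    norm_sub_sq_real, inner_smul_right, norm_smul, mul_pow, Real.norm_eq_abs, sq_abs]
  field_simp
  ring

theorem IsCausalPair.norm_backwardResidual_le (h : IsCausalPair a v₀ v X Y)
    (hd : IsFeasible a v₀ v d) (hM : ∀ k, M k ∈ Submodule.span ℝ (Y '' Set.Iic k))
    (hle : ∀ k, ‖X k - M k‖ ^ 2 ≤ d k) (k : Fin (n + 1)) :
    ‖backwardResidual a v d X M k‖ ^ 2 / backwardVariance a v d k ≤ 1 := by
  rw [h.norm_backwardResidual hd hM]
  have h1 : ‖X k - M k‖ ^ 2 / d k ≤ 1 := (div_le_one (hd.pos k)).2 (hle k)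
  nlinarith [hd.filterWeight_pos k]

theorem IsCausalPair.backwardCost_le (h : IsCausalPair a v₀ v X Y)
    (hd : IsFeasible a v₀ v d) (hM : ∀ k, M k ∈ Submodule.span ℝ (Y '' Set.Iic k))
    (hle : ∀ k, ‖X k - M k‖ ^ 2 ≤ d k) : backwardCost a v d X M ≤ ((n + 1 : ℕ) : ℝ) := by
  calc backwardCost a v d X M ≤ ∑ _k : Fin (n + 1), (1 : ℝ) :=
        Finset.sum_le_sum fun k _ => h.norm_backwardResidual_le hd hM hle k
    _ = ((n + 1 : ℕ) : ℝ) := by simp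

/-- First-order conditions: if the backward cost is bounded below by the number of samples and some
causal estimates have filtering errors at most `d`, then they attain the bound; hence their errors
equal `d` and the backward errors are orthogonal to every output. -/
theorem IsCausalPair.optimality (h : IsCausalPair a v₀ v X Y) (hd : IsFeasible a v₀ v d)
    (hmin : ∀ M : Fin (n + 1) → H, (∀ k, M k ∈ Submodule.span ℝ (Set.range Y)) →
      ((n + 1 : ℕ) : ℝ) ≤ backwardCost a v d X M)
    (hM : ∀ k, M k ∈ Submodule.span ℝ (Y '' Set.Iic k)) (hle : ∀ k, ‖X k - M k‖ ^ 2 ≤ d k) :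
    (∀ k, ‖X k - M k‖ ^ 2 = d k) ∧ ∀ k j, inner ℝ (backwardResidual a v d X M k) (Y j) = 0 := by
  have hspan : ∀ k, M k ∈ Submodule.span ℝ (Set.range Y) := fun k =>
    Submodule.span_mono (Set.image_subset_range _ _) (hM k)
  have hterm := h.norm_backwardResidual_le hd hM hle
  have hcost := h.backwardCost_le hd hM hle
  have heq : ∀ k, ‖backwardResidual a v d X M k‖ ^ 2 / backwardVariance a v d k = 1 := by
    have hs : backwardCost a v d X M = ∑ _k : Fin (n + 1), (1 : ℝ) := by
      simpa using le_antisymm hcost (hmin M hspan)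
    intro k
    exact (Finset.sum_eq_sum_iff_of_le fun k _ => hterm k).1 hs k (Finset.mem_univ k)
  refine ⟨fun k => ?_, fun k j => ?_⟩
  · have h1 := heq k
    rw [h.norm_backwardResidual hd hM, add_eq_left, mul_eq_zero] at h1
    have h2 := h1.resolve_left (hd.filterWeight_pos k).ne'
    rwa [sub_eq_zero, div_eq_one_iff_eq (hd.pos k).ne'] at h2
  · set r := inner ℝ (backwardResidual a v d X M k) (Y j)
    have hw := hd.filterWeight_pos k
    -- the cost along `M k + ε • Y j` is a quadratic polynomial in `ε`, minimal at `ε = 0`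
    have hquad : ∀ ε : ℝ, 0 ≤ filterWeight a v d k ^ 2 * ‖Y j‖ ^ 2 * (ε * ε)
        + (-2 * (filterWeight a v d k * r)) * ε + 0 := by
      intro ε
      have h1 := hmin (Function.update M k (M k + ε • Y j)) (by
        intro i
        by_cases hi : i = k
        · subst hi
          rw [Function.update_self]
          exact add_mem (hspan i) (Submodule.smul_mem _ _ (Submodule.subset_span ⟨j, rfl⟩))
        · rw [Function.update_of_ne hi]
          exact hspan i)
      have h2 := backwardCost_update (M := M) (X := X) k (ε • Y j) hd
      have h3 : 0 ≤ (filterWeight a v d k ^ 2 * ‖ε • Y j‖ ^ 2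
          - 2 * (filterWeight a v d k * inner ℝ (backwardResidual a v d X M k) (ε • Y j)))
          / backwardVariance a v d k := by
        rw [← h2]
        linarith
      have h4 := (le_div_iff₀ (hd.backwardVariance_pos k)).1 h3
      rw [zero_mul, norm_smul, inner_smul_right, mul_pow, Real.norm_eq_abs, sq_abs] at h4
      linarith
    have hdisc := discrim_le_zero hquad
    rw [discrim] at hdisc
    have h5 : filterWeight a v d k * r = 0 := by nlinarith
    exact (mul_eq_zero.1 h5).resolve_left hw.ne'

/-- A backward error differs from a multiple of the filtering error by a multiple of the next
innovation, which is orthogonal to the past outputs. -/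
theorem IsCausalPair.filter_orthogonal (h : IsCausalPair a v₀ v X Y) (hd : IsFeasible a v₀ v d)
    (hR : ∀ k j, inner ℝ (backwardResidual a v d X M k) (Y j) = 0) {j k : Fin (n + 1)}
    (hjk : j ≤ k) : inner ℝ (X k - M k) (Y j) = 0 := by
  induction k using Fin.lastCases with
  | last => simpa only [backwardResidual_last] using hR (Fin.last n) j
  | cast k =>
    have h1 := hR k.castSucc j
    rw [backwardResidual_castSucc hd, inner_sub_left, inner_smul_left, inner_smul_left,
      real_inner_comm (Y j) (X k.succ - _), h.output_orthogonal k j hjk, mul_zero, sub_zero] at h1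
    exact (mul_eq_zero.1 h1).resolve_left (div_pos (hd.var_pos k) (hd.predictedVariance_pos k)).ne'

/-- Some causal linear estimates have errors at most the effective distortions: use the output
when its distortion constraint is active, and the one-step prediction otherwise. -/
theorem IsCausalPair.exists_estimate (h : IsCausalPair a v₀ v X Y) {D : Fin (n + 1) → ℝ}
    (hD : ∀ k, ‖X k - Y k‖ ^ 2 ≤ D k) :
    ∃ M : Fin (n + 1) → H, (∀ k, M k ∈ Submodule.span ℝ (Y '' Set.Iic k)) ∧
      ∀ k, ‖X k - M k‖ ^ 2 ≤ effectiveDistortion a v₀ v D k := by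
  have key : ∀ k, ∃ m ∈ Submodule.span ℝ (Y '' Set.Iic k),
      ‖X k - m‖ ^ 2 ≤ effectiveDistortion a v₀ v D k := by
    intro k
    have hY : Y k ∈ Submodule.span ℝ (Y '' Set.Iic k) :=
      Submodule.subset_span ⟨k, Set.mem_Iic.2 le_rfl, rfl⟩
    induction k using Fin.induction with
    | zero =>
      rcases le_total v₀ (D 0) with h0 | h0
      · exact ⟨0, zero_mem _, by rw [effectiveDistortion_zero, min_eq_left h0, sub_zero,
          h.norm_zero]⟩
      · exact ⟨Y 0, hY, by rw [effectiveDistortion_zero, min_eq_right h0]; exact hD 0⟩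
    | succ k ih =>
      obtain ⟨m, hm, hle⟩ := ih (Submodule.subset_span ⟨_, Set.mem_Iic.2 le_rfl, rfl⟩)
      rcases le_total (predictedVariance a v (effectiveDistortion a v₀ v D) k) (D k.succ)
        with h0 | h0
      · refine ⟨a k • m, Submodule.smul_mem _ _ (Submodule.span_mono (Set.image_mono
          (Set.Iic_subset_Iic.2 (Fin.castSucc_lt_succ).le)) hm), ?_⟩
        have h1 : X k.succ - a k • m
            = a k • (X k.castSucc - m) + (X k.succ - a k • X k.castSucc) := by module
        have h2 : inner ℝ (X k.castSucc - m) (X k.succ - a k • X k.castSucc) = 0 := by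
          rw [inner_sub_left, h.source_orthogonal k _ le_rfl, h.span_orthogonal k hm, sub_zero]
        rw [effectiveDistortion_succ, min_eq_left h0, h1, norm_add_sq_real, inner_smul_left, h2,
          norm_smul, mul_pow, h.norm_innovation, Real.norm_eq_abs, sq_abs, predictedVariance]
        nlinarith [mul_le_mul_of_nonneg_left hle (sq_nonneg (a k))]
      · exact ⟨Y k.succ, hY, by rw [effectiveDistortion_succ, min_eq_right h0]; exact hD _⟩
  choose M hM hle using key
  exact ⟨M, hM, hle⟩

/-- An output whose errors are orthogonal to its past coincides with any other causal estimate with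
that property. -/
theorem eq_of_filter_orthogonal (hM : ∀ k, M k ∈ Submodule.span ℝ (Y '' Set.Iic k))
    (h₁ : ∀ j k, j ≤ k → inner ℝ (X k - M k) (Y j) = 0)
    (h₂ : ∀ j k, j ≤ k → inner ℝ (X k - Y k) (Y j) = 0) : M = Y := by
  funext k
  have hmem : M k - Y k ∈ Submodule.span ℝ (Y '' Set.Iic k) :=
    sub_mem (hM k) (Submodule.subset_span ⟨k, Set.mem_Iic.2 le_rfl, rfl⟩)
  have h0 : inner ℝ (M k - Y k) (M k - Y k) = 0 := by
    refine inner_eq_zero_of_mem_span hmem ?_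
    rintro _ ⟨j, hj, rfl⟩
    have : M k - Y k = (X k - Y k) - (X k - M k) := by abel
    rw [real_inner_comm, this, inner_sub_left, h₁ j k hj, h₂ j k hj, sub_zero]
  exact sub_eq_zero.1 (inner_self_eq_zero.1 h0)

/-- When the output errors are the filtering errors, a backward error is orthogonal to the later
source samples. -/
theorem IsCausalPair.backwardResidual_source (h : IsCausalPair a v₀ v X Y)
    (hd : IsFeasible a v₀ v d) (horth : ∀ j k, j ≤ k → inner ℝ (X k - Y k) (Y j) = 0)
    (hnorm : ∀ k, ‖X k - Y k‖ ^ 2 = d k) {j k : Fin (n + 1)} (hjk : j < k) :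
    inner ℝ (backwardResidual a v d X Y j) (X k) = 0 := by
  induction k using Fin.induction with
  | zero => exact absurd hjk (Fin.not_lt_zero j)
  | succ k ih =>
    induction j using Fin.lastCases with
    | last => exact absurd (Fin.le_last _) hjk.not_ge
    | cast j =>
      have hjk' : j ≤ k := by simpa [Fin.lt_def, Nat.lt_succ_iff] using hjk
      rw [backwardResidual_castSucc hd] at *
      have hX : X k.succ = a k • X k.castSucc + (X k.succ - a k • X k.castSucc) := by abel
      rcases hjk'.lt_or_eq with hlt | rfl
      · have h1 := ih (Fin.castSucc_lt_castSucc_iff.2 hlt)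
        have hsk : j.succ ≤ k.castSucc := by
          simp only [Fin.le_def, Fin.val_succ, Fin.val_castSucc]; exact hlt
        have hck : j.castSucc ≤ k.castSucc := (Fin.castSucc_lt_castSucc_iff.2 hlt).le
        rw [hX, inner_add_right, inner_smul_right, h1, mul_zero, zero_add, inner_sub_left,
          inner_smul_left, inner_smul_left, inner_sub_left, inner_sub_left, inner_smul_left,
          h.source_orthogonal k _ hck, h.source_orthogonal k _ hsk, h.output_orthogonal k _ hck]
        simp
      · have h2 : inner ℝ (X j.castSucc - Y j.castSucc) (X j.castSucc) = d j.castSucc := by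
          have := hnorm j.castSucc
          rw [← real_inner_self_eq_norm_sq, inner_sub_right, horth _ _ le_rfl, sub_zero] at this
          exact this
        have h3 : inner ℝ (X j.castSucc - Y j.castSucc) (X j.succ - a j • X j.castSucc) = 0 := by
          rw [inner_sub_left, h.source_orthogonal j _ le_rfl, h.output_orthogonal j _ le_rfl,
            sub_zero]
        have h4 : inner ℝ (X j.succ - a j • X j.castSucc) (X j.castSucc) = 0 := by
          rw [real_inner_comm, h.source_orthogonal j _ le_rfl]
        have h5 := h.norm_innovation j
        generalize X j.succ - a j • X j.castSucc = I at *
        rw [hX, inner_sub_left, inner_add_right, inner_add_right, inner_smul_right,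
          inner_smul_right, inner_smul_left, inner_smul_left, inner_smul_left, inner_smul_left,
          h2, h3, h4, real_inner_self_eq_norm_sq, h5]
        simp only [smoothingGain, conj_trivial]
        ring

end SecondOrder

/-! ### The recursive procedure -/

section Procedure

variable {H : Type*} [NormedAddCommGroup H] [InnerProductSpace ℝ H]

/-- The matrix of the inner products `⟪u i, w j⟫`. -/
def crossGram {ι κ : Type*} (u : ι → H) (w : κ → H) : Matrix ι κ ℝ :=
  Matrix.of fun i j => inner ℝ (u i) (w j)

/-- The estimate of `x` from `z`, computed with the pseudo-inverse of the Gram matrix of `z`,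
reproduces the product with `y` whenever the error of some linear estimate of `x` from `z` is
orthogonal to `z` and to `y`. -/
theorem vecMul_pinv_gram {m : ℕ} (z : Fin m → H) (y x s : H)
    (hs : s ∈ Submodule.span ℝ (Set.range z)) (hz : ∀ i, inner ℝ (z i) (x - s) = 0)
    (hy : inner ℝ y (x - s) = 0) :
    (fun i => inner ℝ y (z i)) ⬝ᵥ (pinv (crossGram z z) *ᵥ fun i => inner ℝ (z i) x)
      = inner ℝ y x := by
  obtain ⟨b, rfl⟩ := (Submodule.mem_span_range_iff_exists_fun ℝ).1 hs
  set G := crossGram z z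
  have hcomb : ∀ (u : H) (c : Fin m → ℝ),
      inner ℝ u (∑ i, c i • z i) = (fun i => inner ℝ u (z i)) ⬝ᵥ c := by
    intro u c
    simp [inner_sum, inner_smul_right, dotProduct, mul_comm]
  have hGmul : ∀ c : Fin m → ℝ, G *ᵥ c = fun i => inner ℝ (z i) (∑ j, c j • z j) := by
    intro c
    funext i
    rw [hcomb]
    rfl
  have hzx : (fun i => inner ℝ (z i) x) = G *ᵥ b := by
    funext i
    have := hz i
    rw [inner_sub_right, sub_eq_zero] at this
    rw [this, hGmul]
  have hyx : inner ℝ y x = (fun i => inner ℝ y (z i)) ⬝ᵥ b := by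
    rw [inner_sub_right, sub_eq_zero] at hy
    rw [hy, hcomb]
  -- a coefficient vector in the kernel of the Gram matrix gives the zero combination
  have hker : ∀ c : Fin m → ℝ, G *ᵥ c = 0 → ∑ i, c i • z i = 0 := by
    intro c hc
    rw [← inner_self_eq_zero (𝕜 := ℝ), hcomb]
    have : (fun i => inner ℝ (∑ j, c j • z j) (z i)) = G *ᵥ c := by
      rw [hGmul]
      funext i
      exact real_inner_comm _ _
    rw [this, hc, zero_dotProduct]
  have h0 : G *ᵥ (pinv G *ᵥ (G *ᵥ b) - b) = 0 := by
    rw [Matrix.mulVec_sub, Matrix.mulVec_mulVec, Matrix.mulVec_mulVec, (pinv_spec G).mul_mul_self,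
      sub_self]
  have h1 := hcomb y (pinv G *ᵥ (G *ᵥ b) - b)
  rw [hker _ h0, inner_zero_right, dotProduct_sub] at h1
  rw [hzx, hyx]
  linarith

variable {n : ℕ} {a v : Fin n → ℝ} {v₀ : ℝ} {d : Fin (n + 1) → ℝ} {X Y : Fin (n + 1) → H}

theorem IsCausalPair.init {a v : Fin (n + 1) → ℝ} {X Y : Fin (n + 1 + 1) → H}
    (h : IsCausalPair a v₀ v X Y) :
    IsCausalPair (fun k => a k.castSucc) v₀ (fun k => v k.castSucc) (fun k => X k.castSucc)
      (fun k => Y k.castSucc) where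
  norm_zero := h.norm_zero
  norm_innovation k := h.norm_innovation k.castSucc
  source_orthogonal k j hjk :=
    h.source_orthogonal k.castSucc j.castSucc (Fin.castSucc_le_castSucc_iff.2 hjk)
  output_orthogonal k j hjk :=
    h.output_orthogonal k.castSucc j.castSucc (Fin.castSucc_le_castSucc_iff.2 hjk)

theorem IsFeasible.init {a v : Fin (n + 1) → ℝ} {d : Fin (n + 1 + 1) → ℝ}
    (h : IsFeasible a v₀ v d) :
    IsFeasible (fun k => a k.castSucc) v₀ (fun k => v k.castSucc) (fun k => d k.castSucc) where
  var_pos _ := h.var_pos _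
  pos _ := h.pos _
  le_zero := h.le_zero
  le_succ k := h.le_succ k.castSucc

theorem backwardResidual_init {a v : Fin (n + 1) → ℝ} {d : Fin (n + 1 + 1) → ℝ}
    {X M : Fin (n + 1 + 1) → H} (k : Fin n) :
    backwardResidual (fun k => a k.castSucc) (fun k => v k.castSucc) (fun k => d k.castSucc)
      (fun k => X k.castSucc) (fun k => M k.castSucc) k.castSucc
      = backwardResidual a v d X M k.castSucc.castSucc := by
  simp [backwardResidual, backwardDifference, filterWeight, smoothingGain, predictedVariance]

theorem IsCausalPair.inner_source_succ (h : IsCausalPair a v₀ v X Y) {k : Fin n}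
    {j : Fin (n + 1)} (hjk : j ≤ k.castSucc) :
    inner ℝ (X j) (X k.succ) = a k * inner ℝ (X j) (X k.castSucc) := by
  have := h.source_orthogonal k j hjk
  rwa [inner_sub_right, inner_smul_right, sub_eq_zero] at this

theorem IsCausalPair.inner_output_succ (h : IsCausalPair a v₀ v X Y) {k : Fin n}
    {j : Fin (n + 1)} (hjk : j ≤ k.castSucc) :
    inner ℝ (Y j) (X k.succ) = a k * inner ℝ (Y j) (X k.castSucc) := by
  have := h.output_orthogonal k j hjk
  rwa [inner_sub_right, inner_smul_right, sub_eq_zero] at this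

theorem IsCausalPair.linearIndependent (h : IsCausalPair a v₀ v X Y) (hv₀ : 0 < v₀)
    (hv : ∀ k, 0 < v k) : LinearIndependent ℝ X := by
  induction n with
  | zero =>
    have : Subsingleton (Fin (0 + 1)) := inferInstanceAs (Subsingleton (Fin 1))
    refine LinearIndependent.of_subsingleton 0 ?_
    intro h0
    have := h.norm_zero
    rw [h0] at this
    simp at this
    linarith
  | succ n ih =>
    rw [← Fin.snoc_init_self X, linearIndependent_finSnoc]
    refine ⟨ih h.init (fun k => hv _), fun hmem => ?_⟩
    have hX : X (Fin.last (n + 1)) - a (Fin.last n) • X (Fin.last n).castSucc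
        ∈ Submodule.span ℝ (Set.range (Fin.init X)) :=
      sub_mem hmem (Submodule.smul_mem _ _ (Submodule.subset_span ⟨Fin.last n, rfl⟩))
    have h0 := inner_eq_zero_of_mem_span hX (y := X (Fin.last n).succ
      - a (Fin.last n) • X (Fin.last n).castSucc) (by
        rintro _ ⟨j, rfl⟩
        exact h.source_orthogonal (Fin.last n) _ (Fin.castSucc_le_castSucc_iff.2 (Fin.le_last j)))
    rw [← Fin.succ_last, real_inner_self_eq_norm_sq, h.norm_innovation] at h0
    exact (hv _).ne' h0

/-- Markov property of the source in second moments: the regression of the last sample on the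
previous ones only involves the preceding sample. -/
theorem IsCausalPair.inv_gram_mulVec {a v : Fin (n + 1) → ℝ} {X Y : Fin (n + 1 + 1) → H}
    (h : IsCausalPair a v₀ v X Y) (hv₀ : 0 < v₀) (hv : ∀ k, 0 < v k) :
    (crossGram (fun k : Fin (n + 1) => X k.castSucc) (fun k : Fin (n + 1) => X k.castSucc))⁻¹ *ᵥ
      (fun i : Fin (n + 1) => inner ℝ (X i.castSucc) (X (Fin.last (n + 1))))
      = Pi.single (Fin.last n) (a (Fin.last n)) := by
  set G := crossGram (fun k : Fin (n + 1) => X k.castSucc) (fun k : Fin (n + 1) => X k.castSucc)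
  have hG : IsUnit G.det := by
    have := (Matrix.posDef_gram_of_linearIndependent (𝕜 := ℝ)
      (h.init.linearIndependent hv₀ fun _ => hv _)).det_pos
    exact this.ne'.isUnit
  have h1 : (fun i : Fin (n + 1) => inner ℝ (X i.castSucc) (X (Fin.last (n + 1))))
      = G *ᵥ Pi.single (Fin.last n) (a (Fin.last n)) := by
    funext i
    rw [Matrix.mulVec_single, ← Fin.succ_last,
      h.inner_source_succ (Fin.castSucc_le_castSucc_iff.2 (Fin.le_last i))]
    simp [G, crossGram, mul_comm]
  rw [h1, Matrix.mulVec_mulVec, Matrix.nonsing_inv_mul G hG, Matrix.one_mulVec]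

theorem bordered_eq_crossGram {m : ℕ} (u w : Fin (m + 1) → H) :
    bordered (crossGram (fun k : Fin m => u k.castSucc) (fun k : Fin m => w k.castSucc))
      (fun i => inner ℝ (u i.castSucc) (w (Fin.last m)))
      (fun j => inner ℝ (u (Fin.last m)) (w j.castSucc))
      (inner ℝ (u (Fin.last m)) (w (Fin.last m))) = crossGram u w := by
  ext i j
  induction i using Fin.lastCases <;> induction j using Fin.lastCases <;>
    simp [bordered, crossGram]

/-- Each source sample has an estimate from the later source sample `x k` and the outputs strictly
before `k` whose error is orthogonal to every output and to `x k`. -/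
theorem IsCausalPair.exists_smoother (h : IsCausalPair a v₀ v X Y) (hd : IsFeasible a v₀ v d)
    (horth : ∀ j k, j ≤ k → inner ℝ (X k - Y k) (Y j) = 0) (hnorm : ∀ k, ‖X k - Y k‖ ^ 2 = d k)
    (hR : ∀ k j, inner ℝ (backwardResidual a v d X Y k) (Y j) = 0) (j : Fin (n + 1)) :
    ∃ s ∈ Submodule.span ℝ (Set.range
        (Fin.snoc (α := fun _ => H) (fun k : Fin n => Y k.castSucc) (X (Fin.last n)))),
      (∀ i, inner ℝ (Y i) (X j - s) = 0) ∧ inner ℝ (X (Fin.last n)) (X j - s) = 0 := by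
  induction j using Fin.reverseInduction with
  | last =>
    exact ⟨X (Fin.last n), Submodule.subset_span ⟨Fin.last n, by simp⟩, by simp, by simp⟩
  | cast j ih =>
    obtain ⟨s, hs, h1, h2⟩ := ih
    have hdec : X j.castSucc - (smoothingGain a v d j • s
        + filterWeight a v d j.castSucc • Y j.castSucc)
        = smoothingGain a v d j • (X j.succ - s) + backwardResidual a v d X Y j.castSucc := by
      simp only [backwardResidual, backwardDifference, Fin.snoc_castSucc]
      module
    refine ⟨smoothingGain a v d j • s + filterWeight a v d j.castSucc • Y j.castSucc,
      add_mem (Submodule.smul_mem _ _ hs) (Submodule.smul_mem _ _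
        (Submodule.subset_span ⟨j.castSucc, by simp⟩)), fun i => ?_, ?_⟩
    · rw [hdec, inner_add_right, inner_smul_right, h1 i, real_inner_comm, hR, mul_zero, add_zero]
    · rw [hdec, inner_add_right, inner_smul_right, h2, real_inner_comm,
        h.backwardResidual_source hd horth hnorm (Fin.castSucc_lt_last j), mul_zero, add_zero]

/-- If the errors are orthogonal to the past outputs and the backward errors to all outputs, the
second moments are the ones computed by the recursive procedure. -/
theorem IsCausalPair.gram_eq_procedureOne (h : IsCausalPair a v₀ v X Y)
    (hd : IsFeasible a v₀ v d)
    (horth : ∀ j k, j ≤ k → inner ℝ (X k - Y k) (Y j) = 0) (hnorm : ∀ k, ‖X k - Y k‖ ^ 2 = d k)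
    (hR : ∀ k j, inner ℝ (backwardResidual a v d X Y k) (Y j) = 0) :
    (crossGram Y Y, crossGram Y X) = procedureOne n (crossGram X X) d := by
  have hself : ∀ k, inner ℝ (Y k) (X k) = inner ℝ (X k) (X k) - d k ∧
      inner ℝ (Y k) (Y k) = inner ℝ (X k) (X k) - d k := by
    intro k
    have h1 := horth k k le_rfl
    have h2 := hnorm k
    rw [norm_sub_sq_real, ← real_inner_self_eq_norm_sq, ← real_inner_self_eq_norm_sq] at h2
    rw [inner_sub_left] at h1
    have h3 := real_inner_comm (X k) (Y k)
    constructor <;> linarith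
  induction n with
  | zero =>
    refine Prod.ext ?_ ?_ <;> ext i j <;> obtain rfl := Subsingleton.elim (α := Fin 1) i 0 <;>
      obtain rfl := Subsingleton.elim (α := Fin 1) j 0
    · exact (hself 0).2
    · exact (hself 0).1
  | succ n ih =>
    have h0 : 0 < v₀ := (hd.pos 0).trans_le hd.le_zero
    have hR' : ∀ k : Fin (n + 1), ∀ j : Fin (n + 1),
        inner ℝ (backwardResidual (fun k => a k.castSucc) (fun k => v k.castSucc)
          (fun k => d k.castSucc) (fun k => X k.castSucc) (fun k => Y k.castSucc) k)
          (Y j.castSucc) = 0 := by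
      intro k j
      induction k using Fin.lastCases with
      | last =>
        rw [backwardResidual_last]
        exact horth _ _ (Fin.castSucc_le_castSucc_iff.2 (Fin.le_last j))
      | cast k => rw [backwardResidual_init]; exact hR _ _
    have ih' := ih h.init hd.init
      (fun j k hjk => horth _ _ (Fin.castSucc_le_castSucc_iff.2 hjk)) (fun k => hnorm _) hR'
      (fun k => hself _)
    have hsub : (crossGram X X).submatrix Fin.castSucc Fin.castSucc
        = crossGram (fun k : Fin (n + 1) => X k.castSucc) (fun k => X k.castSucc) := rfl
    rw [procedureOne, hsub, ← ih']
    have hu : (fun i : Fin (n + 1) => crossGram X X i.castSucc (Fin.last (n + 1)))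
        = fun i : Fin (n + 1) => inner ℝ (X i.castSucc) (X (Fin.last (n + 1))) := rfl
    have hyx : (crossGram (fun k : Fin (n + 1) => Y k.castSucc) (fun k => X k.castSucc)
        * (crossGram (fun k : Fin (n + 1) => X k.castSucc) (fun k => X k.castSucc))⁻¹) *ᵥ
        (fun i : Fin (n + 1) => inner ℝ (X i.castSucc) (X (Fin.last (n + 1))))
        = fun i : Fin (n + 1) => inner ℝ (Y i.castSucc) (X (Fin.last (n + 1))) := by
      rw [← Matrix.mulVec_mulVec, h.inv_gram_mulVec h0 hd.var_pos]
      funext i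
      rw [Matrix.mulVec_single, ← Fin.succ_last,
        h.inner_output_succ (Fin.castSucc_le_castSucc_iff.2 (Fin.le_last i))]
      simp [crossGram, mul_comm]
    have hyy : (fun i : Fin (n + 1) => inner ℝ (Y i.castSucc) (X (Fin.last (n + 1))))
        = fun i : Fin (n + 1) => inner ℝ (Y i.castSucc) (Y (Fin.last (n + 1))) := by
      funext i
      have := horth i.castSucc _ (Fin.le_last _)
      rw [inner_sub_left, sub_eq_zero] at this
      rw [real_inner_comm, this, real_inner_comm]
    have hyy' : (fun i : Fin (n + 1) => inner ℝ (Y i.castSucc) (X (Fin.last (n + 1))))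
        = fun i : Fin (n + 1) => inner ℝ (Y (Fin.last (n + 1))) (Y i.castSucc) := by
      rw [hyy]
      funext i
      exact real_inner_comm _ _
    set z : Fin (n + 1 + 1) → H :=
      Fin.snoc (α := fun _ => H) (fun k : Fin (n + 1) => Y k.castSucc) (X (Fin.last (n + 1)))
      with hz
    have hbz : bordered (crossGram (fun k : Fin (n + 1) => Y k.castSucc) (fun k => Y k.castSucc))
        (fun i : Fin (n + 1) => inner ℝ (Y i.castSucc) (X (Fin.last (n + 1))))
        (fun i : Fin (n + 1) => inner ℝ (Y i.castSucc) (X (Fin.last (n + 1))))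
        (crossGram X X (Fin.last (n + 1)) (Fin.last (n + 1))) = crossGram z z := by
      rw [← bordered_eq_crossGram z z]
      simp only [hz, Fin.snoc_castSucc, Fin.snoc_last]
      congr 1
      funext i
      exact real_inner_comm _ _
    have hsn : Fin.snoc (α := fun _ => ℝ)
        (fun i : Fin (n + 1) => inner ℝ (Y i.castSucc) (X (Fin.last (n + 1))))
        (crossGram X X (Fin.last (n + 1)) (Fin.last (n + 1)) - d (Fin.last (n + 1)))
        = fun i => inner ℝ (Y (Fin.last (n + 1))) (z i) := by
      funext i
      induction i using Fin.lastCases with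
      | last => simp [hz, (hself (Fin.last (n + 1))).1, crossGram]
      | cast i => rw [hyy']; simp [hz]
    have hof : Matrix.of (Fin.snoc (α := fun _ => Fin (n + 1) → ℝ)
        (crossGram (fun k : Fin (n + 1) => Y k.castSucc) (fun k => X k.castSucc))
        (fun i : Fin (n + 1) => inner ℝ (X i.castSucc) (X (Fin.last (n + 1)))))
        = crossGram z (fun k : Fin (n + 1) => X k.castSucc) := by
      ext i j
      rw [Matrix.of_apply]
      induction i using Fin.lastCases with
      | last =>
        refine (congrFun (Fin.snoc_last (α := fun _ => Fin (n + 1) → ℝ) _ _) j).trans ?_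
        simp [hz, crossGram, real_inner_comm (X (Fin.last (n + 1)))]
      | cast i =>
        refine (congrFun (Fin.snoc_castSucc (α := fun _ => Fin (n + 1) → ℝ) _ _ i) j).trans ?_
        simp [hz, crossGram]
    have hw : (fun i => inner ℝ (Y (Fin.last (n + 1))) (z i)) ᵥ*
        (pinv (crossGram z z) * crossGram z (fun k : Fin (n + 1) => X k.castSucc))
        = fun j : Fin (n + 1) => inner ℝ (Y (Fin.last (n + 1))) (X j.castSucc) := by
      funext j
      obtain ⟨s, hs, h1, h2⟩ := h.exists_smoother hd horth hnorm hR j.castSucc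
      rw [← vecMul_pinv_gram z (Y (Fin.last (n + 1))) (X j.castSucc) s hs ?_ (h1 _),
        Matrix.dotProduct_mulVec]
      · rw [← Matrix.vecMul_vecMul]
        rfl
      · intro i
        induction i using Fin.lastCases with
        | last => simpa [hz] using h2
        | cast i => simpa [hz] using h1 _
    rw [procedureStep]
    simp only [hsub, hyx, hbz, hsn, hof, hu, hw]
    refine Prod.ext ?_ ?_
    · rw [← bordered_eq_crossGram Y Y, ← hyy, ← hyy', (hself _).2]
      rfl
    · rw [← bordered_eq_crossGram Y X, (hself _).1]
      rfl

/-- The diagonals of both matrices computed by the procedure are the source variances minus the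
effective distortions. -/
theorem procedureOne_diag (n : ℕ) (K : Matrix (Fin (n + 1)) (Fin (n + 1)) ℝ)
    (d : Fin (n + 1) → ℝ) (k : Fin (n + 1)) :
    (procedureOne n K d).1 k k = K k k - d k ∧ (procedureOne n K d).2 k k = K k k - d k := by
  induction n with
  | zero => obtain rfl := Subsingleton.elim (α := Fin 1) k 0; exact ⟨rfl, rfl⟩
  | succ n ih =>
    rw [procedureOne, procedureStep]
    induction k using Fin.lastCases with
    | last => simp [bordered]
    | cast k =>
      have := ih (K.submatrix Fin.castSucc Fin.castSucc) (fun i => d i.castSucc) k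
      simpa [bordered] using this

end Procedure

/-! ### Gaussian densities and unit-triangular changes of variables -/

section Densities

/-- The logarithm of the Lebesgue density of independent centred Gaussian variables with
variances `V`. -/
def gaussianLogDensity {m : ℕ} (V : Fin m → ℝ≥0) (z : Fin m → ℝ) : ℝ :=
  ∑ k, (-(1 / 2) * Real.log (2 * Real.pi * V k) - z k ^ 2 / (2 * V k))

variable {m : ℕ}

theorem continuous_gaussianLogDensity (V : Fin m → ℝ≥0) : Continuous (gaussianLogDensity V) := by
  unfold gaussianLogDensity
  fun_prop

theorem exp_gaussianLogDensity {V : Fin m → ℝ≥0} (hV : ∀ k, 0 < V k) (z : Fin m → ℝ) :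
    Real.exp (gaussianLogDensity V z) = ∏ k, gaussianPDFReal 0 (V k) (z k) := by
  rw [gaussianLogDensity, Real.exp_sum]
  refine Finset.prod_congr rfl fun k _ => ?_
  have h0 : (0 : ℝ) < 2 * Real.pi * V k :=
    mul_pos Real.two_pi_pos (NNReal.coe_pos.2 (hV k))
  rw [gaussianPDFReal, sub_eq_add_neg, Real.exp_add, Real.sqrt_eq_rpow, ← Real.rpow_neg h0.le,
    Real.rpow_def_of_pos h0, sub_zero, neg_div]
  ring_nf

theorem pi_gaussianReal_eq_withDensity {V : Fin m → ℝ≥0} (hV : ∀ k, 0 < V k) :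
    Measure.pi (fun k => gaussianReal 0 (V k)) =
      volume.withDensity fun z => ENNReal.ofReal (Real.exp (gaussianLogDensity V z)) := by
  refine Measure.pi_eq fun s hs => ?_
  rw [withDensity_apply _ (MeasurableSet.univ_pi hs), volume_pi, Measure.restrict_pi_pi]
  simp_rw [exp_gaussianLogDensity hV]
  rw [← ofReal_integral_eq_lintegral_ofReal]
  · rw [integral_fintype_prod_eq_prod (𝕜 := ℝ) (fun k => gaussianPDFReal 0 (V k)),
      ENNReal.ofReal_prod_of_nonneg]
    · exact Finset.prod_congr rfl fun k _ =>
        (gaussianReal_apply_eq_integral 0 (hV k).ne' (s k)).symm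
    · exact fun k _ => integral_nonneg fun x => gaussianPDFReal_nonneg _ _ _
  · exact Integrable.fintype_prod fun k => (integrable_gaussianPDFReal 0 (V k)).restrict
  · exact Filter.Eventually.of_forall fun z =>
      Finset.prod_nonneg fun k _ => gaussianPDFReal_nonneg _ _ _

theorem withDensity_of_map_eq {α β : Type*} [MeasurableSpace α] [MeasurableSpace β]
    {ν μ : Measure α} {μ' : Measure β} {f : α → β} (hf : MeasurableEmbedding f)
    (hμ : MeasurePreserving f μ μ') {g : β → ℝ≥0∞} (h : ν.map f = μ'.withDensity g) :
    ν = μ.withDensity (g ∘ f) := by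
  ext s hs
  have h1 : ν s = ν.map f (f '' s) := by
    rw [hf.map_apply, Set.preimage_image_eq _ hf.injective]
  rw [h1, h, withDensity_apply _ (hf.measurableSet_image.2 hs), withDensity_apply _ hs,
    ← hμ.map_eq, hf.restrict_map, hf.lintegral_map, Set.preimage_image_eq _ hf.injective]
  rfl

theorem injective_of_det_ne_zero {f : (Fin m → ℝ) →ₗ[ℝ] (Fin m → ℝ)} (hf : LinearMap.det f ≠ 0) :
    Function.Injective f :=
  (LinearMap.equivOfDetNeZero f hf).injective

theorem measurePreserving_of_det_eq_one {f : (Fin m → ℝ) →ₗ[ℝ] (Fin m → ℝ)}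
    (hf : LinearMap.det f = 1) : MeasurePreserving f volume volume := by
  refine ⟨(LinearMap.continuous_of_finiteDimensional f).measurable, ?_⟩
  rw [Real.map_linearMap_volume_pi_eq_smul_volume_pi (by rw [hf]; exact one_ne_zero), hf]
  simp

/-- The shear `(x, y) ↦ (B x - S y, y)` preserves the product of Lebesgue measure with any
measure in the second coordinate. -/
theorem measurePreserving_shear {B S : (Fin m → ℝ) →ₗ[ℝ] (Fin m → ℝ)} (hB : LinearMap.det B = 1)
    (κ : Measure (Fin m → ℝ)) [IsProbabilityMeasure κ] :
    MeasurePreserving (fun p : (Fin m → ℝ) × (Fin m → ℝ) => (B p.1 - S p.2, p.2))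
      ((volume : Measure (Fin m → ℝ)).prod κ) ((volume : Measure (Fin m → ℝ)).prod κ) := by
  have hBm : Measurable B := (LinearMap.continuous_of_finiteDimensional B).measurable
  have hSm : Measurable S := (LinearMap.continuous_of_finiteDimensional S).measurable
  have h1 := (MeasurePreserving.id κ).skew_product (μc := (volume : Measure (Fin m → ℝ)))
    (g := fun y x => B x - S y) (μd := (volume : Measure (Fin m → ℝ)))
    (by simp only [Function.uncurry_def]; fun_prop)
    (Filter.Eventually.of_forall fun y =>
      ((measurePreserving_sub_right volume (S y)).comp (measurePreserving_of_det_eq_one hB)).map_eq)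
  exact (Measure.measurePreserving_swap.comp h1).comp Measure.measurePreserving_swap

theorem measurableEmbedding_shear {B S : (Fin m → ℝ) →ₗ[ℝ] (Fin m → ℝ)}
    (hB : LinearMap.det B = 1) :
    MeasurableEmbedding fun p : (Fin m → ℝ) × (Fin m → ℝ) => (B p.1 - S p.2, p.2) := by
  have hBc : Continuous B := LinearMap.continuous_of_finiteDimensional B
  have hSc : Continuous S := LinearMap.continuous_of_finiteDimensional S
  refine Continuous.measurableEmbedding (by fun_prop) fun p q hpq => ?_
  obtain ⟨h1, h2⟩ := Prod.ext_iff.1 hpq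
  dsimp only at h1 h2
  rw [h2, sub_left_inj] at h1
  exact Prod.ext (injective_of_det_ne_zero (by rw [hB]; exact one_ne_zero) h1) h2

/-- If `A x` has independent centred Gaussian coordinates of variances `V`, for a linear map `A` of
determinant one, this is the density of `x`. -/
theorem eq_withDensity_of_map_eq_pi {A : (Fin m → ℝ) →ₗ[ℝ] (Fin m → ℝ)}
    (hA : LinearMap.det A = 1) {V : Fin m → ℝ≥0} (hV : ∀ k, 0 < V k) {P : Measure (Fin m → ℝ)}
    (hP : P.map A = Measure.pi fun k => gaussianReal 0 (V k)) :
    P = volume.withDensity fun x => ENNReal.ofReal (Real.exp (gaussianLogDensity V (A x))) := by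
  rw [pi_gaussianReal_eq_withDensity hV] at hP
  have hemb : MeasurableEmbedding A :=
    (LinearMap.continuous_of_finiteDimensional A).measurableEmbedding
      (injective_of_det_ne_zero (by rw [hA]; exact one_ne_zero))
  exact withDensity_of_map_eq (g := fun z => ENNReal.ofReal (Real.exp (gaussianLogDensity V z)))
    hemb (measurePreserving_of_det_eq_one hA) hP

/-- The log-likelihood ratio of the Gaussian channel in which `B x - S y` is independent of `y`
with independent coordinates of variances `τ`, relative to the source law under which `A x` has
independent coordinates of variances `V`. -/
def channelLogRatio (A B S : (Fin m → ℝ) →ₗ[ℝ] (Fin m → ℝ)) (V τ : Fin m → ℝ≥0)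
    (p : (Fin m → ℝ) × (Fin m → ℝ)) : ℝ :=
  gaussianLogDensity τ (B p.1 - S p.2) - gaussianLogDensity V (A p.1)

variable {A B S : (Fin m → ℝ) →ₗ[ℝ] (Fin m → ℝ)} {V τ : Fin m → ℝ≥0}

theorem continuous_channelLogRatio : Continuous (channelLogRatio A B S V τ) := by
  have hA : Continuous A := LinearMap.continuous_of_finiteDimensional A
  have hB : Continuous B := LinearMap.continuous_of_finiteDimensional B
  have hS : Continuous S := LinearMap.continuous_of_finiteDimensional S
  have := continuous_gaussianLogDensity V
  have := continuous_gaussianLogDensity τ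
  unfold channelLogRatio
  fun_prop

theorem prod_withDensity_channelLogRatio (hA : LinearMap.det A = 1) (hV : ∀ k, 0 < V k)
    {P : Measure (Fin m → ℝ)} [IsProbabilityMeasure P]
    (hP : P.map A = Measure.pi fun k => gaussianReal 0 (V k))
    (κ : Measure (Fin m → ℝ)) [IsProbabilityMeasure κ] :
    (P.prod κ).withDensity (fun p => ENNReal.ofReal (Real.exp (channelLogRatio A B S V τ p))) =
      ((volume : Measure (Fin m → ℝ)).prod κ).withDensity fun p =>
        ENNReal.ofReal (Real.exp (gaussianLogDensity τ (B p.1 - S p.2))) := by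
  have hAm : Measurable A := (LinearMap.continuous_of_finiteDimensional A).measurable
  have hVm := (continuous_gaussianLogDensity V).measurable
  have hm : Measurable fun x => ENNReal.ofReal (Real.exp (gaussianLogDensity V (A x))) := by
    fun_prop
  have hr : Measurable fun p =>
      ENNReal.ofReal (Real.exp (channelLogRatio A B S V τ p)) := by
    have := (continuous_channelLogRatio (A := A) (B := B) (S := S) (V := V) (τ := τ)).measurable
    fun_prop
  have hP' := eq_withDensity_of_map_eq_pi hA hV hP
  have hsf : SFinite (volume.withDensity fun x =>
      ENNReal.ofReal (Real.exp (gaussianLogDensity V (A x)))) := by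
    rw [← hP']
    infer_instance
  rw [hP', prod_withDensity_left hm, ← withDensity_mul _ (by fun_prop) hr]
  congr 1
  funext p
  rw [Pi.mul_apply, ← ENNReal.ofReal_mul (Real.exp_pos _).le, ← Real.exp_add, channelLogRatio]
  congr 2
  ring

/-- The law of a pair is determined by the law of its second coordinate when `B x - S y` is
independent of `y` with independent Gaussian coordinates. -/
theorem eq_withDensity_channelLogRatio (hA : LinearMap.det A = 1) (hB : LinearMap.det B = 1)
    (hV : ∀ k, 0 < V k) (hτ : ∀ k, 0 < τ k) {P : Measure (Fin m → ℝ)} [IsProbabilityMeasure P]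
    (hP : P.map A = Measure.pi fun k => gaussianReal 0 (V k))
    {κ : Measure (Fin m → ℝ)} [IsProbabilityMeasure κ]
    {ν : Measure ((Fin m → ℝ) × (Fin m → ℝ))}
    (hν : ν.map (fun p => (B p.1 - S p.2, p.2)) =
      (Measure.pi fun k => gaussianReal 0 (τ k)).prod κ) :
    ν = (P.prod κ).withDensity fun p =>
      ENNReal.ofReal (Real.exp (channelLogRatio A B S V τ p)) := by
  have hm : Measurable fun z => ENNReal.ofReal (Real.exp (gaussianLogDensity τ z)) := by
    have := (continuous_gaussianLogDensity τ).measurable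
    fun_prop
  have hsf : SFinite ((volume : Measure (Fin m → ℝ)).withDensity fun z =>
      ENNReal.ofReal (Real.exp (gaussianLogDensity τ z))) := by
    rw [← pi_gaussianReal_eq_withDensity hτ]
    infer_instance
  rw [prod_withDensity_channelLogRatio hA hV hP κ]
  rw [pi_gaussianReal_eq_withDensity hτ, prod_withDensity_left hm] at hν
  exact withDensity_of_map_eq
    (g := fun p : (Fin m → ℝ) × (Fin m → ℝ) =>
      ENNReal.ofReal (Real.exp (gaussianLogDensity τ p.1)))
    (measurableEmbedding_shear hB) (measurePreserving_shear hB κ) hν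

theorem lintegral_exp_channelLogRatio (hA : LinearMap.det A = 1) (hB : LinearMap.det B = 1)
    (hV : ∀ k, 0 < V k) (hτ : ∀ k, 0 < τ k) {P : Measure (Fin m → ℝ)} [IsProbabilityMeasure P]
    (hP : P.map A = Measure.pi fun k => gaussianReal 0 (V k))
    (κ : Measure (Fin m → ℝ)) [IsProbabilityMeasure κ] :
    ∫⁻ p, ENNReal.ofReal (Real.exp (channelLogRatio A B S V τ p)) ∂(P.prod κ) = 1 := by
  have hm : Measurable fun z => ENNReal.ofReal (Real.exp (gaussianLogDensity τ z)) := by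
    have := (continuous_gaussianLogDensity τ).measurable
    fun_prop
  have hsf : SFinite ((volume : Measure (Fin m → ℝ)).withDensity fun z =>
      ENNReal.ofReal (Real.exp (gaussianLogDensity τ z))) := by
    rw [← pi_gaussianReal_eq_withDensity hτ]
    infer_instance
  have h1 : ((Measure.pi fun k => gaussianReal 0 (τ k)).prod κ) Set.univ = 1 := measure_univ
  rw [pi_gaussianReal_eq_withDensity hτ, prod_withDensity_left hm,
    withDensity_apply _ MeasurableSet.univ, setLIntegral_univ,
    ← (measurePreserving_shear (S := S) hB κ).lintegral_comp_emb
      (measurableEmbedding_shear hB)] at h1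
  rw [← setLIntegral_univ, ← withDensity_apply _ MeasurableSet.univ,
    prod_withDensity_channelLogRatio hA hV hP κ, withDensity_apply _ MeasurableSet.univ,
    setLIntegral_univ]
  exact h1

end Densities

/-! ### The Gibbs variational inequality -/

section Gibbs

variable {α : Type*} [MeasurableSpace α] {ν ρ : Measure α} [IsProbabilityMeasure ν]
  [IsProbabilityMeasure ρ] {f : α → ℝ}

/-- Gibbs' inequality: the difference of the two sides is the divergence of `ν` from the measure
tilted by `f`. -/
theorem ofReal_integral_le_klDiv (hfm : Measurable f) (hf : Integrable f ν)
    (hexp : ∫⁻ x, ENNReal.ofReal (Real.exp (f x)) ∂ρ = 1) :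
    ENNReal.ofReal (∫ x, f x ∂ν) ≤ InformationTheory.klDiv ν ρ := by
  by_cases htop : InformationTheory.klDiv ν ρ = ∞
  · rw [htop]
    exact le_top
  obtain ⟨hac, hint⟩ := InformationTheory.klDiv_ne_top_iff.1 htop
  have hei : Integrable (fun x => Real.exp (f x)) ρ := by
    refine ⟨by fun_prop, ?_⟩
    rw [hasFiniteIntegral_iff_ofReal (Filter.Eventually.of_forall fun x => (Real.exp_pos _).le),
      hexp]
    exact ENNReal.one_lt_top
  have hone : ∫ x, Real.exp (f x) ∂ρ = 1 := by
    rw [integral_eq_lintegral_of_nonneg_ae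
      (Filter.Eventually.of_forall fun x => (Real.exp_pos _).le) (by fun_prop), hexp,
      ENNReal.toReal_one]
  have : IsProbabilityMeasure (ρ.tilted f) := isProbabilityMeasure_tilted hei
  have h1 := integral_llr_tilted_right hac hf hei hint
  have hac' : ν ≪ ρ.tilted f := hac.trans (absolutelyContinuous_tilted hei)
  have h2 := InformationTheory.toReal_klDiv_of_measure_eq hac' (by simp)
  have h3 := InformationTheory.toReal_klDiv_of_measure_eq hac (by simp)
  have h4 : 0 ≤ (InformationTheory.klDiv ν (ρ.tilted f)).toReal := ENNReal.toReal_nonneg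
  rw [hone, Real.log_one, add_zero, ← h3, ← h2] at h1
  refine ENNReal.ofReal_le_of_le_toReal ?_
  linarith

/-- The case of equality in Gibbs' inequality. -/
theorem klDiv_eq_ofReal_integral (hfm : Measurable f) (hf : Integrable f ν)
    (hν : ν = ρ.withDensity fun x => ENNReal.ofReal (Real.exp (f x))) :
    InformationTheory.klDiv ν ρ = ENNReal.ofReal (∫ x, f x ∂ν) := by
  have hac : ν ≪ ρ := by
    rw [hν]
    exact withDensity_absolutelyContinuous _ _
  have hllr : llr ν ρ =ᵐ[ν] f := by
    have h1 : ν.rnDeriv ρ =ᵐ[ρ] fun x => ENNReal.ofReal (Real.exp (f x)) := by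
      conv_lhs => rw [hν]
      exact Measure.rnDeriv_withDensity _ (by fun_prop)
    filter_upwards [hac.ae_le h1] with x hx
    rw [llr, hx, ENNReal.toReal_ofReal (Real.exp_pos _).le, Real.log_exp]
  have hint : Integrable (llr ν ρ) ν := hf.congr hllr.symm
  rw [← ENNReal.ofReal_toReal (InformationTheory.klDiv_ne_top hac hint),
    InformationTheory.toReal_klDiv_of_measure_eq hac (by simp), integral_congr_ae hllr]

end Gibbs

/-! ### Linearity of innovations and backward differences -/

section Linear

variable {n : ℕ} {E F : Type*} [AddCommGroup E] [Module ℝ E] [AddCommGroup F] [Module ℝ F]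
  (a v : Fin n → ℝ) (d : Fin (n + 1) → ℝ)

theorem innovation_zero (X : Fin (n + 1) → E) : innovation a X 0 = X 0 := rfl

theorem innovation_succ (X : Fin (n + 1) → E) (k : Fin n) :
    innovation a X k.succ = X k.succ - a k • X k.castSucc := rfl

theorem map_innovation (f : E →ₗ[ℝ] F) (X : Fin (n + 1) → E) (k : Fin (n + 1)) :
    f (innovation a X k) = innovation a (fun i => f (X i)) k := by
  induction k using Fin.cases <;> simp [innovation]

theorem map_backwardDifference (f : E →ₗ[ℝ] F) (X : Fin (n + 1) → E) (k : Fin (n + 1)) :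
    f (backwardDifference a v d X k) = backwardDifference a v d (fun i => f (X i)) k := by
  induction k using Fin.lastCases <;> simp [backwardDifference]

theorem map_backwardResidual (f : E →ₗ[ℝ] F) (X M : Fin (n + 1) → E) (k : Fin (n + 1)) :
    f (backwardResidual a v d X M k)
      = backwardResidual a v d (fun i => f (X i)) (fun i => f (M i)) k := by
  simp [backwardResidual, map_backwardDifference]

/-- `innovation` on real sequences as a linear map. -/
def innovationLinear : (Fin (n + 1) → ℝ) →ₗ[ℝ] (Fin (n + 1) → ℝ) where
  toFun := innovation a
  map_add' x y := by
    funext k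
    induction k using Fin.cases with
    | zero => rfl
    | succ k => simp only [innovation_succ, Pi.add_apply, smul_eq_mul]; ring
  map_smul' c x := by
    funext k
    induction k using Fin.cases with
    | zero => rfl
    | succ k => simp only [innovation_succ, Pi.smul_apply, smul_eq_mul, RingHom.id_apply]; ring

/-- `backwardDifference` on real sequences as a linear map. -/
def backwardDifferenceLinear : (Fin (n + 1) → ℝ) →ₗ[ℝ] (Fin (n + 1) → ℝ) where
  toFun := backwardDifference a v d
  map_add' x y := by
    funext k
    induction k using Fin.lastCases with
    | last => simp [backwardDifference]
    | cast k =>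
      simp only [backwardDifference, Fin.snoc_castSucc, Pi.add_apply, smul_eq_mul]
      ring
  map_smul' c x := by
    funext k
    induction k using Fin.lastCases with
    | last => simp [backwardDifference]
    | cast k =>
      simp only [backwardDifference, Fin.snoc_castSucc, Pi.smul_apply, smul_eq_mul,
        RingHom.id_apply]
      ring

theorem innovationLinear_apply (x : Fin (n + 1) → ℝ) : innovationLinear a x = innovation a x := rfl

theorem backwardDifferenceLinear_apply (x : Fin (n + 1) → ℝ) :
    backwardDifferenceLinear a v d x = backwardDifference a v d x := rfl

theorem det_innovationLinear : LinearMap.det (innovationLinear a) = 1 := by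
  rw [← LinearMap.det_toMatrix', Matrix.det_of_isLowerTriangular]
  · refine Finset.prod_eq_one fun k _ => ?_
    rw [LinearMap.toMatrix'_apply, innovationLinear_apply]
    induction k using Fin.cases with
    | zero => simp [innovation]
    | succ k => simp [innovation_succ, (Fin.castSucc_lt_succ (i := k)).ne]
  · intro i j hij
    have hij' : i < j := hij
    rw [LinearMap.toMatrix'_apply, innovationLinear_apply]
    induction i using Fin.cases with
    | zero => simp [innovation, hij'.ne]
    | succ i =>
      simp [innovation_succ, hij'.ne, ((Fin.castSucc_lt_succ (i := i)).trans hij').ne]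

theorem det_backwardDifferenceLinear : LinearMap.det (backwardDifferenceLinear a v d) = 1 := by
  rw [← LinearMap.det_toMatrix', Matrix.det_of_isUpperTriangular]
  · refine Finset.prod_eq_one fun k _ => ?_
    rw [LinearMap.toMatrix'_apply, backwardDifferenceLinear_apply]
    induction k using Fin.lastCases with
    | last => simp [backwardDifference]
    | cast k => simp [backwardDifference, (Fin.castSucc_lt_succ (i := k)).ne']
  · intro i j hij
    have hij' : j < i := hij
    rw [LinearMap.toMatrix'_apply, backwardDifferenceLinear_apply]
    induction i using Fin.lastCases with
    | last => simp [backwardDifference, hij'.ne']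
    | cast i =>
      simp [backwardDifference, hij'.ne', (hij'.trans (Fin.castSucc_lt_succ (i := i))).ne']

end Linear

/-! ### Square-integrable functions as vectors -/

section SquareIntegrable

variable {α : Type*} [MeasurableSpace α] (ν : Measure α)

/-- The vector space of square-integrable functions, before identifying almost everywhere equal
ones: pointwise evaluation and passage to `Lp` are both linear on it. -/
def squareIntegrable : Submodule ℝ (α → ℝ) where
  carrier := {f | MemLp f 2 ν}
  add_mem' hf hg := MemLp.add hf hg
  zero_mem' := MemLp.zero
  smul_mem' c _ hf := MemLp.const_smul hf c

/-- The class of a square-integrable function in `L²`. -/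
def toL2 : squareIntegrable ν →ₗ[ℝ] Lp ℝ 2 ν where
  toFun f := MemLp.toLp f.1 f.2
  map_add' f g := MemLp.toLp_add f.2 g.2
  map_smul' c f := MemLp.toLp_const_smul c f.2

variable {ν}

theorem inner_toL2 (f g : squareIntegrable ν) :
    inner ℝ (toL2 ν f) (toL2 ν g) = ∫ x, f.1 x * g.1 x ∂ν := by
  rw [L2.inner_def]
  refine integral_congr_ae ?_
  filter_upwards [MemLp.coeFn_toLp f.2, MemLp.coeFn_toLp g.2] with x hf hg
  change inner ℝ (MemLp.toLp f.1 f.2 x) (MemLp.toLp g.1 g.2 x) = _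
  rw [hf, hg, real_inner_eq_re_inner, RCLike.inner_apply]
  simp [mul_comm]

theorem norm_toL2_sq (f : squareIntegrable ν) : ‖toL2 ν f‖ ^ 2 = ∫ x, f.1 x ^ 2 ∂ν := by
  rw [← real_inner_self_eq_norm_sq, inner_toL2]
  simp only [sq]

/-- Evaluation of a square-integrable function at a point. -/
def evalAt (x : α) : squareIntegrable ν →ₗ[ℝ] ℝ where
  toFun f := f.1 x
  map_add' _ _ := rfl
  map_smul' _ _ := rfl

end SquareIntegrable

/-! ### The lower bound on the rate -/

section LowerBound

variable {n : ℕ} {a : Fin n → ℝ} {v₀ : ℝ≥0} {v : Fin n → ℝ≥0} {d : Fin (n + 1) → ℝ}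

/-- The sum of the logarithmic rates at the successive times, in nats. -/
def totalRate (a : Fin n → ℝ) (v₀ : ℝ) (v : Fin n → ℝ) (d : Fin (n + 1) → ℝ) : ℝ :=
  1 / 2 * Real.log (v₀ / d 0)
    + 1 / 2 * ∑ k : Fin n, Real.log (predictedVariance a v d k / d k.succ)

/-- The sum telescopes, because `backwardVariance k = d k * v k / predictedVariance k`. -/
theorem sum_log_sub_log_backwardVariance (hv₀ : 0 < v₀)
    (hd : IsFeasible a v₀ (fun k => (v k : ℝ)) d) :
    ∑ k, Real.log ((Fin.cons (α := fun _ => ℝ≥0) v₀ v : Fin (n + 1) → ℝ≥0) k)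
      - ∑ k, Real.log (backwardVariance a (fun k => (v k : ℝ)) d k)
      = 2 * totalRate a v₀ (fun k => (v k : ℝ)) d := by
  have hv₀' : (v₀ : ℝ) ≠ 0 := (NNReal.coe_pos.2 hv₀).ne'
  have hterm : ∀ k : Fin n, Real.log (d k.castSucc * v k
      / predictedVariance a (fun k => (v k : ℝ)) d k)
      = Real.log (d k.castSucc) + Real.log (v k)
        - Real.log (predictedVariance a (fun k => (v k : ℝ)) d k) := fun k => by
    rw [Real.log_div (mul_pos (hd.pos _) (hd.var_pos k)).ne' (hd.predictedVariance_pos k).ne',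
      Real.log_mul (hd.pos _).ne' (hd.var_pos k).ne']
  have hterm' : ∀ k : Fin n, Real.log (predictedVariance a (fun k => (v k : ℝ)) d k / d k.succ)
      = Real.log (predictedVariance a (fun k => (v k : ℝ)) d k) - Real.log (d k.succ) :=
    fun k => Real.log_div (hd.predictedVariance_pos k).ne' (hd.pos _).ne'
  have hshift : ∑ k : Fin n, Real.log (d k.castSucc) + Real.log (d (Fin.last n))
      = Real.log (d 0) + ∑ k : Fin n, Real.log (d k.succ) := by
    rw [← Fin.sum_univ_castSucc (fun k => Real.log (d k)), Fin.sum_univ_succ]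
  rw [totalRate, Real.log_div hv₀' (hd.pos 0).ne', Fin.sum_univ_succ, Fin.sum_univ_castSucc]
  simp only [backwardVariance, Fin.snoc_castSucc, Fin.snoc_last, Fin.cons_zero, Fin.cons_succ,
    hterm, hterm', Finset.sum_sub_distrib, Finset.sum_add_distrib]
  linarith

variable {ν : Measure ((Fin (n + 1) → ℝ) × (Fin (n + 1) → ℝ))}

/-- The linear map that multiplies the coefficient matrix of linear estimates by their weights in
the backward residuals. -/
def weightedEstimate (w : Fin (n + 1) → ℝ) (C : Matrix (Fin (n + 1)) (Fin (n + 1)) ℝ) :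
    (Fin (n + 1) → ℝ) →ₗ[ℝ] (Fin (n + 1) → ℝ) :=
  Matrix.toLin' (Matrix.diagonal w * C)

theorem weightedEstimate_apply (w : Fin (n + 1) → ℝ) (C : Matrix (Fin (n + 1)) (Fin (n + 1)) ℝ)
    (y : Fin (n + 1) → ℝ) (k : Fin (n + 1)) :
    weightedEstimate w C y k = w k * ∑ j, C k j * y j := by
  rw [weightedEstimate, Matrix.toLin'_apply, ← Matrix.mulVec_mulVec, Matrix.mulVec_diagonal]
  rfl

variable (hx : ∀ k, MemLp (fun p : (Fin (n + 1) → ℝ) × (Fin (n + 1) → ℝ) => p.1 k) 2 ν)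
  (hy : ∀ k, MemLp (fun p : (Fin (n + 1) → ℝ) × (Fin (n + 1) → ℝ) => p.2 k) 2 ν)

/-- The source samples as vectors of `L²`. -/
def sourceVector (k : Fin (n + 1)) : Lp ℝ 2 ν := toL2 ν ⟨_, hx k⟩

/-- The output samples as vectors of `L²`. -/
def outputVector (k : Fin (n + 1)) : Lp ℝ 2 ν := toL2 ν ⟨_, hy k⟩

/-- The backward residuals of linear estimates are the coordinates of the residual of the channel
with the corresponding coefficients. -/
theorem backwardResidual_eq_toL2 (v : Fin n → ℝ) (C : Matrix (Fin (n + 1)) (Fin (n + 1)) ℝ)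
    (k : Fin (n + 1)) :
    ∃ h : MemLp (fun p => (backwardDifferenceLinear a v d p.1
        - weightedEstimate (filterWeight a v d) C p.2) k) 2 ν,
      backwardResidual a v d (sourceVector hx) (fun k => ∑ j, C k j • outputVector hy j) k
        = toL2 ν ⟨_, h⟩ := by
  set x : Fin (n + 1) → squareIntegrable ν := fun k => ⟨_, hx k⟩
  set y : Fin (n + 1) → squareIntegrable ν := fun k => ⟨_, hy k⟩
  have h1 : (backwardResidual a v d x (fun k => ∑ j, C k j • y j) k).1
      = fun p => (backwardDifferenceLinear a v d p.1
        - weightedEstimate (filterWeight a v d) C p.2) k := by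
    funext p
    change evalAt p (backwardResidual a v d x (fun k => ∑ j, C k j • y j) k) = _
    rw [map_backwardResidual]
    simp only [backwardResidual, map_sum, map_smul, Pi.sub_apply, weightedEstimate_apply,
      smul_eq_mul]
    rfl
  refine ⟨h1 ▸ (backwardResidual a v d x (fun k => ∑ j, C k j • y j) k).2, ?_⟩
  have h2 : toL2 ν (backwardResidual a v d x (fun k => ∑ j, C k j • y j) k)
      = backwardResidual a v d (sourceVector hx) (fun k => ∑ j, C k j • outputVector hy j) k := by
    rw [map_backwardResidual]
    simp only [map_sum, map_smul]
    rfl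
  rw [← h2]
  congr 1
  exact Subtype.ext h1

theorem innovation_eq_toL2 (k : Fin (n + 1)) :
    ∃ h : MemLp (fun p => innovationLinear a p.1 k) 2 ν,
      innovation a (sourceVector hx) k = toL2 ν ⟨_, h⟩ := by
  set x : Fin (n + 1) → squareIntegrable ν := fun k => ⟨_, hx k⟩
  have h1 : (innovation a x k).1 = fun p => innovationLinear a p.1 k := by
    funext p
    change evalAt p (innovation a x k) = _
    rw [map_innovation]
    rfl
  refine ⟨h1 ▸ (innovation a x k).2, ?_⟩
  have h2 : toL2 ν (innovation a x k) = innovation a (sourceVector hx) k := by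
    rw [map_innovation]
    rfl
  rw [← h2]
  congr 1
  exact Subtype.ext h1

/-- The backward variances as nonnegative reals. -/
def backwardVarianceNN (a v : Fin n → ℝ) (d : Fin (n + 1) → ℝ) (k : Fin (n + 1)) : ℝ≥0 :=
  (backwardVariance a v d k).toNNReal

theorem IsFeasible.coe_backwardVarianceNN {v₀ : ℝ} {v : Fin n → ℝ} (hd : IsFeasible a v₀ v d)
    (k : Fin (n + 1)) : (backwardVarianceNN a v d k : ℝ) = backwardVariance a v d k :=
  Real.coe_toNNReal _ (hd.backwardVariance_pos k).le

/-- The mean log-likelihood ratio of a linear Gaussian channel under a pair `ν` with the prescribed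
innovation variances. -/
theorem integral_channelLogRatio [IsProbabilityMeasure ν] (hv₀ : 0 < v₀)
    (hd : IsFeasible a v₀ (fun k => (v k : ℝ)) d)
    (hinn : ∀ k, ‖innovation a (sourceVector hx) k‖ ^ 2
      = (Fin.cons (α := fun _ => ℝ≥0) v₀ v : Fin (n + 1) → ℝ≥0) k)
    (C : Matrix (Fin (n + 1)) (Fin (n + 1)) ℝ) :
    Integrable (channelLogRatio (innovationLinear a)
        (backwardDifferenceLinear a (fun k => (v k : ℝ)) d)
        (weightedEstimate (filterWeight a (fun k => (v k : ℝ)) d) C)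
        (Fin.cons (α := fun _ => ℝ≥0) v₀ v) (backwardVarianceNN a (fun k => (v k : ℝ)) d)) ν ∧
    ∫ p, channelLogRatio (innovationLinear a)
        (backwardDifferenceLinear a (fun k => (v k : ℝ)) d)
        (weightedEstimate (filterWeight a (fun k => (v k : ℝ)) d) C)
        (Fin.cons (α := fun _ => ℝ≥0) v₀ v) (backwardVarianceNN a (fun k => (v k : ℝ)) d) p ∂ν
      = totalRate a v₀ (fun k => (v k : ℝ)) d + ((n + 1 : ℕ) : ℝ) / 2
        - backwardCost a (fun k => (v k : ℝ)) d (sourceVector hx)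
            (fun k => ∑ j, C k j • outputVector hy j) / 2 := by
  set V : Fin (n + 1) → ℝ≥0 := Fin.cons (α := fun _ => ℝ≥0) v₀ v with hVdef
  set v' : Fin n → ℝ := fun k => (v k : ℝ)
  set τ := backwardVarianceNN a v' d
  set w := weightedEstimate (filterWeight a v' d) C
  have hV : ∀ k, 0 < V k := by
    intro k
    induction k using Fin.cases with
    | zero => exact hv₀
    | succ k => exact NNReal.coe_pos.1 (hd.var_pos k)
  choose hrm hr using backwardResidual_eq_toL2 (a := a) (d := d) hx hy v' C
  choose hzm hz using innovation_eq_toL2 (a := a) hx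
  have hτ : ∀ k, (τ k : ℝ) = backwardVariance a v' d k := hd.coe_backwardVarianceNN
  have hform : ∀ (U : Fin (n + 1) → ℝ≥0) (r : Fin (n + 1) →
      (Fin (n + 1) → ℝ) × (Fin (n + 1) → ℝ) → ℝ) (_ : ∀ k, MemLp (r k) 2 ν),
      Integrable (fun p => gaussianLogDensity U (fun k => r k p)) ν ∧
      ∫ p, gaussianLogDensity U (fun k => r k p) ∂ν
        = ∑ k, (-(1 / 2) * Real.log (2 * Real.pi * U k) - (∫ p, r k p ^ 2 ∂ν) / (2 * U k)) := by
    intro U r hr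
    have hi : ∀ k, Integrable (fun p =>
        -(1 / 2) * Real.log (2 * Real.pi * U k) - r k p ^ 2 / (2 * U k)) ν := fun k =>
      (integrable_const _).sub ((hr k).integrable_sq.div_const _)
    refine ⟨integrable_finsetSum _ fun k _ => hi k, ?_⟩
    simp only [gaussianLogDensity]
    rw [integral_finsetSum _ fun k _ => hi k]
    refine Finset.sum_congr rfl fun k _ => ?_
    rw [integral_sub (integrable_const _) ((hr k).integrable_sq.div_const _), integral_div]
    simp
  obtain ⟨hi1, he1⟩ := hform τ _ hrm
  obtain ⟨hi2, he2⟩ := hform V _ hzm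
  refine ⟨hi1.sub hi2, ?_⟩
  have hsplit : ∫ p, channelLogRatio (innovationLinear a) (backwardDifferenceLinear a v' d) w V τ p
      ∂ν = ∑ k, (-(1 / 2) * Real.log (2 * Real.pi * τ k)
          - ‖backwardResidual a v' d (sourceVector hx)
              (fun k => ∑ j, C k j • outputVector hy j) k‖ ^ 2 / (2 * τ k))
        - ∑ k, (-(1 / 2) * Real.log (2 * Real.pi * V k)
          - ‖innovation a (sourceVector hx) k‖ ^ 2 / (2 * V k)) := by
    refine (integral_sub hi1 hi2).trans ?_
    rw [he1, he2]
    simp_rw [hr, hz, norm_toL2_sq]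
  have hterm : ∀ k, (-(1 / 2) * Real.log (2 * Real.pi * τ k)
          - ‖backwardResidual a v' d (sourceVector hx)
              (fun k => ∑ j, C k j • outputVector hy j) k‖ ^ 2 / (2 * τ k))
        - (-(1 / 2) * Real.log (2 * Real.pi * V k)
          - ‖innovation a (sourceVector hx) k‖ ^ 2 / (2 * V k))
      = 1 / 2 * Real.log (V k) - 1 / 2 * Real.log (backwardVariance a v' d k) + 1 / 2
        - 1 / 2 * (‖backwardResidual a v' d (sourceVector hx)
            (fun k => ∑ j, C k j • outputVector hy j) k‖ ^ 2 / backwardVariance a v' d k) := by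
    intro k
    have h1 : (V k : ℝ) ≠ 0 := (NNReal.coe_pos.2 (hV k)).ne'
    have h2 := (hd.backwardVariance_pos k).ne'
    rw [hinn, hτ, Real.log_mul Real.two_pi_pos.ne' h1, Real.log_mul Real.two_pi_pos.ne' h2]
    field_simp
    ring
  rw [hsplit, ← Finset.sum_sub_distrib, Finset.sum_congr rfl fun k _ => hterm k,
    Finset.sum_sub_distrib, Finset.sum_add_distrib, Finset.sum_sub_distrib, ← Finset.mul_sum,
    ← Finset.mul_sum, ← Finset.mul_sum]
  have h3 := sum_log_sub_log_backwardVariance hv₀ hd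
  have h4 : ∑ _k : Fin (n + 1), (1 / 2 : ℝ) = ((n + 1 : ℕ) : ℝ) / 2 := by
    rw [Finset.sum_const, Finset.card_univ, Fintype.card_fin, nsmul_eq_mul]
    ring
  rw [h4, backwardCost]
  linarith

end LowerBound

/-! ### Second moments of causally related outputs -/

section Causality

variable {n : ℕ} {a : Fin n → ℝ} {V : Fin (n + 1) → ℝ≥0}
  {α : Type*} {mα : MeasurableSpace α} {ν : Measure α}
  {x : Fin (n + 1) → α → ℝ}

theorem iIndepFun_innovation (hx : ∀ k, Measurable (x k))
    (hlaw : ν.map (fun p => innovation a fun i => x i p) =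
      Measure.pi fun k => gaussianReal 0 (V k)) :
    (∀ k, HasLaw (fun p => innovation a (fun i => x i p) k) (gaussianReal 0 (V k)) ν) ∧
      iIndepFun (fun k p => innovation a (fun i => x i p) k) ν := by
  have hm : Measurable fun p => innovation a fun i => x i p :=
    (LinearMap.continuous_of_finiteDimensional (innovationLinear a)).measurable.comp
      (measurable_pi_lambda _ hx)
  have hmk : ∀ k, Measurable fun p => innovation a (fun i => x i p) k :=
    fun k => (measurable_pi_apply k).comp hm
  have hk : ∀ k, ν.map (fun p => innovation a (fun i => x i p) k) = gaussianReal 0 (V k) := by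
    intro k
    have h1 := (measurePreserving_eval (fun k => gaussianReal 0 (V k)) k).map_eq
    rw [← hlaw, Measure.map_map (measurable_pi_apply k) hm] at h1
    exact h1
  have : IsProbabilityMeasure ν := by
    have h0 : IsProbabilityMeasure (ν.map (fun p => innovation a fun i => x i p)) := by
      rw [hlaw]
      infer_instance
    exact Measure.isProbabilityMeasure_of_map fun p => innovation a fun i => x i p
  refine ⟨fun k => ⟨(hmk k).aemeasurable, hk k⟩, ?_⟩
  rw [iIndepFun_iff_map_fun_eq_pi_map fun k => (hmk k).aemeasurable]
  simp_rw [hk]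
  exact hlaw

theorem memLp_of_innovation {p : ℝ≥0∞}
    (h : ∀ k, MemLp (fun ω => innovation a (fun i => x i ω) k) p ν) (k : Fin (n + 1)) :
    MemLp (x k) p ν := by
  induction k using Fin.induction with
  | zero => exact h 0
  | succ k ih =>
    have h1 : x k.succ = fun ω => innovation a (fun i => x i ω) k.succ + a k • x k.castSucc ω := by
      funext ω
      rw [innovation_succ]
      abel
    rw [h1]
    exact (h k.succ).add (ih.const_smul (a k))

/-- The past of the source is generated by the past of the innovations. -/
theorem measurable_of_innovation (k : Fin (n + 1)) {i : Fin (n + 1)} (hi : i ≤ k) :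
    Measurable[⨆ j ∈ Set.Iic k, MeasurableSpace.comap
      (fun ω => innovation a (fun i => x i ω) j) inferInstance] (x i) := by
  have hz : ∀ j ≤ k, Measurable[⨆ j ∈ Set.Iic k, MeasurableSpace.comap
      (fun ω => innovation a (fun i => x i ω) j) inferInstance]
      (fun ω => innovation a (fun i => x i ω) j) := fun j hj =>
    (comap_measurable _).mono (le_iSup₂_of_le j hj le_rfl) le_rfl
  induction i using Fin.induction with
  | zero => exact hz 0 hi
  | succ i ih =>
    have h1 : x i.succ = fun ω => innovation a (fun i => x i ω) i.succ + a i • x i.castSucc ω := by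
      funext ω
      rw [innovation_succ]
      abel
    rw [h1]
    exact (hz _ hi).add ((ih ((Fin.castSucc_lt_succ).le.trans hi)).const_smul (a i))

theorem source_orthogonal_of_innovation {H : Type*} [NormedAddCommGroup H] [InnerProductSpace ℝ H]
    {X : Fin (n + 1) → H} (h : ∀ i j, i ≠ j → inner ℝ (innovation a X i) (innovation a X j) = 0)
    {j k : Fin (n + 1)} (hjk : j < k) : inner ℝ (X j) (innovation a X k) = 0 := by
  induction j using Fin.induction with
  | zero => exact h 0 k hjk.ne
  | succ j ih =>
    have h1 : X j.succ = innovation a X j.succ + a j • X j.castSucc := by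
      rw [innovation_succ]
      abel
    rw [h1, inner_add_left, inner_smul_left, h _ _ hjk.ne,
      ih ((Fin.castSucc_lt_succ).trans hjk), mul_zero, add_zero]

/-- Conditional independence factorizes conditional means of products. -/
theorem condExp_mul_of_condIndepFun {β : Type*} {m' mβ : MeasurableSpace β}
    [StandardBorelSpace β] (hm' : m' ≤ mβ) {ν : Measure β} [IsFiniteMeasure ν]
    {f g : β → ℝ} (hf : Measurable f) (hg : Measurable g)
    (h : CondIndepFun m' hm' f g ν) (hfi : Integrable f ν) (hgi : Integrable g ν)
    (hfg : Integrable (fun ω => f ω * g ω) ν) :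
    ν[fun ω => f ω * g ω | m'] =ᵐ[ν] fun ω => (ν[f | m']) ω * (ν[g | m']) ω := by
  have hker := ae_of_ae_trim hm' ((condIndepFun_iff_map_prod_eq_prod_map_map hf hg).1 h)
  filter_upwards [condExp_ae_eq_integral_condExpKernel hm' hfi,
    condExp_ae_eq_integral_condExpKernel hm' hgi,
    condExp_ae_eq_integral_condExpKernel hm' hfg, hker] with ω h1 h2 h3 h4
  rw [h1, h2, h3]
  have hind : IndepFun f g (condExpKernel ν m' ω) := by
    rw [indepFun_iff_map_prod_eq_prod_map_map hf.aemeasurable hg.aemeasurable]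
    rw [Kernel.map_apply _ (hf.prodMk hg), Kernel.prod_apply, Kernel.map_apply _ hf,
      Kernel.map_apply _ hg] at h4
    exact h4
  exact hind.integral_fun_mul_eq_mul_integral hf.aestronglyMeasurable hg.aestronglyMeasurable

end Causality

section Admissible

variable {n : ℕ} {a : Fin n → ℝ} {v₀ : ℝ≥0} {v : Fin n → ℝ≥0}
  {ν : ProbabilityMeasure ((Fin (n + 1) → ℝ) × (Fin (n + 1) → ℝ))} {P : Measure (Fin (n + 1) → ℝ)}

theorem map_innovation_eq_pi (hP : P.map (innovationLinear a) =
      Measure.pi fun k => gaussianReal 0 ((Fin.cons (α := fun _ => ℝ≥0) v₀ v : _ → ℝ≥0) k))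
    (hfst : (ν : Measure ((Fin (n + 1) → ℝ) × (Fin (n + 1) → ℝ))).fst = P) :
    (ν : Measure ((Fin (n + 1) → ℝ) × (Fin (n + 1) → ℝ))).map
      (fun p => innovation a fun i => p.1 i) =
      Measure.pi fun k => gaussianReal 0 ((Fin.cons (α := fun _ => ℝ≥0) v₀ v : _ → ℝ≥0) k) := by
  rw [← hP, ← hfst, Measure.fst, Measure.map_map
    (LinearMap.continuous_of_finiteDimensional (innovationLinear a)).measurable measurable_fst]
  rfl

theorem memLp_source (hP : P.map (innovationLinear a) =
      Measure.pi fun k => gaussianReal 0 ((Fin.cons (α := fun _ => ℝ≥0) v₀ v : _ → ℝ≥0) k))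
    (hfst : (ν : Measure ((Fin (n + 1) → ℝ) × (Fin (n + 1) → ℝ))).fst = P) (k : Fin (n + 1)) :
    MemLp (fun p : (Fin (n + 1) → ℝ) × (Fin (n + 1) → ℝ) => p.1 k) 2
      (ν : Measure ((Fin (n + 1) → ℝ) × (Fin (n + 1) → ℝ))) := by
  obtain ⟨hl, -⟩ := iIndepFun_innovation (x := fun k (p : (Fin (n + 1) → ℝ) × (Fin (n + 1) → ℝ)) =>
    p.1 k) (fun k => by fun_prop) (map_innovation_eq_pi hP hfst)
  exact memLp_of_innovation (a := a)
    (x := fun k (p : (Fin (n + 1) → ℝ) × (Fin (n + 1) → ℝ)) => p.1 k)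
    (fun k => (hl k).hasGaussianLaw.memLp_two) k

theorem norm_innovation_source (hP : P.map (innovationLinear a) =
      Measure.pi fun k => gaussianReal 0 ((Fin.cons (α := fun _ => ℝ≥0) v₀ v : _ → ℝ≥0) k))
    (hfst : (ν : Measure ((Fin (n + 1) → ℝ) × (Fin (n + 1) → ℝ))).fst = P) (k : Fin (n + 1)) :
    ‖innovation a (sourceVector (memLp_source hP hfst)) k‖ ^ 2
      = (Fin.cons (α := fun _ => ℝ≥0) v₀ v : _ → ℝ≥0) k := by
  obtain ⟨hl, -⟩ := iIndepFun_innovation (x := fun k (p : (Fin (n + 1) → ℝ) × (Fin (n + 1) → ℝ)) =>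
    p.1 k) (fun k => by fun_prop) (map_innovation_eq_pi hP hfst)
  obtain ⟨hz, hze⟩ := innovation_eq_toL2 (a := a) (memLp_source hP hfst) k
  have hmean : ∫ p, innovationLinear a p.1 k
      ∂(ν : Measure ((Fin (n + 1) → ℝ) × (Fin (n + 1) → ℝ))) = 0 := by
    have := (hl k).integral_eq
    rw [integral_id_gaussianReal] at this
    exact this
  have hvar := (hl k).variance_eq
  rw [variance_id_gaussianReal] at hvar
  change Var[fun p => innovationLinear a p.1 k;
    (ν : Measure ((Fin (n + 1) → ℝ) × (Fin (n + 1) → ℝ)))] = _ at hvar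
  rw [variance_of_integral_eq_zero hz.aestronglyMeasurable.aemeasurable
    hmean] at hvar
  rw [hze, norm_toL2_sq, ← hvar]

theorem inner_innovation_source (hP : P.map (innovationLinear a) =
      Measure.pi fun k => gaussianReal 0 ((Fin.cons (α := fun _ => ℝ≥0) v₀ v : _ → ℝ≥0) k))
    (hfst : (ν : Measure ((Fin (n + 1) → ℝ) × (Fin (n + 1) → ℝ))).fst = P) {i j : Fin (n + 1)}
    (hij : i ≠ j) :
    inner ℝ (innovation a (sourceVector (memLp_source hP hfst)) i)
      (innovation a (sourceVector (memLp_source hP hfst)) j) = 0 := by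
  obtain ⟨hl, hind⟩ := iIndepFun_innovation
    (x := fun k (p : (Fin (n + 1) → ℝ) × (Fin (n + 1) → ℝ)) => p.1 k) (fun k => by fun_prop)
    (map_innovation_eq_pi hP hfst)
  obtain ⟨hz, hze⟩ := innovation_eq_toL2 (a := a) (memLp_source hP hfst) i
  obtain ⟨hz', hze'⟩ := innovation_eq_toL2 (a := a) (memLp_source hP hfst) j
  have hmean := (hl i).integral_eq
  rw [integral_id_gaussianReal] at hmean
  rw [hze, hze', inner_toL2]
  refine ((hind.indepFun hij).integral_fun_mul_eq_mul_integral hz.aestronglyMeasurable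
    hz'.aestronglyMeasurable).trans ?_
  rw [hmean, zero_mul]

/-- The innovation after time `k` has conditional mean zero given the source up to time `k`. -/
theorem condExp_innovation (hP : P.map (innovationLinear a) =
      Measure.pi fun k => gaussianReal 0 ((Fin.cons (α := fun _ => ℝ≥0) v₀ v : _ → ℝ≥0) k))
    (hfst : (ν : Measure ((Fin (n + 1) → ℝ) × (Fin (n + 1) → ℝ))).fst = P) (k : Fin n) :
    (ν : Measure ((Fin (n + 1) → ℝ) × (Fin (n + 1) → ℝ)))[
      fun p => innovation a (fun i => p.1 i) k.succ | sourcePast k.castSucc]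
      =ᵐ[(ν : Measure ((Fin (n + 1) → ℝ) × (Fin (n + 1) → ℝ)))] fun _ => 0 := by
  obtain ⟨hl, hind⟩ := iIndepFun_innovation
    (x := fun k (p : (Fin (n + 1) → ℝ) × (Fin (n + 1) → ℝ)) => p.1 k) (fun k => by fun_prop)
    (map_innovation_eq_pi hP hfst)
  have hmz : ∀ j, Measurable fun p : (Fin (n + 1) → ℝ) × (Fin (n + 1) → ℝ) =>
      innovation a (fun i => p.1 i) j := fun j =>
    ((measurable_pi_apply j).comp (LinearMap.continuous_of_finiteDimensional
      (innovationLinear a)).measurable).comp measurable_fst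
  have hdisj : Disjoint ({k.succ} : Set (Fin (n + 1))) (Set.Iic k.castSucc) := by
    rw [Set.disjoint_singleton_left, Set.mem_Iic, not_le]
    exact Fin.castSucc_lt_succ
  have hI := indep_iSup_of_disjoint (fun j => (hmz j).comap_le) hind.iIndep hdisj
  rw [iSup_singleton] at hI
  have hle : sourcePast k.castSucc ≤ ⨆ j ∈ Set.Iic k.castSucc, MeasurableSpace.comap
      (fun p : (Fin (n + 1) → ℝ) × (Fin (n + 1) → ℝ) => innovation a (fun i => p.1 i) j)
      inferInstance := by
    refine Measurable.comap_le ?_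
    exact @measurable_pi_lambda _ _ _ (_) _ _ fun i => measurable_of_innovation
      (x := fun k (p : (Fin (n + 1) → ℝ) × (Fin (n + 1) → ℝ)) => p.1 k) k.castSucc i.2
  have h1 := condExp_indep_eq (hmz k.succ).comap_le (sourcePast_le k.castSucc)
    (comap_measurable (fun p : (Fin (n + 1) → ℝ) × (Fin (n + 1) → ℝ) =>
      innovation a (fun i => p.1 i) k.succ)).stronglyMeasurable (indep_of_indep_of_le_right hI hle)
  have hmean := (hl k.succ).integral_eq
  rw [integral_id_gaussianReal] at hmean
  rwa [hmean] at h1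

theorem IsAdmissible.memLp_output {D : Fin (n + 1) → ℝ} (hP : P.map (innovationLinear a) =
      Measure.pi fun k => gaussianReal 0 ((Fin.cons (α := fun _ => ℝ≥0) v₀ v : _ → ℝ≥0) k))
    (h : IsAdmissible P D ν) (k : Fin (n + 1)) :
    MemLp (fun p : (Fin (n + 1) → ℝ) × (Fin (n + 1) → ℝ) => p.2 k) 2
      (ν : Measure ((Fin (n + 1) → ℝ) × (Fin (n + 1) → ℝ))) := by
  have := (h.memLp k).add (memLp_source hP h.source_law k)
  refine this.congr_norm (by fun_prop) (Filter.Eventually.of_forall fun p => ?_)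
  simp

/-- An admissible output is causally related to the source at the level of second moments. -/
theorem IsAdmissible.isCausalPair {D : Fin (n + 1) → ℝ} (hP : P.map (innovationLinear a) =
      Measure.pi fun k => gaussianReal 0 ((Fin.cons (α := fun _ => ℝ≥0) v₀ v : _ → ℝ≥0) k))
    (h : IsAdmissible P D ν) :
    IsCausalPair a v₀ (fun k => (v k : ℝ)) (sourceVector (memLp_source hP h.source_law))
      (outputVector (h.memLp_output hP)) where
  norm_zero := norm_innovation_source hP h.source_law 0
  norm_innovation k := norm_innovation_source hP h.source_law k.succ
  source_orthogonal k j hjk := source_orthogonal_of_innovation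
    (fun _ _ hij => inner_innovation_source hP h.source_law hij)
    (hjk.trans_lt Fin.castSucc_lt_succ)
  output_orthogonal k j hjk := by
    set μ := (ν : Measure ((Fin (n + 1) → ℝ) × (Fin (n + 1) → ℝ)))
    set F := sourcePast k.castSucc
    have hx := memLp_source hP h.source_law
    have hy := h.memLp_output hP
    -- only the output `y j` and the next source sample matter
    have hci : CondIndepFun F (sourcePast_le k.castSucc)
        (fun p : (Fin (n + 1) → ℝ) × (Fin (n + 1) → ℝ) => p.2 j) (fun p => p.1 k.succ) μ :=
      (h.causal k.castSucc).comp (φ := fun u : Set.Iic k.castSucc → ℝ => u ⟨j, hjk⟩)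
        (ψ := fun u : Set.Ioi k.castSucc → ℝ => u ⟨k.succ, Fin.castSucc_lt_succ⟩)
        (by fun_prop) (by fun_prop)
    have hxF : StronglyMeasurable[F]
        (fun p : (Fin (n + 1) → ℝ) × (Fin (n + 1) → ℝ) => p.1 k.castSucc) := by
      have h1 : Measurable[F] (fun (p : (Fin (n + 1) → ℝ) × (Fin (n + 1) → ℝ))
          (i : Set.Iic k.castSucc) => p.1 i) := comap_measurable _
      exact ((measurable_pi_apply (⟨k.castSucc, Set.mem_Iic.2 le_rfl⟩ :
        Set.Iic k.castSucc)).comp h1).stronglyMeasurable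
    have hyx : ∀ i, Integrable (fun p => p.2 j * p.1 i) μ := fun i => (hy j).integrable_mul (hx i)
    have hci' := condExp_mul_of_condIndepFun (sourcePast_le k.castSucc) (by fun_prop)
      (by fun_prop) hci ((hy j).integrable one_le_two) ((hx k.succ).integrable one_le_two)
      (hyx k.succ)
    -- the conditional mean of the next sample
    have hnext : μ[fun p => p.1 k.succ | F] =ᵐ[μ] fun p => a k * p.1 k.castSucc := by
      have h1 : (fun p : (Fin (n + 1) → ℝ) × (Fin (n + 1) → ℝ) => p.1 k.succ)
          = (fun p => innovation a (fun i => p.1 i) k.succ) + fun p => a k * p.1 k.castSucc := by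
        funext p
        simp [innovation_succ]
      have hiz : Integrable (fun p : (Fin (n + 1) → ℝ) × (Fin (n + 1) → ℝ) =>
          innovation a (fun i => p.1 i) k.succ) μ :=
        ((hx k.succ).sub ((hx k.castSucc).const_smul (a k))).integrable one_le_two
      have hix : Integrable (fun p : (Fin (n + 1) → ℝ) × (Fin (n + 1) → ℝ) =>
          a k * p.1 k.castSucc) μ := ((hx k.castSucc).integrable one_le_two).const_mul _
      rw [h1]
      filter_upwards [condExp_add hiz hix F, condExp_innovation hP h.source_law k] with p h2 h3
      rw [h2, Pi.add_apply, h3, zero_add, condExp_of_stronglyMeasurable (sourcePast_le k.castSucc)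
        (hxF.const_mul (a k)) hix]
    have hprod : μ[fun p => p.2 j * p.1 k.castSucc | F] =ᵐ[μ]
        fun p => (μ[fun p => p.2 j | F]) p * p.1 k.castSucc :=
      condExp_mul_of_stronglyMeasurable_right hxF (hyx k.castSucc)
        ((hy j).integrable one_le_two)
    have hint : ∫ p, p.2 j * p.1 k.succ ∂μ = a k * ∫ p, p.2 j * p.1 k.castSucc ∂μ := by
      rw [← integral_condExp (sourcePast_le k.castSucc),
        ← integral_condExp (f := fun p => p.2 j * p.1 k.castSucc) (sourcePast_le k.castSucc),
        ← integral_const_mul]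
      refine integral_congr_ae ?_
      filter_upwards [hci', hnext, hprod] with p h1 h2 h3
      rw [h1, h2, h3]
      ring
    rw [inner_sub_right, inner_smul_right, sub_eq_zero]
    simp only [sourceVector, outputVector, inner_toL2]
    exact hint

/-- The rate of a pair with the given source is bounded below in terms of the backward cost of any
linear estimates. -/
theorem ofReal_le_mutualInformation (hv₀ : 0 < v₀) {d : Fin (n + 1) → ℝ}
    (hd : IsFeasible a v₀ (fun k => (v k : ℝ)) d) (hP : P.map (innovationLinear a) =
      Measure.pi fun k => gaussianReal 0 ((Fin.cons (α := fun _ => ℝ≥0) v₀ v : _ → ℝ≥0) k))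
    (hfst : (ν : Measure ((Fin (n + 1) → ℝ) × (Fin (n + 1) → ℝ))).fst = P)
    (hy : ∀ k, MemLp (fun p : (Fin (n + 1) → ℝ) × (Fin (n + 1) → ℝ) => p.2 k) 2
      (ν : Measure ((Fin (n + 1) → ℝ) × (Fin (n + 1) → ℝ))))
    {M : Fin (n + 1) → Lp ℝ 2 (ν : Measure ((Fin (n + 1) → ℝ) × (Fin (n + 1) → ℝ)))}
    (hM : ∀ k, M k ∈ Submodule.span ℝ (Set.range (outputVector hy))) :
    ENNReal.ofReal (totalRate a v₀ (fun k => (v k : ℝ)) d + ((n + 1 : ℕ) : ℝ) / 2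
        - backwardCost a (fun k => (v k : ℝ)) d (sourceVector (memLp_source hP hfst)) M / 2)
      ≤ mutualInformation ν := by
  have hV : ∀ k, 0 < (Fin.cons (α := fun _ => ℝ≥0) v₀ v : Fin (n + 1) → ℝ≥0) k := by
    intro k
    induction k using Fin.cases with
    | zero => exact hv₀
    | succ k => exact NNReal.coe_pos.1 (hd.var_pos k)
  choose C hC using fun k => (Submodule.mem_span_range_iff_exists_fun ℝ).1 (hM k)
  obtain rfl : (fun k => ∑ j, C k j • outputVector hy j) = M := funext hC
  obtain ⟨hi, he⟩ := integral_channelLogRatio (memLp_source hP hfst) hy hv₀ hd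
    (norm_innovation_source hP hfst) (Matrix.of C)
  have hPprob : IsProbabilityMeasure P := by
    rw [← hfst]
    infer_instance
  have h1 := ofReal_integral_le_klDiv (ρ := P.prod
    (ν : Measure ((Fin (n + 1) → ℝ) × (Fin (n + 1) → ℝ))).snd)
    continuous_channelLogRatio.measurable hi
    (lintegral_exp_channelLogRatio (det_innovationLinear a)
      (det_backwardDifferenceLinear a _ d) hV
      (fun k => Real.toNNReal_pos.2 (hd.backwardVariance_pos k)) hP _)
  rw [he] at h1
  rw [mutualInformation, hfst]
  exact h1

end Admissible

/-! ### Causality from independent noise -/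

section ConditionalIndependence

variable {β : Type*}

/-- Multiplying by an event that is independent of everything else only rescales a conditional
probability. -/
theorem condExp_indicator_inter_of_indep {m' G K mβ : MeasurableSpace β} (hm' : m' ≤ mβ)
    (hG : G ≤ mβ) (hK : K ≤ mβ) (hmK : m' ≤ K) {μ : Measure β} [IsProbabilityMeasure μ]
    (hind : Indep G K μ) {B T : Set β} (hB : MeasurableSet[G] B) (hT : MeasurableSet[K] T) :
    μ⟦B ∩ T | m'⟧ =ᵐ[μ] fun ω => μ.real B * (μ⟦T | m'⟧) ω := by
  have hT' := hK _ hT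
  have hB' := hG _ hB
  have hi : ∀ {s : Set β}, MeasurableSet s → Integrable (s.indicator fun _ => (1 : ℝ)) μ :=
    fun hs => (integrable_const _).indicator hs
  refine (ae_eq_condExp_of_forall_setIntegral_eq hm' (hi (hB'.inter hT'))
    (fun s _ _ => (integrable_condExp.const_mul _).integrableOn) (fun s hs _ => ?_)
    (stronglyMeasurable_condExp.const_mul _).aestronglyMeasurable).symm
  have hs' := hm' _ hs
  rw [integral_const_mul, setIntegral_condExp hm' (hi hT') hs, setIntegral_indicator hT',
    setIntegral_indicator (hB'.inter hT'), setIntegral_const, setIntegral_const, smul_eq_mul,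
    smul_eq_mul, mul_one, mul_one, measureReal_def, measureReal_def, measureReal_def,
    ← ENNReal.toReal_mul, ← (Indep_iff _ _ _).1 hind B (s ∩ T) hB ((hmK _ hs).inter hT)]
  congr 2
  ext ω
  simp only [Set.mem_inter_iff]
  tauto

/-- If `m₁` is generated by `m'` together with some noise `G` independent of `m'` and `K`, then
`m₁` and `K` are conditionally independent given `m'`. -/
theorem condIndep_of_indep_noise {m' m₁ G K mβ : MeasurableSpace β} [StandardBorelSpace β]
    (hm' : m' ≤ mβ) (hG : G ≤ mβ) (hK : K ≤ mβ) {μ : Measure β} [IsProbabilityMeasure μ]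
    (hind : Indep G (m' ⊔ K) μ) (hle : m₁ ≤ m' ⊔ G) : CondIndep m' m₁ K hm' μ := by
  have hmK : m' ⊔ K ≤ mβ := sup_le hm' hK
  refine condIndep_of_condIndep_of_le_left (m₁ := m' ⊔ G) ?_ hle
  set p : Set (Set β) :=
    {s | ∃ A B, MeasurableSet[m'] A ∧ MeasurableSet[G] B ∧ s = A ∩ B} with hp
  have hp_pi : IsPiSystem p := by
    rintro _ ⟨A, B, hA, hB, rfl⟩ _ ⟨A', B', hA', hB', rfl⟩ -
    exact ⟨A ∩ A', B ∩ B', hA.inter hA', hB.inter hB', by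
      ext; simp only [Set.mem_inter_iff]; tauto⟩
  have hgen : m' ⊔ G = MeasurableSpace.generateFrom p := by
    refine le_antisymm (sup_le (fun s hs => ?_) fun s hs => ?_)
      (MeasurableSpace.generateFrom_le ?_)
    · exact MeasurableSpace.measurableSet_generateFrom
        ⟨s, Set.univ, hs, MeasurableSet.univ, (Set.inter_univ s).symm⟩
    · exact MeasurableSpace.measurableSet_generateFrom
        ⟨Set.univ, s, MeasurableSet.univ, hs, (Set.univ_inter s).symm⟩
    · rintro _ ⟨A, B, hA, hB, rfl⟩
      exact @MeasurableSet.inter _ (m' ⊔ G) _ _ ((le_sup_left : m' ≤ m' ⊔ G) _ hA)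
        ((le_sup_right : G ≤ m' ⊔ G) _ hB)
  refine CondIndepSets.condIndep (sup_le hm' hG) hK hp_pi
    (@MeasurableSpace.isPiSystem_measurableSet β K) hgen
    (@MeasurableSpace.generateFrom_measurableSet β K).symm ?_
  refine (condIndepSets_iff m' hm' p {s | MeasurableSet[K] s} ?_ (fun s hs => hK _ hs) μ).2 ?_
  · rintro _ ⟨A, B, hA, hB, rfl⟩
    exact (hm' _ hA).inter (hG _ hB)
  rintro _ t ⟨A, B, hA, hB, rfl⟩ ht
  have hA' : MeasurableSet[m' ⊔ K] A := (le_sup_left : m' ≤ m' ⊔ K) _ hA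
  have ht' : MeasurableSet[m' ⊔ K] t := (le_sup_right : K ≤ m' ⊔ K) _ ht
  have h1 := condExp_indicator_inter_of_indep hm' hG hmK le_sup_left hind hB
    (@MeasurableSet.inter _ (m' ⊔ K) _ _ hA' ht')
  have h2 := condExp_indicator_inter_of_indep hm' hG hmK le_sup_left hind hB hA'
  have h3 : μ⟦A ∩ t | m'⟧ =ᵐ[μ] A.indicator (μ⟦t | m'⟧) := by
    rw [← Set.indicator_indicator]
    exact condExp_indicator ((integrable_const _).indicator (hK _ ht)) hA
  have h4 : μ⟦A | m'⟧ = A.indicator fun _ => 1 :=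
    condExp_of_stronglyMeasurable hm' (stronglyMeasurable_const.indicator hA)
      ((integrable_const _).indicator (hm' _ hA))
  have h5 : A ∩ B ∩ t = B ∩ (A ∩ t) := by
    ext; simp only [Set.mem_inter_iff]; tauto
  rw [h5, Set.inter_comm A B]
  filter_upwards [h1, h2, h3] with ω e1 e2 e3
  rw [Pi.mul_apply, e1, e2, e3, h4]
  by_cases hω : ω ∈ A <;> simp [hω]

end ConditionalIndependence

/-! ### Second moments of the recursive filter channel -/

section Filter

variable {n : ℕ} {H : Type*} [NormedAddCommGroup H] [InnerProductSpace ℝ H]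
  {a v : Fin n → ℝ} {v₀ : ℝ} {d : Fin (n + 1) → ℝ} {X Y : Fin (n + 1) → H}

/-- The gain `1 - d k / σ²` of the filter channel at time `k`, where `σ²` is the variance of the
one-step prediction error. -/
def filterGain (a : Fin n → ℝ) (v₀ : ℝ) (v : Fin n → ℝ) (d : Fin (n + 1) → ℝ) :
    Fin (n + 1) → ℝ :=
  Fin.cons (α := fun _ => ℝ) (1 - d 0 / v₀) (fun k => 1 - d k.succ / predictedVariance a v d k)

/-- The noise variance of the filter channel. -/
def filterNoiseVariance (a : Fin n → ℝ) (v₀ : ℝ) (v : Fin n → ℝ) (d : Fin (n + 1) → ℝ)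
    (k : Fin (n + 1)) : ℝ :=
  d k * filterGain a v₀ v d k

/-- The coefficient of the previous output in the recursion of the filter channel. -/
def filterFeedback (a : Fin n → ℝ) (v₀ : ℝ) (v : Fin n → ℝ) (d : Fin (n + 1) → ℝ) (k : Fin n) : ℝ :=
  (1 - filterGain a v₀ v d k.succ) * a k

/-- The noise of the filter channel
`y (k + 1) = (1 - g) a y k + g x (k + 1) + e (k + 1)`, recovered from the source and the output. -/
def filterNoise {E : Type*} [AddCommGroup E] [Module ℝ E] (a : Fin n → ℝ) (v₀ : ℝ) (v : Fin n → ℝ)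
    (d : Fin (n + 1) → ℝ) (X Y : Fin (n + 1) → E) (k : Fin (n + 1)) : E :=
  innovation (filterFeedback a v₀ v d) Y k - filterGain a v₀ v d k • X k

theorem IsFeasible.filterNoiseVariance_nonneg (hd : IsFeasible a v₀ v d) (k : Fin (n + 1)) :
    0 ≤ filterNoiseVariance a v₀ v d k := by
  refine mul_nonneg (hd.pos k).le ?_
  induction k using Fin.cases with
  | zero =>
    exact sub_nonneg.2 ((div_le_one ((hd.pos 0).trans_le hd.le_zero)).2 hd.le_zero)
  | succ k => exact sub_nonneg.2 ((div_le_one (hd.predictedVariance_pos k)).2 (hd.le_succ k))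

/-- The innovations of the source and the noise of the filter channel form an orthogonal family
with the prescribed variances. -/
structure IsFilterPair (a : Fin n → ℝ) (v₀ : ℝ) (v : Fin n → ℝ) (d : Fin (n + 1) → ℝ)
    (X Y : Fin (n + 1) → H) : Prop where
  norm_innovation : ∀ k, ‖innovation a X k‖ ^ 2 = (Fin.cons (α := fun _ => ℝ) v₀ v : _ → ℝ) k
  norm_noise : ∀ k, ‖filterNoise a v₀ v d X Y k‖ ^ 2 = filterNoiseVariance a v₀ v d k
  innovation_orthogonal : ∀ i j, i ≠ j → inner ℝ (innovation a X i) (innovation a X j) = 0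
  noise_orthogonal : ∀ i j, i ≠ j →
    inner ℝ (filterNoise a v₀ v d X Y i) (filterNoise a v₀ v d X Y j) = 0
  innovation_noise : ∀ i j, inner ℝ (innovation a X i) (filterNoise a v₀ v d X Y j) = 0

theorem output_zero_eq :
    Y 0 = filterNoise a v₀ v d X Y 0 + filterGain a v₀ v d 0 • X 0 := by
  rw [filterNoise, innovation_zero]
  abel

theorem output_succ_eq (k : Fin n) :
    Y k.succ = filterNoise a v₀ v d X Y k.succ
      + (filterFeedback a v₀ v d k • Y k.castSucc + filterGain a v₀ v d k.succ • X k.succ) := by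
  rw [filterNoise, innovation_succ]
  abel

theorem IsFilterPair.source_noise (h : IsFilterPair a v₀ v d X Y) (i j : Fin (n + 1)) :
    inner ℝ (X i) (filterNoise a v₀ v d X Y j) = 0 := by
  induction i using Fin.induction with
  | zero => exact h.innovation_noise 0 j
  | succ i ih =>
    have h1 : X i.succ = innovation a X i.succ + a i • X i.castSucc := by
      rw [innovation_succ]
      abel
    rw [h1, inner_add_left, inner_smul_left, ih, h.innovation_noise, mul_zero, add_zero]

theorem IsFilterPair.output_noise (h : IsFilterPair a v₀ v d X Y) {i j : Fin (n + 1)}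
    (hij : i < j) : inner ℝ (Y i) (filterNoise a v₀ v d X Y j) = 0 := by
  induction i using Fin.induction with
  | zero =>
    rw [output_zero_eq (a := a) (v₀ := v₀) (v := v) (d := d) (X := X) (Y := Y), inner_add_left,
      inner_smul_left, h.noise_orthogonal _ _ hij.ne, h.source_noise, mul_zero, add_zero]
  | succ i ih =>
    rw [output_succ_eq (a := a) (v₀ := v₀) (v := v) (d := d) (X := X) (Y := Y), inner_add_left,
      inner_add_left, inner_smul_left, inner_smul_left, h.noise_orthogonal _ _ hij.ne,
      h.source_noise, ih (Fin.castSucc_lt_succ.trans hij), mul_zero, mul_zero, add_zero, add_zero]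

theorem IsFilterPair.isCausalPair (h : IsFilterPair a v₀ v d X Y) : IsCausalPair a v₀ v X Y where
  norm_zero := h.norm_innovation 0
  norm_innovation k := h.norm_innovation k.succ
  source_orthogonal k j hjk := source_orthogonal_of_innovation h.innovation_orthogonal
    (hjk.trans_lt Fin.castSucc_lt_succ)
  output_orthogonal k j hjk := by
    rw [← innovation_succ]
    have hX : ∀ i ≤ k.castSucc, inner ℝ (X i) (innovation a X k.succ) = 0 := fun i hi =>
      source_orthogonal_of_innovation h.innovation_orthogonal (hi.trans_lt Fin.castSucc_lt_succ)
    have hW : ∀ i, inner ℝ (filterNoise a v₀ v d X Y i) (innovation a X k.succ) = 0 := fun i => by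
      rw [real_inner_comm, h.innovation_noise]
    induction j using Fin.induction with
    | zero =>
      rw [output_zero_eq (a := a) (v₀ := v₀) (v := v) (d := d) (X := X) (Y := Y), inner_add_left,
        inner_smul_left, hW, hX _ hjk, mul_zero, add_zero]
    | succ j ih =>
      rw [output_succ_eq (a := a) (v₀ := v₀) (v := v) (d := d) (X := X) (Y := Y), inner_add_left,
        inner_add_left, inner_smul_left, inner_smul_left, hW, hX _ hjk,
        ih (Fin.castSucc_lt_succ.le.trans hjk), mul_zero, mul_zero, add_zero, add_zero]

/-- The errors of the filter channel have the prescribed variances and are orthogonal to the past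
outputs. -/
theorem IsFilterPair.filter_error (h : IsFilterPair a v₀ v d X Y) (hd : IsFeasible a v₀ v d)
    (k : Fin (n + 1)) :
    ‖X k - Y k‖ ^ 2 = d k ∧ ∀ j ≤ k, inner ℝ (X k - Y k) (Y j) = 0 := by
  -- one step: the error and output in terms of the prediction error `I` and the noise `W`
  have step : ∀ (I W : H) (g σ δ : ℝ), 0 < σ → g = 1 - δ / σ → ‖I‖ ^ 2 = σ → ‖W‖ ^ 2 = δ * g →
      inner ℝ I W = 0 → ‖(1 - g) • I - W‖ ^ 2 = δ ∧
        inner ℝ ((1 - g) • I - W) (W + g • I) = 0 := by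
    intro I W g σ δ hσ hg hI hW hIW
    have hIW' : inner ℝ W I = 0 := by rw [real_inner_comm, hIW]
    constructor
    · rw [norm_sub_sq_real, inner_smul_left, hIW, norm_smul, mul_pow, hI, hW, Real.norm_eq_abs,
        sq_abs, hg]
      field_simp
      ring
    · rw [inner_sub_left, inner_add_right, inner_add_right, inner_smul_left, inner_smul_left,
        inner_smul_right, inner_smul_right, hIW, hIW', real_inner_self_eq_norm_sq,
        real_inner_self_eq_norm_sq, hI, hW, hg]
      simp only [conj_trivial]
      field_simp
      ring
  have hc := h.isCausalPair
  induction k using Fin.induction with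
  | zero =>
    have h0 := (hd.pos 0).trans_le hd.le_zero
    have hY := output_zero_eq (a := a) (v₀ := v₀) (v := v) (d := d) (X := X) (Y := Y)
    obtain ⟨h1, h2⟩ := step (X 0) (filterNoise a v₀ v d X Y 0) (filterGain a v₀ v d 0) v₀ (d 0) h0
      rfl (h.norm_innovation 0) (h.norm_noise 0) (h.source_noise 0 0)
    have hE : X 0 - Y 0 = (1 - filterGain a v₀ v d 0) • X 0 - filterNoise a v₀ v d X Y 0 := by
      rw [hY]
      module
    refine ⟨by rw [hE, h1], fun j hj => ?_⟩
    obtain rfl : j = 0 := Fin.le_zero_iff.1 hj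
    rw [hE]
    conv_lhs => rw [hY]
    exact h2
  | succ k ih =>
    obtain ⟨ih1, ih2⟩ := ih
    set Z := X k.succ - a k • X k.castSucc with hZ
    set W := filterNoise a v₀ v d X Y k.succ with hW
    set g := filterGain a v₀ v d k.succ with hg
    set I := a k • (X k.castSucc - Y k.castSucc) + Z with hI
    have hEZ : inner ℝ (X k.castSucc - Y k.castSucc) Z = 0 := by
      rw [inner_sub_left, hc.source_orthogonal k _ le_rfl, hc.output_orthogonal k _ le_rfl,
        sub_zero]
    have hIn : ‖I‖ ^ 2 = predictedVariance a v d k := by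
      rw [hI, norm_add_sq_real, inner_smul_left, hEZ, norm_smul, mul_pow, ih1,
        hc.norm_innovation, Real.norm_eq_abs, sq_abs, predictedVariance]
      ring
    have hZW : inner ℝ Z W = 0 := h.innovation_noise k.succ k.succ
    have hYW : ∀ j ≤ k.castSucc, inner ℝ (Y j) W = 0 := fun j hj =>
      h.output_noise (hj.trans_lt Fin.castSucc_lt_succ)
    have hIW : inner ℝ I W = 0 := by
      rw [hI, inner_add_left, inner_smul_left, inner_sub_left, h.source_noise, hYW _ le_rfl, hZW]
      simp
    have hIY : ∀ j ≤ k.castSucc, inner ℝ I (Y j) = 0 := fun j hj => by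
      rw [hI, inner_add_left, inner_smul_left, ih2 j hj, real_inner_comm,
        hc.output_orthogonal k j hj, mul_zero, add_zero]
    obtain ⟨h1, h2⟩ := step I W g (predictedVariance a v d k) (d k.succ)
      (hd.predictedVariance_pos k) rfl hIn (h.norm_noise k.succ) hIW
    have hY : Y k.succ = a k • Y k.castSucc + (W + g • I) := by
      rw [output_succ_eq (a := a) (v₀ := v₀) (v := v) (d := d) (X := X) (Y := Y), ← hW, ← hg, hI,
        hZ, filterFeedback, ← hg]
      module
    have hE : X k.succ - Y k.succ = (1 - g) • I - W := by
      rw [hY, hI, hZ]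
      module
    have hpast : ∀ j ≤ k.castSucc, inner ℝ ((1 - g) • I - W) (Y j) = 0 := fun j hj => by
      rw [inner_sub_left, inner_smul_left, hIY j hj, real_inner_comm, hYW j hj, mul_zero, sub_zero]
    rw [hE]
    refine ⟨h1, fun j hj => ?_⟩
    rcases hj.lt_or_eq with hlt | rfl
    · exact hpast j (Fin.le_castSucc_iff.2 hlt)
    · rw [hY, inner_add_right, inner_smul_right, hpast _ le_rfl, h2, mul_zero, add_zero]

/-- The backward residuals of the filter channel are orthogonal to all outputs, earlier or later. -/
theorem IsFilterPair.backwardResidual_output (h : IsFilterPair a v₀ v d X Y)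
    (hd : IsFeasible a v₀ v d) (k j : Fin (n + 1)) :
    inner ℝ (backwardResidual a v d X Y k) (Y j) = 0 := by
  have hc := h.isCausalPair
  have horth : ∀ j k, j ≤ k → inner ℝ (X k - Y k) (Y j) = 0 := fun j k hjk =>
    (h.filter_error hd k).2 j hjk
  have hpast : ∀ j ≤ k, inner ℝ (backwardResidual a v d X Y k) (Y j) = 0 := by
    intro j hj
    induction k using Fin.lastCases with
    | last => rw [backwardResidual_last, horth _ _ hj]
    | cast k =>
      rw [backwardResidual_castSucc hd, inner_sub_left, inner_smul_left, inner_smul_left,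
        horth _ _ hj, real_inner_comm, hc.output_orthogonal k j hj, mul_zero, mul_zero, sub_zero]
  induction j using Fin.induction with
  | zero => exact hpast 0 (Fin.zero_le k)
  | succ j ih =>
    rcases le_or_gt j.succ k with hle | hlt
    · exact hpast _ hle
    · have hRW : inner ℝ (backwardResidual a v d X Y k) (filterNoise a v₀ v d X Y j.succ) = 0 := by
        rw [backwardResidual, inner_sub_left, inner_smul_left, h.output_noise hlt, mul_zero,
          sub_zero]
        induction k using Fin.lastCases with
        | last => rw [backwardDifference, Fin.snoc_last, h.source_noise]
        | cast k =>
          rw [backwardDifference, Fin.snoc_castSucc, inner_sub_left, inner_smul_left,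
            h.source_noise, h.source_noise, mul_zero, sub_zero]
      rw [output_succ_eq (a := a) (v₀ := v₀) (v := v) (d := d) (X := X) (Y := Y), inner_add_right,
        inner_add_right, inner_smul_right, inner_smul_right, ih, hRW,
        hc.backwardResidual_source hd horth (fun k => (h.filter_error hd k).1) hlt, mul_zero,
        mul_zero, add_zero, add_zero]

theorem IsFilterPair.norm_backwardResidual (h : IsFilterPair a v₀ v d X Y)
    (hd : IsFeasible a v₀ v d) (k : Fin (n + 1)) :
    ‖backwardResidual a v d X Y k‖ ^ 2 = backwardVariance a v d k := by
  have h1 := h.isCausalPair.norm_backwardResidual hd (M := Y)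
    (fun k => Submodule.subset_span ⟨k, Set.mem_Iic.2 le_rfl, rfl⟩) k
  rw [(h.filter_error hd k).1, div_self (hd.pos k).ne', sub_self, mul_zero, add_zero,
    div_eq_one_iff_eq (hd.backwardVariance_pos k).ne'] at h1
  exact h1

theorem IsFilterPair.backwardResidual_orthogonal (h : IsFilterPair a v₀ v d X Y)
    (hd : IsFeasible a v₀ v d) {j k : Fin (n + 1)} (hjk : j ≠ k) :
    inner ℝ (backwardResidual a v d X Y j) (backwardResidual a v d X Y k) = 0 := by
  have key : ∀ j k : Fin (n + 1), j < k →
      inner ℝ (backwardResidual a v d X Y j) (backwardResidual a v d X Y k) = 0 := by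
    intro j k hlt
    have hX : ∀ i, j < i → inner ℝ (backwardResidual a v d X Y j) (X i) = 0 := fun i hi =>
      h.isCausalPair.backwardResidual_source hd (fun j k hjk => (h.filter_error hd k).2 j hjk)
        (fun k => (h.filter_error hd k).1) hi
    rw [backwardResidual.eq_1 a v d X Y k, inner_sub_right, inner_smul_right,
      h.backwardResidual_output hd, mul_zero, sub_zero]
    induction k using Fin.lastCases with
    | last => rw [backwardDifference, Fin.snoc_last, hX _ hlt]
    | cast k =>
      rw [backwardDifference, Fin.snoc_castSucc, inner_sub_right, inner_smul_right, hX _ hlt,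
        hX _ (hlt.trans Fin.castSucc_lt_succ), mul_zero, sub_zero]
  rcases lt_or_gt_of_ne hjk with hlt | hlt
  · exact key j k hlt
  · rw [real_inner_comm, key k j hlt]

end Filter

/-! ### Realization of the filter channel -/

section Realization

theorem isGaussian_pi_gaussianReal {ι : Type*} [Fintype ι] (V : ι → ℝ≥0) :
    IsGaussian (Measure.pi fun k => gaussianReal 0 (V k)) := by
  have h1 : iIndepFun (fun (k : ι) (z : ι → ℝ) => z k)
      (Measure.pi fun k => gaussianReal 0 (V k)) :=
    iIndepFun_pi (X := fun _ => id) fun _ => aemeasurable_id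
  have h2 : ∀ k, HasGaussianLaw (fun z : ι → ℝ => z k)
      (Measure.pi fun k => gaussianReal 0 (V k)) := fun k =>
    HasLaw.hasGaussianLaw (μ := gaussianReal 0 (V k))
      ⟨(measurable_pi_apply k).aemeasurable, (measurePreserving_eval _ k).map_eq⟩
  have h3 := (h1.hasGaussianLaw h2).isGaussian_map
  rwa [show (fun ω : ι → ℝ => (fun k => ω k)) = id from rfl, Measure.map_id] at h3

/-- Jointly Gaussian variables that are centred and orthogonal to each other and to `Y` are
independent of each other and of `Y`. -/
theorem map_prodMk_eq_prod_of_orthogonal {α ι κ : Type*} [MeasurableSpace α] [Fintype ι]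
    [Fintype κ] {ν : Measure α} {X : ι → α → ℝ} {Y : κ → α → ℝ} {τ : ι → ℝ≥0}
    (hg : HasGaussianLaw (fun ω => (fun i => X i ω, fun j => Y j ω)) ν)
    (hmean : ∀ i, ∫ ω, X i ω ∂ν = 0) (hXY : ∀ i j, ∫ ω, X i ω * Y j ω ∂ν = 0)
    (hXX : ∀ i j, i ≠ j → ∫ ω, X i ω * X j ω ∂ν = 0) (hvar : ∀ i, ∫ ω, X i ω ^ 2 ∂ν = τ i) :
    ν.map (fun ω => (fun i => X i ω, fun j => Y j ω)) =
      (Measure.pi fun i => gaussianReal 0 (τ i)).prod (ν.map fun ω j => Y j ω) := by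
  have : IsProbabilityMeasure ν := hg.isProbabilityMeasure
  have hX := hg.fst
  have hY := hg.snd
  have hind : IndepFun (fun ω i => X i ω) (fun ω j => Y j ω) ν := by
    refine hg.indepFun_of_covariance_eval fun i j => ?_
    rw [covariance_eq_sub (hX.eval i).memLp_two (hY.eval j).memLp_two, hmean, zero_mul, sub_zero]
    exact hXY i j
  have hiind : iIndepFun X ν := by
    refine hX.iIndepFun_of_covariance_eq_zero fun i j hij => ?_
    rw [covariance_eq_sub (hX.eval i).memLp_two (hX.eval j).memLp_two, hmean, zero_mul, sub_zero]
    exact hXX i j hij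
  have hlaw : ∀ i, ν.map (X i) = gaussianReal 0 (τ i) := fun i => by
    rw [(hX.eval i).map_eq_gaussianReal, hmean,
      variance_of_integral_eq_zero (hX.eval i).aemeasurable (hmean i), hvar, Real.toNNReal_coe]
  rw [(indepFun_iff_map_prod_eq_prod_map_map hX.aemeasurable hY.aemeasurable).1 hind,
    (iIndepFun_iff_map_fun_eq_pi_map fun i => (hX.eval i).aemeasurable).1 hiind]
  simp_rw [hlaw]

variable {n : ℕ} {a : Fin n → ℝ} {v₀ : ℝ≥0} {v : Fin n → ℝ≥0} {d : Fin (n + 1) → ℝ}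

/-- The filter noise as a linear function of source and output. -/
def filterNoiseLinear (a : Fin n → ℝ) (v₀ : ℝ) (v : Fin n → ℝ) (d : Fin (n + 1) → ℝ) :
    (Fin (n + 1) → ℝ) × (Fin (n + 1) → ℝ) →ₗ[ℝ] (Fin (n + 1) → ℝ) :=
  innovationLinear (filterFeedback a v₀ v d) ∘ₗ LinearMap.snd ℝ _ _
    - Matrix.toLin' (Matrix.diagonal (filterGain a v₀ v d)) ∘ₗ LinearMap.fst ℝ _ _

theorem filterNoiseLinear_apply (a : Fin n → ℝ) (v₀ : ℝ) (v : Fin n → ℝ) (d : Fin (n + 1) → ℝ)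
    (p : (Fin (n + 1) → ℝ) × (Fin (n + 1) → ℝ)) (k : Fin (n + 1)) :
    filterNoiseLinear a v₀ v d p k = filterNoise a v₀ v d p.1 p.2 k := by
  simp [filterNoiseLinear, filterNoise, innovationLinear_apply, Matrix.mulVec_diagonal]

theorem map_filterNoise {E F : Type*} [AddCommGroup E] [Module ℝ E] [AddCommGroup F] [Module ℝ F]
    (a : Fin n → ℝ) (v₀ : ℝ) (v : Fin n → ℝ) (d : Fin (n + 1) → ℝ) (f : E →ₗ[ℝ] F)
    (X Y : Fin (n + 1) → E) (k : Fin (n + 1)) :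
    f (filterNoise a v₀ v d X Y k)
      = filterNoise a v₀ v d (fun i => f (X i)) (fun i => f (Y i)) k := by
  simp [filterNoise, map_innovation]

/-- The noise variances as nonnegative reals. -/
def filterNoiseVarianceNN (a : Fin n → ℝ) (v₀ : ℝ) (v : Fin n → ℝ) (d : Fin (n + 1) → ℝ)
    (k : Fin (n + 1)) : ℝ≥0 :=
  (filterNoiseVariance a v₀ v d k).toNNReal

/-- Source and output are linear functions of the innovations and the filter noise, so that the
joint law of the latter can be prescribed. -/
theorem exists_gaussian_filter (a : Fin n → ℝ) (v₀ : ℝ) (v : Fin n → ℝ) (d : Fin (n + 1) → ℝ)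
    (V W : Fin (n + 1) → ℝ≥0) :
    ∃ ν : ProbabilityMeasure ((Fin (n + 1) → ℝ) × (Fin (n + 1) → ℝ)),
      IsGaussian (ν : Measure ((Fin (n + 1) → ℝ) × (Fin (n + 1) → ℝ))) ∧
      (ν : Measure ((Fin (n + 1) → ℝ) × (Fin (n + 1) → ℝ))).map
        (fun p => (innovationLinear a p.1, filterNoiseLinear a v₀ v d p)) =
        (Measure.pi fun k => gaussianReal 0 (V k)).prod
          (Measure.pi fun k => gaussianReal 0 (W k)) := by
  set f := ((innovationLinear a) ∘ₗ LinearMap.fst ℝ (Fin (n + 1) → ℝ) (Fin (n + 1) → ℝ)).prod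
    (filterNoiseLinear a v₀ v d) with hf
  have hdet : ∀ b : Fin n → ℝ, LinearMap.det (innovationLinear b) ≠ 0 := fun b => by
    rw [det_innovationLinear]
    exact one_ne_zero
  have hinj : Function.Injective f := by
    rw [injective_iff_map_eq_zero]
    rintro ⟨x, y⟩ hp
    obtain ⟨h1, h2⟩ := Prod.ext_iff.1 hp
    have hx : x = 0 := injective_of_det_ne_zero (hdet a) (h1.trans (map_zero _).symm)
    subst hx
    have h3 : innovationLinear (filterFeedback a v₀ v d) y = 0 := by
      simpa [f, filterNoiseLinear] using h2
    rw [injective_of_det_ne_zero (hdet _) (h3.trans (map_zero _).symm)]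
    rfl
  set e := LinearEquiv.ofInjectiveEndo f hinj
  have hg1 := isGaussian_pi_gaussianReal V
  have hg2 := isGaussian_pi_gaussianReal W
  set π := (Measure.pi fun k => gaussianReal 0 (V k)).prod
    (Measure.pi fun k => gaussianReal 0 (W k))
  have hgauss : IsGaussian (π.map e.symm.toLinearMap.toContinuousLinearMap) := inferInstance
  refine ⟨⟨π.map e.symm.toLinearMap.toContinuousLinearMap, inferInstance⟩, hgauss, ?_⟩
  have hfm : Measurable f := (LinearMap.continuous_of_finiteDimensional f).measurable
  change (π.map e.symm.toLinearMap.toContinuousLinearMap).map f = π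
  rw [Measure.map_map hfm (ContinuousLinearMap.measurable _)]
  have hid : f ∘ e.symm.toLinearMap.toContinuousLinearMap = id := by
    funext p
    exact e.apply_symm_apply p
  rw [hid, Measure.map_id]


variable {P : Measure (Fin (n + 1) → ℝ)}
  {ν : ProbabilityMeasure ((Fin (n + 1) → ℝ) × (Fin (n + 1) → ℝ))}

/-- The innovations of the source and the noise of the filter channel are independent Gaussian
variables with the prescribed variances. -/
def IsFilterLaw (a : Fin n → ℝ) (v₀ : ℝ≥0) (v : Fin n → ℝ≥0) (d : Fin (n + 1) → ℝ)
    (ν : ProbabilityMeasure ((Fin (n + 1) → ℝ) × (Fin (n + 1) → ℝ))) : Prop :=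
  (ν : Measure ((Fin (n + 1) → ℝ) × (Fin (n + 1) → ℝ))).map
    (fun p => (innovationLinear a p.1, filterNoiseLinear a v₀ (fun k => (v k : ℝ)) d p)) =
    (Measure.pi fun k => gaussianReal 0 ((Fin.cons (α := fun _ => ℝ≥0) v₀ v : _ → ℝ≥0) k)).prod
      (Measure.pi fun k => gaussianReal 0 (filterNoiseVarianceNN a v₀ (fun k => (v k : ℝ)) d k))

theorem measurable_innovationLinear (a : Fin n → ℝ) : Measurable (innovationLinear a) :=
  (LinearMap.continuous_of_finiteDimensional _).measurable

theorem measurable_innovationLinear_fst (a : Fin n → ℝ) :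
    Measurable fun p : (Fin (n + 1) → ℝ) × (Fin (n + 1) → ℝ) => innovationLinear a p.1 :=
  (measurable_innovationLinear a).comp measurable_fst

theorem measurable_filterNoiseLinear (a : Fin n → ℝ) (v₀ : ℝ) (v : Fin n → ℝ)
    (d : Fin (n + 1) → ℝ) : Measurable (filterNoiseLinear a v₀ v d) :=
  (LinearMap.continuous_of_finiteDimensional _).measurable

theorem IsFilterLaw.map_noise (h : IsFilterLaw a v₀ v d ν) :
    (ν : Measure ((Fin (n + 1) → ℝ) × (Fin (n + 1) → ℝ))).map
      (filterNoiseLinear a v₀ (fun k => (v k : ℝ)) d) =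
      Measure.pi fun k =>
        gaussianReal 0 (filterNoiseVarianceNN a v₀ (fun k => (v k : ℝ)) d k) := by
  have h1 := congrArg Measure.snd h
  rw [Measure.snd_prod, Measure.snd, Measure.map_map measurable_snd
    ((measurable_innovationLinear_fst a).prodMk
      (measurable_filterNoiseLinear _ _ _ _))] at h1
  exact h1

theorem IsFilterLaw.map_innovation (h : IsFilterLaw a v₀ v d ν) :
    (ν : Measure ((Fin (n + 1) → ℝ) × (Fin (n + 1) → ℝ))).map
      (fun p => innovationLinear a p.1) =
      Measure.pi fun k => gaussianReal 0 ((Fin.cons (α := fun _ => ℝ≥0) v₀ v : _ → ℝ≥0) k) := by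
  have h1 := congrArg Measure.fst h
  rw [Measure.fst_prod, Measure.fst, Measure.map_map measurable_fst
    ((measurable_innovationLinear_fst a).prodMk
      (measurable_filterNoiseLinear _ _ _ _))] at h1
  exact h1

theorem IsFilterLaw.indepFun_innovation (h : IsFilterLaw a v₀ v d ν) :
    IndepFun (fun p => innovationLinear a p.1) (filterNoiseLinear a v₀ (fun k => (v k : ℝ)) d)
      (ν : Measure ((Fin (n + 1) → ℝ) × (Fin (n + 1) → ℝ))) := by
  rw [indepFun_iff_map_prod_eq_prod_map_map
    (measurable_innovationLinear_fst a).aemeasurable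
    (measurable_filterNoiseLinear _ _ _ _).aemeasurable, h.map_noise, h.map_innovation]
  exact h

/-- The filter noise is independent of the source, since the innovations determine the source. -/
theorem IsFilterLaw.indepFun_source (h : IsFilterLaw a v₀ v d ν) :
    IndepFun Prod.fst (filterNoiseLinear a v₀ (fun k => (v k : ℝ)) d)
      (ν : Measure ((Fin (n + 1) → ℝ) × (Fin (n + 1) → ℝ))) := by
  set e := LinearMap.equivOfDetNeZero (innovationLinear a)
    (by rw [det_innovationLinear]; exact one_ne_zero)
  have h1 := h.indepFun_innovation.comp
    (LinearMap.continuous_of_finiteDimensional e.symm.toLinearMap).measurable measurable_id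
  have h2 : e.symm.toLinearMap ∘ (fun p : (Fin (n + 1) → ℝ) × (Fin (n + 1) → ℝ) =>
      innovationLinear a p.1) = Prod.fst := by
    funext p
    exact e.symm_apply_apply p.1
  rwa [h2] at h1

/-- The law of the innovations determines the law of the source. -/
theorem IsFilterLaw.fst_eq (h : IsFilterLaw a v₀ v d ν) (hv₀ : 0 < v₀) (hv : ∀ k, 0 < v k)
    (hP : P.map (innovationLinear a) =
      Measure.pi fun k => gaussianReal 0 ((Fin.cons (α := fun _ => ℝ≥0) v₀ v : _ → ℝ≥0) k)) :
    (ν : Measure ((Fin (n + 1) → ℝ) × (Fin (n + 1) → ℝ))).fst = P := by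
  have hV : ∀ k, 0 < (Fin.cons (α := fun _ => ℝ≥0) v₀ v : Fin (n + 1) → ℝ≥0) k :=
    Fin.cases hv₀ hv
  rw [eq_withDensity_of_map_eq_pi (det_innovationLinear a) hV hP]
  refine eq_withDensity_of_map_eq_pi (det_innovationLinear a) hV ?_
  rw [Measure.fst, Measure.map_map (measurable_innovationLinear a) measurable_fst]
  exact h.map_innovation

theorem integral_eq_zero_of_innovation {α : Type*} [MeasurableSpace α] {ρ : Measure α}
    {x : Fin (n + 1) → α → ℝ} (hx : ∀ k, Integrable (x k) ρ)
    (h : ∀ k, ∫ ω, innovation a (fun i => x i ω) k ∂ρ = 0) (k : Fin (n + 1)) :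
    ∫ ω, x k ω ∂ρ = 0 := by
  induction k using Fin.induction with
  | zero => exact h 0
  | succ k ih =>
    have h1 := h k.succ
    simp only [innovation_succ, smul_eq_mul] at h1
    rwa [integral_sub (hx _) ((hx _).const_mul _), integral_const_mul, ih, mul_zero, sub_zero] at h1

theorem IsFilterLaw.hasLaw_noise (h : IsFilterLaw a v₀ v d ν) (k : Fin (n + 1)) :
    HasLaw (fun p => filterNoiseLinear a v₀ (fun k => (v k : ℝ)) d p k)
      (gaussianReal 0 (filterNoiseVarianceNN a v₀ (fun k => (v k : ℝ)) d k))
      (ν : Measure ((Fin (n + 1) → ℝ) × (Fin (n + 1) → ℝ))) where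
  aemeasurable := ((measurable_pi_apply k).comp
    (measurable_filterNoiseLinear _ _ _ _)).aemeasurable
  map_eq := by
    have h1 := (measurePreserving_eval (fun k => gaussianReal 0
      (filterNoiseVarianceNN a v₀ (fun k => (v k : ℝ)) d k)) k).map_eq
    rw [← h.map_noise, Measure.map_map (measurable_pi_apply k)
      (measurable_filterNoiseLinear _ _ _ _)] at h1
    exact h1

theorem IsFilterLaw.iIndepFun_noise (h : IsFilterLaw a v₀ v d ν) :
    iIndepFun (fun k p => filterNoiseLinear a v₀ (fun k => (v k : ℝ)) d p k)
      (ν : Measure ((Fin (n + 1) → ℝ) × (Fin (n + 1) → ℝ))) := by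
  rw [iIndepFun_iff_map_fun_eq_pi_map fun k => (h.hasLaw_noise k).aemeasurable]
  simp_rw [fun k => (h.hasLaw_noise k).map_eq]
  exact h.map_noise

theorem innovation_output_eq (p : (Fin (n + 1) → ℝ) × (Fin (n + 1) → ℝ)) (k : Fin (n + 1)) :
    innovation (filterFeedback a v₀ (fun k => (v k : ℝ)) d) p.2 k
      = filterNoiseLinear a v₀ (fun k => (v k : ℝ)) d p k
        + filterGain a v₀ (fun k => (v k : ℝ)) d k * p.1 k := by
  rw [filterNoiseLinear_apply, filterNoise, smul_eq_mul, sub_add_cancel]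

theorem IsFilterLaw.memLp_output (h : IsFilterLaw a v₀ v d ν)
    (hx : ∀ k, MemLp (fun p : (Fin (n + 1) → ℝ) × (Fin (n + 1) → ℝ) => p.1 k) 2
      (ν : Measure ((Fin (n + 1) → ℝ) × (Fin (n + 1) → ℝ)))) (k : Fin (n + 1)) :
    MemLp (fun p : (Fin (n + 1) → ℝ) × (Fin (n + 1) → ℝ) => p.2 k) 2
      (ν : Measure ((Fin (n + 1) → ℝ) × (Fin (n + 1) → ℝ))) := by
  refine memLp_of_innovation (a := filterFeedback a v₀ (fun k => (v k : ℝ)) d)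
    (x := fun k (p : (Fin (n + 1) → ℝ) × (Fin (n + 1) → ℝ)) => p.2 k) (fun k => ?_) k
  simp_rw [innovation_output_eq]
  exact (h.hasLaw_noise k).hasGaussianLaw.memLp_two.add ((hx k).const_mul _)

theorem IsFilterLaw.integral_source (h : IsFilterLaw a v₀ v d ν)
    (hx : ∀ k, MemLp (fun p : (Fin (n + 1) → ℝ) × (Fin (n + 1) → ℝ) => p.1 k) 2
      (ν : Measure ((Fin (n + 1) → ℝ) × (Fin (n + 1) → ℝ)))) (k : Fin (n + 1)) :
    ∫ p, p.1 k ∂(ν : Measure ((Fin (n + 1) → ℝ) × (Fin (n + 1) → ℝ))) = 0 := by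
  refine integral_eq_zero_of_innovation (a := a)
    (x := fun k (p : (Fin (n + 1) → ℝ) × (Fin (n + 1) → ℝ)) => p.1 k)
    (fun k => (hx k).integrable one_le_two) (fun k => ?_) k
  obtain ⟨hl, -⟩ := iIndepFun_innovation (a := a)
    (x := fun k (p : (Fin (n + 1) → ℝ) × (Fin (n + 1) → ℝ)) => p.1 k) (fun k => by fun_prop)
    h.map_innovation
  rw [(hl k).integral_eq, integral_id_gaussianReal]

theorem IsFilterLaw.integral_output (h : IsFilterLaw a v₀ v d ν)
    (hx : ∀ k, MemLp (fun p : (Fin (n + 1) → ℝ) × (Fin (n + 1) → ℝ) => p.1 k) 2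
      (ν : Measure ((Fin (n + 1) → ℝ) × (Fin (n + 1) → ℝ)))) (k : Fin (n + 1)) :
    ∫ p, p.2 k ∂(ν : Measure ((Fin (n + 1) → ℝ) × (Fin (n + 1) → ℝ))) = 0 := by
  refine integral_eq_zero_of_innovation (a := filterFeedback a v₀ (fun k => (v k : ℝ)) d)
    (x := fun k (p : (Fin (n + 1) → ℝ) × (Fin (n + 1) → ℝ)) => p.2 k)
    (fun k => (h.memLp_output hx k).integrable one_le_two) (fun k => ?_) k
  simp_rw [innovation_output_eq]
  rw [integral_add ((h.hasLaw_noise k).hasGaussianLaw.integrable)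
    (((hx k).integrable one_le_two).const_mul _), integral_const_mul, h.integral_source hx,
    (h.hasLaw_noise k).integral_eq, integral_id_gaussianReal, mul_zero, add_zero]

/-- The outputs of the filter channel are generated by the past of the source and the noise, and
the noise is independent of the whole source. -/
theorem IsFilterLaw.isCausal (h : IsFilterLaw a v₀ v d ν) : IsCausal ν := by
  intro k
  rw [condIndepFun_iff_condIndep]
  set G : MeasurableSpace ((Fin (n + 1) → ℝ) × (Fin (n + 1) → ℝ)) :=
    MeasurableSpace.comap (filterNoiseLinear a v₀ (fun k => (v k : ℝ)) d) inferInstance with hG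
  set F := sourcePast k with hF
  have hfst : ∀ s : Set (Fin (n + 1)), MeasurableSpace.comap
      (fun (p : (Fin (n + 1) → ℝ) × (Fin (n + 1) → ℝ)) (i : s) => p.1 i) inferInstance
      ≤ MeasurableSpace.comap (Prod.fst : (Fin (n + 1) → ℝ) × (Fin (n + 1) → ℝ) → _)
        inferInstance := fun s => by
    refine Measurable.comap_le (@measurable_pi_lambda _ _ _ (_) _ _ fun i => ?_)
    exact (measurable_pi_apply i.1).comp (comap_measurable _)
  refine condIndep_of_indep_noise (G := G) (sourcePast_le k)
    (measurable_filterNoiseLinear _ _ _ _).comap_le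
    (Measurable.comap_le (by fun_prop)) ?_ ?_
  · exact (indep_of_indep_of_le_left h.indepFun_source (sup_le (hfst _) (hfst _))).symm
  · refine Measurable.comap_le (@measurable_pi_lambda _ _ _ (_) _ _ fun i => ?_)
    refine (measurable_of_innovation (a := filterFeedback a v₀ (fun k => (v k : ℝ)) d)
      (x := fun k (p : (Fin (n + 1) → ℝ) × (Fin (n + 1) → ℝ)) => p.2 k) k i.2).mono
      (iSup₂_le fun j hj => Measurable.comap_le ?_) le_rfl
    have h1 : Measurable[F ⊔ G] fun p : (Fin (n + 1) → ℝ) × (Fin (n + 1) → ℝ) =>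
        filterNoiseLinear a v₀ (fun k => (v k : ℝ)) d p j :=
      ((measurable_pi_apply j).comp (comap_measurable _)).mono
        (le_sup_right : G ≤ F ⊔ G) le_rfl
    have h2 : Measurable[F ⊔ G] fun p : (Fin (n + 1) → ℝ) × (Fin (n + 1) → ℝ) => p.1 j := by
      have h3 : Measurable[F] fun (p : (Fin (n + 1) → ℝ) × (Fin (n + 1) → ℝ)) (i : Set.Iic k) =>
        p.1 i := comap_measurable _
      exact ((measurable_pi_apply (⟨j, hj⟩ : Set.Iic k)).comp h3).mono
        (le_sup_left : F ≤ F ⊔ G) le_rfl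
    simp_rw [innovation_output_eq]
    exact h1.add (h2.const_mul _)


theorem filterNoise_eq_toL2
    (hx : ∀ k, MemLp (fun p : (Fin (n + 1) → ℝ) × (Fin (n + 1) → ℝ) => p.1 k) 2
      (ν : Measure ((Fin (n + 1) → ℝ) × (Fin (n + 1) → ℝ))))
    (hy : ∀ k, MemLp (fun p : (Fin (n + 1) → ℝ) × (Fin (n + 1) → ℝ) => p.2 k) 2
      (ν : Measure ((Fin (n + 1) → ℝ) × (Fin (n + 1) → ℝ))))
    (v₀ : ℝ) (v : Fin n → ℝ) (k : Fin (n + 1)) :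
    ∃ h : MemLp (fun p => filterNoiseLinear a v₀ v d p k) 2
        (ν : Measure ((Fin (n + 1) → ℝ) × (Fin (n + 1) → ℝ))),
      filterNoise a v₀ v d (sourceVector hx) (outputVector hy) k = toL2 _ ⟨_, h⟩ := by
  set x : Fin (n + 1) → squareIntegrable (ν : Measure ((Fin (n + 1) → ℝ) × (Fin (n + 1) → ℝ))) :=
    fun k => ⟨_, hx k⟩
  set y : Fin (n + 1) → squareIntegrable (ν : Measure ((Fin (n + 1) → ℝ) × (Fin (n + 1) → ℝ))) :=
    fun k => ⟨_, hy k⟩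
  have h1 : (filterNoise a v₀ v d x y k).1 = fun p => filterNoiseLinear a v₀ v d p k := by
    funext p
    change evalAt p (filterNoise a v₀ v d x y k) = _
    rw [map_filterNoise, filterNoiseLinear_apply]
    rfl
  refine ⟨h1 ▸ (filterNoise a v₀ v d x y k).2, ?_⟩
  have h2 : toL2 _ (filterNoise a v₀ v d x y k)
      = filterNoise a v₀ v d (sourceVector hx) (outputVector hy) k := by
    rw [map_filterNoise]
    rfl
  rw [← h2]
  congr 1
  exact Subtype.ext h1

theorem IsFilterLaw.isFilterPair (h : IsFilterLaw a v₀ v d ν)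
    (hd : IsFeasible a v₀ (fun k => (v k : ℝ)) d)
    (hP : P.map (innovationLinear a) =
      Measure.pi fun k => gaussianReal 0 ((Fin.cons (α := fun _ => ℝ≥0) v₀ v : _ → ℝ≥0) k))
    (hfst : (ν : Measure ((Fin (n + 1) → ℝ) × (Fin (n + 1) → ℝ))).fst = P)
    (hy : ∀ k, MemLp (fun p : (Fin (n + 1) → ℝ) × (Fin (n + 1) → ℝ) => p.2 k) 2
      (ν : Measure ((Fin (n + 1) → ℝ) × (Fin (n + 1) → ℝ)))) :
    IsFilterPair a v₀ (fun k => (v k : ℝ)) d (sourceVector (memLp_source hP hfst))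
      (outputVector hy) where
  norm_innovation k := by
    rw [norm_innovation_source hP hfst]
    induction k using Fin.cases <;> rfl
  innovation_orthogonal i j hij := inner_innovation_source hP hfst hij
  norm_noise k := by
    obtain ⟨hw, hwe⟩ := filterNoise_eq_toL2 (a := a) (d := d) (memLp_source hP hfst) hy v₀
      (fun k => (v k : ℝ)) k
    have hvar := (h.hasLaw_noise k).variance_eq
    have hmean := (h.hasLaw_noise k).integral_eq
    rw [integral_id_gaussianReal] at hmean
    rw [variance_id_gaussianReal, variance_of_integral_eq_zero
      (h.hasLaw_noise k).aemeasurable hmean] at hvar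
    rw [hwe, norm_toL2_sq, hvar]
    exact Real.coe_toNNReal _ (hd.filterNoiseVariance_nonneg k)
  noise_orthogonal i j hij := by
    obtain ⟨hw, hwe⟩ := filterNoise_eq_toL2 (a := a) (d := d) (memLp_source hP hfst) hy v₀
      (fun k => (v k : ℝ)) i
    obtain ⟨hw', hwe'⟩ := filterNoise_eq_toL2 (a := a) (d := d) (memLp_source hP hfst) hy v₀
      (fun k => (v k : ℝ)) j
    have hmean := (h.hasLaw_noise i).integral_eq
    rw [integral_id_gaussianReal] at hmean
    rw [hwe, hwe', inner_toL2]
    refine ((h.iIndepFun_noise.indepFun hij).integral_fun_mul_eq_mul_integral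
      hw.aestronglyMeasurable hw'.aestronglyMeasurable).trans ?_
    rw [hmean, zero_mul]
  innovation_noise i j := by
    obtain ⟨hz, hze⟩ := innovation_eq_toL2 (a := a) (memLp_source hP hfst) i
    obtain ⟨hw, hwe⟩ := filterNoise_eq_toL2 (a := a) (d := d) (memLp_source hP hfst) hy v₀
      (fun k => (v k : ℝ)) j
    have hmean := (h.hasLaw_noise j).integral_eq
    rw [integral_id_gaussianReal] at hmean
    rw [hze, hwe, inner_toL2]
    refine ((h.indepFun_innovation.comp (measurable_pi_apply i)
      (measurable_pi_apply j)).integral_fun_mul_eq_mul_integral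
      hz.aestronglyMeasurable hw.aestronglyMeasurable).trans ?_
    change _ * ∫ p, filterNoiseLinear a v₀ (fun k => (v k : ℝ)) d p j ∂_ = 0
    rw [hmean, mul_zero]

/-- The mean of square-integrable functions as a linear functional. -/
def meanLinear {α : Type*} [MeasurableSpace α] (ρ : Measure α) [IsFiniteMeasure ρ] :
    squareIntegrable ρ →ₗ[ℝ] ℝ where
  toFun f := ∫ ω, f.1 ω ∂ρ
  map_add' f g := integral_add (f.2.integrable one_le_two) (g.2.integrable one_le_two)
  map_smul' c _ := integral_const_mul c _

/-- The rate of the filter channel. -/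
theorem IsFilterLaw.mutualInformation_eq (h : IsFilterLaw a v₀ v d ν) (hv₀ : 0 < v₀)
    (hd : IsFeasible a v₀ (fun k => (v k : ℝ)) d)
    (hg : IsGaussian (ν : Measure ((Fin (n + 1) → ℝ) × (Fin (n + 1) → ℝ))))
    (hP : P.map (innovationLinear a) =
      Measure.pi fun k => gaussianReal 0 ((Fin.cons (α := fun _ => ℝ≥0) v₀ v : _ → ℝ≥0) k))
    (hfst : (ν : Measure ((Fin (n + 1) → ℝ) × (Fin (n + 1) → ℝ))).fst = P) :
    mutualInformation ν = ENNReal.ofReal (totalRate a v₀ (fun k => (v k : ℝ)) d) := by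
  set μ := (ν : Measure ((Fin (n + 1) → ℝ) × (Fin (n + 1) → ℝ))) with hμ
  set v' : Fin n → ℝ := fun k => (v k : ℝ)
  have hx := memLp_source hP hfst
  have hy := h.memLp_output hx
  have hf := h.isFilterPair hd hP hfst hy
  have hV : ∀ k, 0 < (Fin.cons (α := fun _ => ℝ≥0) v₀ v : Fin (n + 1) → ℝ≥0) k :=
    Fin.cases hv₀ fun k => NNReal.coe_pos.1 (hd.var_pos k)
  have hone : (fun k => ∑ j, (1 : Matrix (Fin (n + 1)) (Fin (n + 1)) ℝ) k j • outputVector hy j)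
      = outputVector hy := by
    funext k
    simp [Matrix.one_apply]
  obtain ⟨hi, he⟩ := integral_channelLogRatio hx hy hv₀ hd (norm_innovation_source hP hfst) 1
  set S := weightedEstimate (filterWeight a v' d) 1 with hS
  set B := backwardDifferenceLinear a v' d with hB
  have hcost : backwardCost a v' d (sourceVector hx) (outputVector hy) = ((n + 1 : ℕ) : ℝ) := by
    rw [backwardCost, Finset.sum_congr rfl fun k _ => by
      rw [hf.norm_backwardResidual hd, div_self (hd.backwardVariance_pos k).ne']]
    simp
  rw [hone, hcost, add_sub_cancel_right] at he
  have hR : ∀ k, ∃ hr : MemLp (fun p => (B p.1 - S p.2) k) 2 μ,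
      backwardResidual a v' d (sourceVector hx) (outputVector hy) k = toL2 μ ⟨_, hr⟩ := fun k => by
    have := backwardResidual_eq_toL2 (a := a) (d := d) hx hy v' 1 k
    rwa [hone] at this
  choose hr hre using hR
  have hmean : ∀ k, ∫ p, (B p.1 - S p.2) k ∂μ = 0 := by
    intro k
    set x : Fin (n + 1) → squareIntegrable μ := fun k => ⟨_, hx k⟩
    set y : Fin (n + 1) → squareIntegrable μ := fun k => ⟨_, hy k⟩
    have h1 := map_backwardResidual a v' d (meanLinear μ) x y k
    have h2 : (fun i => meanLinear μ (x i)) = 0 := funext fun i => h.integral_source hx i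
    have h3 : (fun i => meanLinear μ (y i)) = 0 := funext fun i => h.integral_output hx i
    rw [h2, h3] at h1
    have h4 : backwardResidual a v' d (0 : Fin (n + 1) → ℝ) 0 k = 0 := by
      have := map_backwardResidual a v' d (0 : ℝ →ₗ[ℝ] ℝ) (0 : Fin (n + 1) → ℝ) 0 k
      exact this.symm
    rw [h4] at h1
    rw [← h1]
    refine integral_congr_ae (Filter.Eventually.of_forall fun p => ?_)
    change _ = evalAt p (backwardResidual a v' d x y k)
    rw [map_backwardResidual]
    simp only [Pi.sub_apply, hS, weightedEstimate_apply, Matrix.one_apply]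
    simp [backwardResidual, B, x, y, evalAt, backwardDifferenceLinear_apply]
  have hlin : HasGaussianLaw (fun p => (fun i => (B p.1 - S p.2) i, fun j => p.2 j)) μ := by
    set L := ((B ∘ₗ LinearMap.fst ℝ (Fin (n + 1) → ℝ) (Fin (n + 1) → ℝ))
      - S ∘ₗ LinearMap.snd ℝ _ _).prod (LinearMap.snd ℝ (Fin (n + 1) → ℝ) (Fin (n + 1) → ℝ))
    exact (IsGaussian.hasGaussianLaw_id (μ := μ)).map L.toContinuousLinearMap
  have hlaw := map_prodMk_eq_prod_of_orthogonal (τ := backwardVarianceNN a v' d) hlin hmean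
    (fun i j => by
      have := hf.backwardResidual_output hd i j
      rwa [hre, outputVector, inner_toL2] at this)
    (fun i j hij => by
      have := hf.backwardResidual_orthogonal hd hij
      rwa [hre, hre, inner_toL2] at this)
    (fun i => by
      have := hf.norm_backwardResidual hd i
      rw [hre, norm_toL2_sq] at this
      rw [hd.coe_backwardVarianceNN, ← this])
  have hPprob : IsProbabilityMeasure P := by
    rw [← hfst]
    infer_instance
  have hden := eq_withDensity_channelLogRatio (S := S) (κ := μ.snd) (det_innovationLinear a)
    (det_backwardDifferenceLinear a v' d) hV
    (fun k => Real.toNNReal_pos.2 (hd.backwardVariance_pos k)) hP hlaw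
  rw [mutualInformation, ← hμ, hfst, klDiv_eq_ofReal_integral
    continuous_channelLogRatio.measurable hi hden, he]

end Realization

/-! ### The rate-distortion function and its realizations -/

section Main

variable {n : ℕ} {a : Fin n → ℝ} {v₀ : ℝ≥0} {v : Fin n → ℝ≥0} {D d : Fin (n + 1) → ℝ}
  {P : Measure (Fin (n + 1) → ℝ)}
  {ν : ProbabilityMeasure ((Fin (n + 1) → ℝ) × (Fin (n + 1) → ℝ))}

/-- The recursion makes the innovations of the source equal to `x 0, ξ 0, ξ 1, …`. -/
theorem map_innovationLinear_source {Ω : Type*} [MeasurableSpace Ω] {μ : Measure Ω}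
    [IsProbabilityMeasure μ] {x : Fin (n + 1) → Ω → ℝ} {ξ : Fin n → Ω → ℝ}
    (hx₀ : HasLaw (x 0) (gaussianReal 0 v₀) μ)
    (hξ : ∀ k, HasLaw (ξ k) (gaussianReal 0 (v k)) μ)
    (hindep : iIndepFun (Fin.cons (α := fun _ => Ω → ℝ) (x 0) ξ) μ)
    (hrec : ∀ k : Fin n, x k.succ =ᵐ[μ] fun ω => a k * x k.castSucc ω + ξ k ω) :
    (μ.map fun ω k => x k ω).map (innovationLinear a) =
      Measure.pi fun k => gaussianReal 0 ((Fin.cons (α := fun _ => ℝ≥0) v₀ v : _ → ℝ≥0) k) := by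
  have hxm : ∀ k, AEMeasurable (x k) μ := by
    intro k
    induction k using Fin.induction with
    | zero => exact hx₀.aemeasurable
    | succ k ih => exact ((ih.const_mul _).add (hξ k).aemeasurable).congr (hrec k).symm
  have hlaw : ∀ k, HasLaw (Fin.cons (α := fun _ => Ω → ℝ) (x 0) ξ k)
      (gaussianReal 0 ((Fin.cons (α := fun _ => ℝ≥0) v₀ v : _ → ℝ≥0) k)) μ :=
    Fin.cases hx₀ hξ
  rw [AEMeasurable.map_map_of_aemeasurable (measurable_innovationLinear a).aemeasurable
    (aemeasurable_pi_lambda _ hxm)]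
  have hae : (innovationLinear a ∘ fun ω k => x k ω) =ᵐ[μ]
      fun ω k => Fin.cons (α := fun _ => Ω → ℝ) (x 0) ξ k ω := by
    filter_upwards [ae_all_iff.2 hrec] with ω hω
    funext k
    induction k using Fin.cases with
    | zero => rfl
    | succ k =>
      simp only [Function.comp_apply, innovationLinear_apply, innovation_succ, hω, smul_eq_mul,
        add_sub_cancel_left, Fin.cons_succ]
  rw [Measure.map_congr hae,
    (iIndepFun_iff_map_fun_eq_pi_map fun k => (hlaw k).aemeasurable).1 hindep]
  simp_rw [fun k => (hlaw k).map_eq]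

theorem IsFeasible.totalRate_nonneg {v₀ : ℝ} {v : Fin n → ℝ} (hd : IsFeasible a v₀ v d) :
    0 ≤ totalRate a v₀ v d := by
  have h0 : 0 ≤ Real.log (v₀ / d 0) :=
    Real.log_nonneg ((one_le_div (hd.pos 0)).2 hd.le_zero)
  have h1 : 0 ≤ ∑ k : Fin n, Real.log (predictedVariance a v d k / d k.succ) :=
    Finset.sum_nonneg fun k _ => Real.log_nonneg ((one_le_div (hd.pos _)).2 (hd.le_succ k))
  rw [totalRate]
  positivity

variable {ρ : Measure ((Fin (n + 1) → ℝ) × (Fin (n + 1) → ℝ))}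

theorem norm_source_sub_output
    (hx : ∀ k, MemLp (fun p : (Fin (n + 1) → ℝ) × (Fin (n + 1) → ℝ) => p.1 k) 2 ρ)
    (hy : ∀ k, MemLp (fun p : (Fin (n + 1) → ℝ) × (Fin (n + 1) → ℝ) => p.2 k) 2 ρ)
    (k : Fin (n + 1)) :
    ‖sourceVector hx k - outputVector hy k‖ ^ 2 = ∫ p, (p.2 k - p.1 k) ^ 2 ∂ρ := by
  rw [norm_sub_rev, sourceVector, outputVector, ← map_sub, norm_toL2_sq]
  rfl

theorem inner_source_sub_output
    (hx : ∀ k, MemLp (fun p : (Fin (n + 1) → ℝ) × (Fin (n + 1) → ℝ) => p.1 k) 2 ρ)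
    (hy : ∀ k, MemLp (fun p : (Fin (n + 1) → ℝ) × (Fin (n + 1) → ℝ) => p.2 k) 2 ρ)
    (j k : Fin (n + 1)) :
    inner ℝ (sourceVector hx k - outputVector hy k) (outputVector hy j)
      = -∫ p, (p.2 k - p.1 k) * p.2 j ∂ρ := by
  rw [← neg_sub, inner_neg_left, sourceVector, outputVector, outputVector, ← map_sub, inner_toL2]
  rfl

theorem outputMoments_eq_crossGram
    (hy : ∀ k, MemLp (fun p : (Fin (n + 1) → ℝ) × (Fin (n + 1) → ℝ) => p.2 k) 2
      (ν : Measure ((Fin (n + 1) → ℝ) × (Fin (n + 1) → ℝ)))) :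
    outputMoments ν = crossGram (outputVector hy) (outputVector hy) := by
  ext i j
  exact (inner_toL2 ⟨_, hy i⟩ ⟨_, hy j⟩).symm

theorem crossMoments_eq_crossGram
    (hx : ∀ k, MemLp (fun p : (Fin (n + 1) → ℝ) × (Fin (n + 1) → ℝ) => p.1 k) 2
      (ν : Measure ((Fin (n + 1) → ℝ) × (Fin (n + 1) → ℝ))))
    (hy : ∀ k, MemLp (fun p : (Fin (n + 1) → ℝ) × (Fin (n + 1) → ℝ) => p.2 k) 2
      (ν : Measure ((Fin (n + 1) → ℝ) × (Fin (n + 1) → ℝ)))) :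
    crossMoments ν = crossGram (outputVector hy) (sourceVector hx) := by
  ext i j
  exact (inner_toL2 ⟨_, hy i⟩ ⟨_, hx j⟩).symm

theorem sourceMoments_eq_crossGram
    (hfst : (ν : Measure ((Fin (n + 1) → ℝ) × (Fin (n + 1) → ℝ))).fst = P)
    (hx : ∀ k, MemLp (fun p : (Fin (n + 1) → ℝ) × (Fin (n + 1) → ℝ) => p.1 k) 2
      (ν : Measure ((Fin (n + 1) → ℝ) × (Fin (n + 1) → ℝ)))) :
    sourceMoments P = crossGram (sourceVector hx) (sourceVector hx) := by
  ext i j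
  refine Eq.trans ?_ (inner_toL2 ⟨_, hx i⟩ ⟨_, hx j⟩).symm
  subst hfst
  rw [sourceMoments, Matrix.of_apply, Measure.fst, integral_map measurable_fst.aemeasurable
    (by fun_prop)]

/-- The converse: every admissible output has at least the total rate. -/
theorem IsAdmissible.ofReal_totalRate_le (h : IsAdmissible P D ν) (hv₀ : 0 < v₀)
    (hd : IsFeasible a v₀ (fun k => (v k : ℝ))
      (effectiveDistortion a v₀ (fun k => (v k : ℝ)) D))
    (hP : P.map (innovationLinear a) =
      Measure.pi fun k => gaussianReal 0 ((Fin.cons (α := fun _ => ℝ≥0) v₀ v : _ → ℝ≥0) k)) :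
    ENNReal.ofReal (totalRate a v₀ (fun k => (v k : ℝ))
      (effectiveDistortion a v₀ (fun k => (v k : ℝ)) D)) ≤ mutualInformation ν := by
  have hc := h.isCausalPair hP
  obtain ⟨M, hM, hle⟩ := hc.exists_estimate (D := D) fun k => by
    rw [norm_source_sub_output]
    exact h.distortion k
  have hcost := hc.backwardCost_le hd hM hle
  refine le_trans (ENNReal.ofReal_le_ofReal ?_) (ofReal_le_mutualInformation hv₀ hd hP
    h.source_law (h.memLp_output hP) fun k =>
      Submodule.span_mono (Set.image_subset_range _ _) (hM k))
  linarith

/-- The filter channel is admissible and attains the effective distortions. -/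
theorem IsFilterLaw.isAdmissible (h : IsFilterLaw a v₀ v d ν)
    (hd : IsFeasible a v₀ (fun k => (v k : ℝ)) d) (hdD : ∀ k, d k ≤ D k)
    (hP : P.map (innovationLinear a) =
      Measure.pi fun k => gaussianReal 0 ((Fin.cons (α := fun _ => ℝ≥0) v₀ v : _ → ℝ≥0) k))
    (hfst : (ν : Measure ((Fin (n + 1) → ℝ) × (Fin (n + 1) → ℝ))).fst = P) :
    IsAdmissible P D ν ∧ ∀ k, ∫ p, (p.2 k - p.1 k) ^ 2
      ∂(ν : Measure ((Fin (n + 1) → ℝ) × (Fin (n + 1) → ℝ))) = d k := by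
  have hx := memLp_source hP hfst
  have hy := h.memLp_output hx
  have hdist : ∀ k, ∫ p, (p.2 k - p.1 k) ^ 2
      ∂(ν : Measure ((Fin (n + 1) → ℝ) × (Fin (n + 1) → ℝ))) = d k := fun k => by
    rw [← norm_source_sub_output hx hy]
    exact ((h.isFilterPair hd hP hfst hy).filter_error hd k).1
  exact ⟨⟨hfst, h.isCausal, fun k => (hy k).sub (hx k), fun k => (hdist k).trans_le (hdD k)⟩,
    hdist⟩

/-- The converse bound is attained by the filter channel. -/
theorem SRDF_eq (hv₀ : 0 < v₀) (hv : ∀ k, 0 < v k)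
    (hd : IsFeasible a v₀ (fun k => (v k : ℝ))
      (effectiveDistortion a v₀ (fun k => (v k : ℝ)) D))
    (hP : P.map (innovationLinear a) =
      Measure.pi fun k => gaussianReal 0 ((Fin.cons (α := fun _ => ℝ≥0) v₀ v : _ → ℝ≥0) k)) :
    SRDF P D = ((n + 1 : ℕ) : ℝ≥0∞)⁻¹ * ENNReal.ofReal (totalRate a v₀ (fun k => (v k : ℝ))
      (effectiveDistortion a v₀ (fun k => (v k : ℝ)) D)) := by
  refine le_antisymm ?_ (le_iInf₂ fun ν h =>
    mul_le_mul_right (h.ofReal_totalRate_le hv₀ hd hP) _)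
  obtain ⟨ν, hg, h : IsFilterLaw a v₀ v _ ν⟩ := exists_gaussian_filter a v₀
    (fun k => (v k : ℝ)) (effectiveDistortion a v₀ (fun k => (v k : ℝ)) D) _ _
  have hfst := h.fst_eq hv₀ hv hP
  rw [← h.mutualInformation_eq hv₀ hd hg hP hfst]
  exact iInf₂_le ν (h.isAdmissible hd (effectiveDistortion_le D) hP hfst).1

/-- For a realization no linear estimates from all outputs can bring the backward cost below the
number of samples. -/
theorem IsRealization.le_backwardCost (h : IsRealization P D ν) (hv₀ : 0 < v₀)
    (hv : ∀ k, 0 < v k)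
    (hd : IsFeasible a v₀ (fun k => (v k : ℝ))
      (effectiveDistortion a v₀ (fun k => (v k : ℝ)) D))
    (hP : P.map (innovationLinear a) =
      Measure.pi fun k => gaussianReal 0 ((Fin.cons (α := fun _ => ℝ≥0) v₀ v : _ → ℝ≥0) k))
    {M : Fin (n + 1) → Lp ℝ 2 (ν : Measure ((Fin (n + 1) → ℝ) × (Fin (n + 1) → ℝ)))}
    (hM : ∀ k, M k ∈ Submodule.span ℝ (Set.range (outputVector (h.memLp_output hP)))) :
    ((n + 1 : ℕ) : ℝ) ≤ backwardCost a (fun k => (v k : ℝ))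
      (effectiveDistortion a v₀ (fun k => (v k : ℝ)) D)
      (sourceVector (memLp_source hP h.source_law)) M := by
  have h1 := h.rate_eq
  rw [SRDF_eq hv₀ hv hd hP, ENNReal.mul_right_inj (by simp) (by simp)] at h1
  have h2 := ofReal_le_mutualInformation hv₀ hd hP h.source_law (h.memLp_output hP) hM
  rw [h1, ENNReal.ofReal_le_ofReal_iff hd.totalRate_nonneg] at h2
  linarith

/-- The three descriptions of the second-order statistics of a realization. -/
theorem IsRealization.tfae (h : IsRealization P D ν) (hv₀ : 0 < v₀) (hv : ∀ k, 0 < v k)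
    (hd : IsFeasible a v₀ (fun k => (v k : ℝ)) d)
    (hdD : d = effectiveDistortion a v₀ (fun k => (v k : ℝ)) D)
    (hP : P.map (innovationLinear a) =
      Measure.pi fun k => gaussianReal 0 ((Fin.cons (α := fun _ => ℝ≥0) v₀ v : _ → ℝ≥0) k)) :
    List.TFAE [
      ∀ k, ∫ p, (p.2 k - p.1 k) ^ 2
        ∂(ν : Measure ((Fin (n + 1) → ℝ) × (Fin (n + 1) → ℝ))) ≤ d k,
      ∀ j k, j ≤ k → ∫ p, (p.2 k - p.1 k) * p.2 j
        ∂(ν : Measure ((Fin (n + 1) → ℝ) × (Fin (n + 1) → ℝ))) = 0,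
      (outputMoments ν, crossMoments ν) = procedureOne n (sourceMoments P) d] := by
  subst hdD
  have hx := memLp_source hP h.source_law
  have hy := h.memLp_output hP
  have hc := h.isCausalPair hP
  have hmin : ∀ M : Fin (n + 1) → Lp ℝ 2 (ν : Measure ((Fin (n + 1) → ℝ) × (Fin (n + 1) → ℝ))),
      (∀ k, M k ∈ Submodule.span ℝ (Set.range (outputVector hy))) →
      ((n + 1 : ℕ) : ℝ) ≤ backwardCost a (fun k => (v k : ℝ)) _ (sourceVector hx) M :=
    fun M hM => h.le_backwardCost hv₀ hv hd hP hM
  tfae_have 1 → 2 := by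
    intro h1 j k hjk
    obtain ⟨-, hR⟩ := hc.optimality hd hmin
      (fun k => Submodule.subset_span ⟨k, Set.mem_Iic.2 le_rfl, rfl⟩) fun k => by
        rw [norm_source_sub_output]
        exact h1 k
    have h2 := hc.filter_orthogonal hd hR hjk
    rwa [inner_source_sub_output, neg_eq_zero] at h2
  tfae_have 2 → 3 := by
    intro h2
    obtain ⟨M, hM, hle⟩ := hc.exists_estimate (D := D) fun k => by
      rw [norm_source_sub_output]
      exact h.distortion k
    obtain ⟨hnorm, hR⟩ := hc.optimality hd hmin hM hle
    have horth : ∀ j k, j ≤ k →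
        inner ℝ (sourceVector hx k - outputVector hy k) (outputVector hy j) = 0 :=
      fun j k hjk => by rw [inner_source_sub_output, h2 j k hjk, neg_zero]
    obtain rfl := eq_of_filter_orthogonal hM
      (fun j k hjk => hc.filter_orthogonal hd hR hjk) horth
    rw [outputMoments_eq_crossGram hy, crossMoments_eq_crossGram hx hy,
      sourceMoments_eq_crossGram h.source_law hx]
    exact hc.gram_eq_procedureOne hd horth hnorm hR
  tfae_have 3 → 1 := by
    intro h3 k
    obtain ⟨h4, h5⟩ := procedureOne_diag n (sourceMoments P)
      (effectiveDistortion a v₀ (fun k => (v k : ℝ)) D) k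
    rw [← h3] at h4 h5
    rw [outputMoments_eq_crossGram hy, sourceMoments_eq_crossGram h.source_law hx] at h4
    rw [crossMoments_eq_crossGram hx hy, sourceMoments_eq_crossGram h.source_law hx] at h5
    rw [← norm_source_sub_output hx hy, norm_sub_sq_real, real_inner_comm,
      ← real_inner_self_eq_norm_sq, ← real_inner_self_eq_norm_sq]
    simp only [crossGram, Matrix.of_apply] at h4 h5
    linarith
  tfae_finish

end Main

end

/-- The samples are indexed by `Fin (n + 1)`, so that the length is `ℓ = n + 1`. -/
theorem mainTheorem8 (n : ℕ) {Ω : Type*} [MeasurableSpace Ω] (μ : Measure Ω) [IsProbabilityMeasure μ]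
    (a : Fin n → ℝ) (v₀ : ℝ≥0) (v : Fin n → ℝ≥0) (hv₀ : 0 < v₀) (hv : ∀ k, 0 < v k)
    (x : Fin (n + 1) → Ω → ℝ) (ξ : Fin n → Ω → ℝ)
    (hx₀ : HasLaw (x 0) (gaussianReal 0 v₀) μ)
    (hξ : ∀ k, HasLaw (ξ k) (gaussianReal 0 (v k)) μ)
    (hindep : iIndepFun (Fin.cons (α := fun _ => Ω → ℝ) (x 0) ξ) μ)
    (hrec : ∀ k : Fin n, x k.succ =ᵐ[μ] fun ω => a k * x k.castSucc ω + ξ k ω)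
    (D : Fin (n + 1) → ℝ) (hD : ∀ k, 0 < D k)
    (P : Measure (Fin (n + 1) → ℝ)) (hP : P = μ.map (fun ω k => x k ω))
    (d : Fin (n + 1) → ℝ)
    (hd : d = effectiveDistortion a (v₀ : ℝ) (fun k => (v k : ℝ)) D) :
    ((SRDF P D : ℝ≥0∞) : EReal) =
      ((1 / (2 * ((n + 1 : ℕ) : ℝ)) * Real.log ((v₀ : ℝ) / d 0)
        + 1 / (2 * ((n + 1 : ℕ) : ℝ)) *
          ∑ k : Fin n, Real.log ((a k ^ 2 * d k.castSucc + (v k : ℝ)) / d k.succ) : ℝ) : EReal)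
    ∧ (∃ ν : ProbabilityMeasure ((Fin (n + 1) → ℝ) × (Fin (n + 1) → ℝ)),
        IsRealization P D ν
        ∧ IsGaussian (ν : Measure ((Fin (n + 1) → ℝ) × (Fin (n + 1) → ℝ)))
        ∧ (∀ k, ∫ p, p.2 k ∂(ν : Measure ((Fin (n + 1) → ℝ) × (Fin (n + 1) → ℝ))) = 0)
        ∧ (∀ k, ∫ p, (p.2 k - p.1 k) ^ 2
            ∂(ν : Measure ((Fin (n + 1) → ℝ) × (Fin (n + 1) → ℝ))) = d k)
        ∧ (outputMoments ν, crossMoments ν) = procedureOne n (sourceMoments P) d)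
    ∧ (∀ ν : ProbabilityMeasure ((Fin (n + 1) → ℝ) × (Fin (n + 1) → ℝ)),
        IsRealization P D ν →
        List.TFAE [
          ∀ k, ∫ p, (p.2 k - p.1 k) ^ 2
            ∂(ν : Measure ((Fin (n + 1) → ℝ) × (Fin (n + 1) → ℝ))) ≤ d k,
          ∀ j k, j ≤ k → ∫ p, (p.2 k - p.1 k) * p.2 j
            ∂(ν : Measure ((Fin (n + 1) → ℝ) × (Fin (n + 1) → ℝ))) = 0,
          (outputMoments ν, crossMoments ν) = procedureOne n (sourceMoments P) d]) := by
  subst hd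
  have hPlaw : P.map (innovationLinear a) = Measure.pi fun k =>
      gaussianReal 0 ((Fin.cons (α := fun _ => ℝ≥0) v₀ v : _ → ℝ≥0) k) := by
    rw [hP]
    exact map_innovationLinear_source hx₀ hξ hindep hrec
  have hfeas := isFeasible_effectiveDistortion (a := a) (NNReal.coe_pos.2 hv₀)
    (fun k => NNReal.coe_pos.2 (hv k)) hD
  have htfae : ∀ ν : ProbabilityMeasure ((Fin (n + 1) → ℝ) × (Fin (n + 1) → ℝ)),
      IsRealization P D ν → _ := fun ν hν => hν.tfae hv₀ hv hfeas rfl hPlaw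
  refine ⟨?_, ?_, htfae⟩
  · have hn : (0 : ℝ) < ((n + 1 : ℕ) : ℝ) := Nat.cast_pos.2 n.succ_pos
    rw [SRDF_eq hv₀ hv hfeas hPlaw, ← ENNReal.ofReal_natCast, ← ENNReal.ofReal_inv_of_pos hn,
      ← ENNReal.ofReal_mul (inv_nonneg.2 hn.le), EReal.coe_ennreal_ofReal,
      max_eq_left (mul_nonneg (inv_nonneg.2 hn.le) hfeas.totalRate_nonneg), totalRate]
    congr 1
    simp only [predictedVariance]
    field_simp
  · obtain ⟨ν, hg, h : IsFilterLaw a v₀ v _ ν⟩ := exists_gaussian_filter a v₀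
      (fun k => (v k : ℝ)) (effectiveDistortion a v₀ (fun k => (v k : ℝ)) D) _ _
    have hfst := h.fst_eq hv₀ hv hPlaw
    obtain ⟨hadm, hdist⟩ := h.isAdmissible hfeas (effectiveDistortion_le D) hPlaw hfst
    have hreal : IsRealization P D ν :=
      ⟨hadm, by rw [h.mutualInformation_eq hv₀ hfeas hg hPlaw hfst, SRDF_eq hv₀ hv hfeas hPlaw]⟩
    exact ⟨ν, hreal, hg, h.integral_output (memLp_source hPlaw hfst), hdist,
      ((htfae ν hreal).out 0 2).1 fun k => (hdist k).le⟩
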